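/- **Conventions.** Let $\mathbb{E}$ be a field or a complete discrete valuation ring with uniformizer $\varpi$. Let $\mathcal{T}$ be an $\mathbb{E}$-linear triangulated category with a Tate twist, i.e. an $\mathbb{E}$-linear triangulated autoequivalence $\langle 1\rangle$ with powers $\langle k\rangle$, $k\in\mathbb{Z}$. Assume that $\mathcal{T}$ is graded $\mathrm{Hom}$-finite: $\bigoplus_{k}\mathrm{Hom}(X,Y\langle k\rangle)$ is a finitely generated $\mathbb{E}$-module for all $X,Y$. Let $I$ be an ordered set isomorphic to a subset of $(\mathbb{Z}_{\ge 0},\le)$. A *graded exceptional sequence* is a family $(\nabla_i)_{i\in I}$ of objects such that $\mathrm{Hom}(\nabla_i,\nabla_j[n]\langle k\rangle)=0$ for $i<j$ and all $n,k$; $\mathrm{Hom}(\nabla_i,\nabla_i[n]\langle k\rangle)=0$ unless $n=k=0$; $\mathrm{End}(\nabla_i)\cong\mathbb{E}$; and the $\nabla_i\langle k\rangle$ generate $\mathcal{T}$ as a triangulated category. Let $\mathcal{T}_{<i}$, resp. $\mathcal{T}_{\le i}$, be the full triangulated subcategory generated by the $\nabla_j\langle k\rangle$ with $j<i$, resp.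 $j\le i$, and let $\Pi_i:\mathcal{T}_{\le i}\to\mathcal{T}_{\le i}/\mathcal{T}_{<i}$ be the Verdier quotient functor. A family $(\Delta_i)_{i\in I}$ is a *dual sequence* if $\mathrm{Hom}(\Delta_j,\nabla_i[n]\langle k\rangle)=0$ for $i<j$ and all $n,k$, and if $\Delta_i\in\mathcal{T}_{\le i}$ and $\Pi_i(\Delta_i)\cong\Pi_i(\nabla_i)$ for all $i$. Given both, let $\mathcal{T}^{\le 0}$ be generated under extensions by the $\Delta_j[n]\langle k\rangle$ with $n\ge 0$, and $\mathcal{T}^{\ge 0}$ by the $\nabla_j[n]\langle k\rangle$ and, if $\mathbb{E}$ is not a field, the $\bar\nabla_j[n]\langle k\rangle$, with $n\le 0$, where $\bar\nabla_j$ is the cone of $\varpi\cdot\mathrm{id}:\nabla_j\to\nabla_j$. When this is a t-structure, let $\mathscr{A}$ be its heart and $H^0:\mathcal{T}\to\mathscr{A}$ the cohomology functor. A *canonical map* $\Delta_i\to\nabla_i$ is one that $\Pi_i$ sends to an isomorphism, and $L_i:=\mathrm{im}(H^0(\Delta_i)\to H^0(\nabla_i))$ is the image in $\mathscr{A}$ of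 $H^0$ of such a map. If $\mathbb{E}$ is a discrete valuation ring, an object $X$ of $\mathscr{A}$ is *torsion* if $\varpi^n\cdot\mathrm{id}_X=0$ for some $n\ge 1$, and $L_i^+$ denotes the largest subobject of $H^0(\nabla_i)$ that contains $L_i$ and is such that $L_i^+/L_i$ is torsion. The *head* (resp. *socle*) of an object is its largest semisimple quotient (resp. subobject). **Setting.** Let $\mathbb{O}$ be a complete discrete valuation ring with fraction field $\mathbb{K}$ and residue field $\mathbb{F}$. Let $\mathcal{T}_{\mathbb{O}}$, $\mathcal{T}_{\mathbb{K}}$, $\mathcal{T}_{\mathbb{F}}$ be graded $\mathrm{Hom}$-finite triangulated categories with Tate twists, linear over $\mathbb{O}$, $\mathbb{K}$, $\mathbb{F}$ respectively. Let $(\nabla_i)_{i\in I}$ be a graded exceptional sequence in $\mathcal{T}_{\mathbb{O}}$ with a dual sequence $(\Delta_i)_{i\in I}$. Let $\mathbb{K}(-):\mathcal{T}_{\mathbb{O}}\to\mathcal{T}_{\mathbb{K}}$ and $\mathbb{F}(-):\mathcal{T}_{\mathbb{O}}\to\mathcal{T}_{\mathbb{F}}$ be $\mathbb{O}$-linear triangulated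 functors commuting with the Tate twists up to natural isomorphism, such that for all $X,Y\in\mathcal{T}_{\mathbb{O}}$ * $\mathbb{K}(-)$ induces an isomorphism $\mathbb{K}\otimes_{\mathbb{O}}\mathrm{Hom}(X,Y)\cong\mathrm{Hom}(\mathbb{K}(X),\mathbb{K}(Y))$; * there is a short exact sequence, natural in $X$ and $Y$, $$0\to\mathbb{F}\otimes_{\mathbb{O}}\mathrm{Hom}(X,Y)\to\mathrm{Hom}(\mathbb{F}(X),\mathbb{F}(Y))\to\mathrm{Tor}_1^{\mathbb{O}}(\mathbb{F},\mathrm{Hom}(X,Y[1]))\to 0$$ whose first map is induced by $\mathbb{F}(-)$. Assume moreover that $(\mathbb{K}(\nabla_i))_{i\in I}$ and $(\mathbb{F}(\nabla_i))_{i\in I}$ are graded exceptional sequences in $\mathcal{T}_{\mathbb{K}}$ and $\mathcal{T}_{\mathbb{F}}$. **Statement.** The construction above, applied to $(\nabla_i),(\Delta_i)$ over $\mathbb{O}$ and to $(\Bbbk(\nabla_i)),(\Bbbk(\Delta_i))$ over $\Bbbk\in\{\mathbb{K},\mathbb{F}\}$, gives t-structures on $\mathcal{T}_{\mathbb{O}}$,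 $\mathcal{T}_{\mathbb{K}}$, $\mathcal{T}_{\mathbb{F}}$, with hearts $\mathscr{A}_{\mathbb{O}}$, $\mathscr{A}_{\mathbb{K}}$, $\mathscr{A}_{\mathbb{F}}$; in all three cases canonical maps exist for every $i\in I$, and $L_i^+(\mathbb{O})$ exists. Write $L_i(\mathbb{O}),L_i^+(\mathbb{O})\in\mathscr{A}_{\mathbb{O}}$, $L_i(\mathbb{K})\in\mathscr{A}_{\mathbb{K}}$ and $L_i(\mathbb{F})\in\mathscr{A}_{\mathbb{F}}$ for the resulting objects (for any choice of the canonical maps). Then for all $i\in I$: 1. $\mathbb{K}(L_i(\mathbb{O}))\cong\mathbb{K}(L_i^+(\mathbb{O}))\cong L_i(\mathbb{K})$. 2. The objects $\mathbb{F}(L_i(\mathbb{O}))$ and $\mathbb{F}(L_i^+(\mathbb{O}))$ lie in $\mathscr{A}_{\mathbb{F}}$. Moreover, $\mathbb{F}(L_i(\mathbb{O}))$ has a simple head, and $\mathbb{F}(L_i^+(\mathbb{O}))$ has a simple socle, both isomorphic to $L_i(\mathbb{F})$. -/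

import Mathlib

open CategoryTheory CategoryTheory.Limits CategoryTheory.Pretriangulated CategoryTheory.Triangulated
open scoped TensorProduct ZeroObject

universe u u' v v' v'' w w' w'' x

noncomputable section

namespace ExcSeq

/-! ### The heart of a t-structure as an abelian category -/

section Heart

variable {C : Type w} [Category.{v} C] [Preadditive C] [HasZeroObject C] [HasShift C ℤ]
  [∀ n : ℤ, (shiftFunctor C n).Additive] [Pretriangulated C] (t : TStructure C)

/-- The heart of a t-structure, as a full subcategory. -/
abbrev HeartCat : Type w := t.heart.FullSubcategory

theorem heart_hom_shift_neg ⦃X Y : HeartCat t⦄ ⦃n : ℤ⦄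
    (f : t.heart.ι.obj X ⟶ (t.heart.ι.obj Y)⟦n⟧) (hn : n < 0) : f = 0 := by
  have h₁ : t.IsLE X.obj 0 := ((t.mem_heart_iff _).1 X.property).1
  have h₂ : t.IsGE Y.obj 0 := ((t.mem_heart_iff _).1 Y.property).2
  exact t.zero_of_isLE_of_isGE f 0 (-n) (by lia) h₁ (t.isGE_shift Y.obj 0 n (-n) (by lia))

instance heart_containsZero : t.heart.ContainsZero where
  exists_zero := ⟨0, isZero_zero C, (t.mem_heart_iff _).2 ⟨inferInstance, inferInstance⟩⟩

instance heart_closedUnderBinaryProducts : t.heart.IsClosedUnderBinaryProducts where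
  limitsOfShape_le := by
    rintro X ⟨p⟩
    have h₁ := (t.mem_heart_iff _).1 (p.prop_diag_obj (.mk .left))
    have h₂ := (t.mem_heart_iff _).1 (p.prop_diag_obj (.mk .right))
    refine t.heart.prop_of_iso
      (IsLimit.conePointUniqueUpToIso (prodIsProd _ _)
        ((IsLimit.postcomposeHomEquiv (diagramIsoPair p.diag) _).2 p.isLimit))
      ((t.mem_heart_iff _).2
        ⟨t.isLE₂ _ (binaryProductTriangle_distinguished _ _) 0 h₁.1 h₂.1,
          t.isGE₂ _ (binaryProductTriangle_distinguished _ _) 0 h₁.2 h₂.2⟩)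

instance heart_closedUnderFiniteProducts : t.heart.IsClosedUnderFiniteProducts := .mk'

variable [IsTriangulated C]

theorem heart_admissible :
    AbelianSubcategory.admissibleMorphism t.heart.ι = ⊤ := by
  rw [eq_top_iff]
  rintro X₁ X₂ f₁ - X₃ f₂ f₃ hT
  obtain ⟨h₁LE, h₁GE⟩ := (t.mem_heart_iff _).1 X₁.property
  obtain ⟨h₂LE, h₂GE⟩ := (t.mem_heart_iff _).1 X₂.property
  have hs₁ : t.IsLE (X₁.obj⟦(1 : ℤ)⟧) (-1) := t.isLE_shift X₁.obj 0 1 (-1) (by lia)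
  have hs₂ : t.IsGE (X₁.obj⟦(1 : ℤ)⟧) (-1) := t.isGE_shift X₁.obj 0 1 (-1) (by lia)
  have hLE : t.IsLE X₃ 0 := t.isLE₂ _ (rot_of_distTriang _ hT) 0 h₂LE
      (t.isLE_of_le (X₁.obj⟦(1 : ℤ)⟧) (-1) 0 (by lia))
  have hGE : t.IsGE X₃ (-1) := t.isGE₂ _ (rot_of_distTriang _ hT) (-1)
      (t.isGE_of_ge X₂.obj (-1) 0 (by lia)) hs₂
  have hA : t.IsGE ((t.truncLE (-1)).obj X₃) (-1) := inferInstance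
  have hQ : t.heart ((t.truncGE 0).obj X₃) :=
    (t.mem_heart_iff _).2 ⟨inferInstance, inferInstance⟩
  have hK : t.heart (((t.truncLE (-1)).obj X₃)⟦(-1 : ℤ)⟧) :=
    (t.mem_heart_iff _).2 ⟨t.isLE_shift _ (-1) (-1) 0 (by lia), t.isGE_shift _ (-1) (-1) 0 (by lia)⟩
  let e : (((t.truncLE (-1)).obj X₃)⟦(-1 : ℤ)⟧)⟦(1 : ℤ)⟧ ≅ (t.truncLE (-1)).obj X₃ :=
    (shiftEquiv C (1 : ℤ)).counitIso.app _
  refine ⟨⟨_, hK⟩, ⟨_, hQ⟩, e.hom ≫ (t.truncLEι (-1)).app X₃, (t.truncGEπ 0).app X₃,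
    (t.truncGEδLE (-1) 0 (by lia)).app X₃ ≫ e.inv⟦(1 : ℤ)⟧', ?_⟩
  refine isomorphic_distinguished _ (t.triangleLEGE_distinguished (-1) 0 (by lia) X₃) _ ?_
  refine Triangle.isoMk _ _ e (Iso.refl _) (Iso.refl _) ?_ ?_ ?_
  · exact Category.comp_id _
  · exact (Category.comp_id _).trans (Category.id_comp _).symm
  · refine Eq.trans ?_ (Category.id_comp _).symm
    refine (Category.assoc _ _ _).trans ?_
    refine (congrArg (_ ≫ ·) ?_).trans (Category.comp_id _)
    exact ((shiftFunctor C (1 : ℤ)).mapIso e).inv_hom_id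

instance heartAbelian : Abelian (HeartCat t) :=
  AbelianSubcategory.abelian t.heart.ι (heart_hom_shift_neg t) (heart_admissible t)

/-- The zeroth cohomology functor `H⁰ = τ^{≥ 0} τ^{≤ 0}`, with values in the heart. -/
def H0 : C ⥤ HeartCat t :=
  t.heart.lift (t.truncGELE 0 0) fun _ => (t.mem_heart_iff _).2 ⟨inferInstance, inferInstance⟩

end Heart

/-! ### Heads and socles in an abelian category -/

section Abelian

variable {A : Type w} [Category.{v} A] [Abelian A]

attribute [local instance] Abelian.hasFiniteBiproducts

/-- A semisimple object: a finite direct sum of simple objects. -/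
def IsSemisimpleObj (X : A) : Prop :=
  ∃ (n : ℕ) (S : Fin n → A), (∀ j, Simple (S j)) ∧ Nonempty (X ≅ ⨁ S)

/-- `q` exhibits `Q` as the head of `X`, i.e. as the largest semisimple quotient of `X`. -/
structure IsHead {X Q : A} (q : X ⟶ Q) : Prop where
  epi : Epi q
  semisimple : IsSemisimpleObj Q
  factors : ∀ (Q' : A) (q' : X ⟶ Q'), Epi q' → IsSemisimpleObj Q' → ∃ r : Q ⟶ Q', q ≫ r = q'

/-- `s` exhibits `S` as the socle of `X`, i.e. as the largest semisimple subobject of `X`. -/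
structure IsSocle {S X : A} (s : S ⟶ X) : Prop where
  mono : Mono s
  semisimple : IsSemisimpleObj S
  factors : ∀ (S' : A) (s' : S' ⟶ X), Mono s' → IsSemisimpleObj S' → ∃ r : S' ⟶ S, r ≫ s = s'

/-- `X` has a simple head, and it is isomorphic to `S`. -/
def HasSimpleHead (X S : A) : Prop := Simple S ∧ ∃ q : X ⟶ S, IsHead q

/-- `X` has a simple socle, and it is isomorphic to `S`. -/
def HasSimpleSocle (X S : A) : Prop := Simple S ∧ ∃ s : S ⟶ X, IsSocle s

/-- An object killed by a positive power of a uniformizer of the discrete valuation ring `E`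
(whose uniformizers are its irreducible elements). -/
def IsTorsionObj (E : Type u) [CommRing E] [Linear E A] (X : A) : Prop :=
  ∃ ϖ : E, Irreducible ϖ ∧ ∃ n : ℕ, 1 ≤ n ∧ (ϖ ^ n) • 𝟙 X = 0

end Abelian

/-! ### Subcategories generated by objects of a triangulated category -/

section Generation

variable {C : Type w} [Category.{v} C] [Preadditive C] [HasZeroObject C] [HasShift C ℤ]
  [∀ n : ℤ, (shiftFunctor C n).Additive] [Pretriangulated C]

/-- The smallest strictly full triangulated subcategory containing `P`. -/
def triangulatedHull (P : ObjectProperty C) : ObjectProperty C := fun X =>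
  ∀ Q : ObjectProperty C, Q.IsTriangulated → Q.IsClosedUnderIsomorphisms → P ≤ Q → Q X

theorem le_triangulatedHull (P : ObjectProperty C) : P ≤ triangulatedHull P :=
  fun X hX _ _ _ h => h X hX

instance triangulatedHull_closedUnderIso (P : ObjectProperty C) :
    (triangulatedHull P).IsClosedUnderIsomorphisms where
  of_iso e hX Q hQ hQ' h := Q.prop_of_iso e (hX Q hQ hQ' h)

instance triangulatedHull_isTriangulated (P : ObjectProperty C) :
    (triangulatedHull P).IsTriangulated where
  exists_zero := ⟨0, isZero_zero C, fun Q _ _ _ => Q.prop_zero⟩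
  isStableUnderShiftBy a := ⟨fun X hX Q hQ hQ' h => Q.le_shift a X (hX Q hQ hQ' h)⟩
  toIsTriangulatedClosed₂ := .mk' fun T hT h₁ h₃ Q hQ hQ' h =>
    Q.ext_of_isTriangulatedClosed₂ T hT (h₁ Q hQ hQ' h) (h₃ Q hQ hQ' h)

/-- The full subcategory generated by `P` under extensions (it contains the zero objects,
and hence is closed under isomorphisms). -/
inductive extensionHull (P : ObjectProperty C) : C → Prop
  | of_mem (X : C) : P X → extensionHull P X
  | of_isZero (X : C) : IsZero X → extensionHull P X
  | ext (T : Triangle C) : T ∈ distTriang C → extensionHull P T.obj₁ → extensionHull P T.obj₃ →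
      extensionHull P T.obj₂

end Generation

/-! ### Tate twists, graded exceptional sequences, dual sequences -/

section Exceptional

variable (E : Type u) [CommRing E]
variable (C : Type w) [Category.{v} C] [Preadditive C] [Linear E C] [HasZeroObject C]
  [HasShift C ℤ] [∀ n : ℤ, (shiftFunctor C n).Additive] [Pretriangulated C]

/-- A Tate twist: an autoequivalence of `E`-linear triangulated categories. -/
structure TateTwist where
  /-- the functor `⟨1⟩` and its quasi-inverse `⟨-1⟩` -/
  equiv : C ≌ C
  commShift : equiv.functor.CommShift ℤ
  isTriangulated : equiv.functor.IsTriangulated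
  linear : equiv.functor.Linear E

variable {C}

/-- The functor `⟨k⟩`. -/
def TateTwist.twist {E : Type u} [CommRing E] [Linear E C] (τ : TateTwist E C) (k : ℤ) : C ⥤ C :=
  (τ.equiv ^ k).functor

variable {E}

/-- `⨁_k Hom(X, Y⟨k⟩)` is a finitely generated `E`-module for all `X`, `Y`. -/
def IsGradedHomFinite (τ : TateTwist E C) : Prop :=
  ∀ X Y : C, Module.Finite E (DirectSum ℤ fun k => X ⟶ (τ.twist k).obj Y)

variable {I : Type x} [LinearOrder I] (τ : TateTwist E C) (nab del : I → C)

/-- The objects `∇_j⟨k⟩`, for `j` in a subset `J` of `I` and `k ∈ ℤ`. -/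
def twists (J : Set I) : ObjectProperty C := fun X =>
  ∃ j ∈ J, ∃ k : ℤ, X = (τ.twist k).obj (nab j)

/-- `(∇_i)_{i ∈ I}` is an `E`-linear graded exceptional sequence. -/
structure IsGradedExceptional : Prop where
  /-- the ordered set `I` is isomorphic to a subset of `ℕ` -/
  order : Nonempty (I ↪o ℕ)
  hom_lt : ∀ i j : I, i < j → ∀ (n k : ℤ) (f : nab i ⟶ (τ.twist k).obj ((nab j)⟦n⟧)), f = 0
  hom_self : ∀ (i : I) (n k : ℤ), ¬ (n = 0 ∧ k = 0) →
    ∀ f : nab i ⟶ (τ.twist k).obj ((nab i)⟦n⟧), f = 0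
  end_self : ∀ i : I, Nonempty ((nab i ⟶ nab i) ≃ₗ[E] E)
  generates : ∀ X : C, triangulatedHull (twists τ nab Set.univ) X

/-- The triangulated subcategory `T_{< i}`. -/
def Tlt (i : I) : ObjectProperty C := triangulatedHull (twists τ nab (Set.Iio i))

/-- The triangulated subcategory `T_{≤ i}`. -/
def Tle (i : I) : ObjectProperty C := triangulatedHull (twists τ nab (Set.Iic i))

instance Tle_isTriangulated (i : I) : (Tle τ nab i).IsTriangulated :=
  triangulatedHull_isTriangulated _

theorem nab_mem_Tle (i : I) : Tle τ nab i (nab i) :=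
  le_triangulatedHull _ _ ⟨i, le_refl i, 0, rfl⟩

/-- The morphisms of `T_{≤ i}` whose cone lies in `T_{< i}`. -/
def verdierW (i : I) : MorphismProperty (Tle τ nab i).FullSubcategory :=
  ((Tlt τ nab i).inverseImage (Tle τ nab i).ι).trW

/-- The Verdier quotient functor `Π_i : T_{≤ i} ⥤ T_{≤ i} / T_{< i}`. -/
def Pi (i : I) : (Tle τ nab i).FullSubcategory ⥤ (verdierW τ nab i).Localization :=
  (verdierW τ nab i).Q

/-- `(Δ_i)_{i ∈ I}` is a dual sequence to `(∇_i)_{i ∈ I}`. -/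
structure IsDualSequence : Prop where
  hom_lt : ∀ i j : I, i < j → ∀ (n k : ℤ) (f : del j ⟶ (τ.twist k).obj ((nab i)⟦n⟧)), f = 0
  quotient : ∀ i : I, ∃ h : Tle τ nab i (del i),
    Nonempty ((Pi τ nab i).obj ⟨del i, h⟩ ≅ (Pi τ nab i).obj ⟨nab i, nab_mem_Tle τ nab i⟩)

/-- `c : Δ_i ⟶ ∇_i` is a canonical map, i.e. it corresponds under adjunction to an isomorphism
`Π_i(Δ_i) ≅ Π_i(∇_i)`: its image under `Π_i` is an isomorphism. -/
def IsCanonicalMap {i : I} (c : del i ⟶ nab i) : Prop :=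
  ∃ h : Tle τ nab i (del i), IsIso ((Pi τ nab i).map
    (ObjectProperty.homMk c : (⟨del i, h⟩ : (Tle τ nab i).FullSubcategory) ⟶
      ⟨nab i, nab_mem_Tle τ nab i⟩))

/-! ### The t-structure attached to an exceptional sequence, and the objects `L_i`, `L_i⁺` -/

/-- The objects `Δ_j[n]⟨k⟩` with `n ≥ 0`. -/
def genLE : ObjectProperty C := fun X =>
  ∃ (j : I) (n k : ℤ), 0 ≤ n ∧ X = (τ.twist k).obj ((del j)⟦n⟧)

/-- The objects `∇_j[n]⟨k⟩` and `∇̄_j[n]⟨k⟩` with `n ≤ 0`, where `∇̄_j` is any cone of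
multiplication by a uniformizer on `∇_j`. If `E` is a field, there is no irreducible element and
the objects `∇̄_j` are omitted (they are zero by convention). -/
def genGE : ObjectProperty C := fun X =>
  (∃ (j : I) (n k : ℤ), n ≤ 0 ∧ X = (τ.twist k).obj ((nab j)⟦n⟧)) ∨
  (∃ (j : I) (ϖ : E) (Z : C) (g : nab j ⟶ Z) (h : Z ⟶ (nab j)⟦(1 : ℤ)⟧), Irreducible ϖ ∧
    Triangle.mk (ϖ • 𝟙 (nab j)) g h ∈ distTriang C ∧
    ∃ (n k : ℤ), n ≤ 0 ∧ X = (τ.twist k).obj (Z⟦n⟧))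

/-- `t` is the t-structure attached to `(∇_i)` and `(Δ_i)`: `T^{≤ 0}` and `T^{≥ 0}` are generated
under extensions by the objects above. (These two subcategories determine `t`.) -/
structure IsExcTStructure (t : TStructure C) : Prop where
  le_zero : t.le 0 = extensionHull (genLE τ del)
  ge_zero : t.ge 0 = extensionHull (genGE τ nab)

variable {nab del} [IsTriangulated C]

/-- `L_i = im(H⁰(Δ_i) ⟶ H⁰(∇_i))`, as a subobject of `H⁰(∇_i)` in the heart. -/
def Lsub (t : TStructure C) {i : I} (c : del i ⟶ nab i) : Subobject ((H0 t).obj (nab i)) :=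
  imageSubobject ((H0 t).map c)

/-- `L_i`, as an object of the heart. -/
def Lobj (t : TStructure C) {i : I} (c : del i ⟶ nab i) : HeartCat t := (Lsub t c : HeartCat t)

variable (E)

/-- `M` is the largest subobject `L_i⁺` of `H⁰(∇_i)` that contains `L_i` and is such that
`L_i⁺ / L_i` is torsion. -/
def IsLplus (t : TStructure C) {i : I} (c : del i ⟶ nab i)
    (M : Subobject ((H0 t).obj (nab i))) : Prop :=
  IsGreatest {M | ∃ h : Lsub t c ≤ M, IsTorsionObj E (cokernel (Subobject.ofLE _ M h))} M

end Exceptional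

/-! ### Change of scalars -/

section Scalars

variable (O : Type u) [CommRing O]
variable {C : Type w} [Category.{v} C] [Preadditive C] [Linear O C]
variable (k : Type u') [CommRing k] [Algebra O k]
variable {D : Type w'} [Category.{v'} D] [Preadditive D] [Linear k D]

/-- The functor `F` is linear along `O → k`. -/
def IsSemilinear (F : C ⥤ D) : Prop :=
  ∀ (X Y : C) (a : O) (f : X ⟶ Y), F.map (a • f) = algebraMap O k a • F.map f

/-- The map `k ⊗_O Hom(X, Y) → Hom(F(X), F(Y))`, `x ⊗ f ↦ x • F(f)`, induced by `F`. -/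
def baseChangeHom (F : C ⥤ D) [F.Additive] (hF : IsSemilinear O k F) (X Y : C) :
    k ⊗[O] (X ⟶ Y) →+ (F.obj X ⟶ F.obj Y) :=
  TensorProduct.liftAddHom
    (AddMonoidHom.mk' (fun x => AddMonoidHom.mk' (fun f => x • F.map f)
      (by intro f g; simp)) (by intro x y; ext f; simp [add_smul]))
    (by
      intro a x f
      change (a • x) • F.map f = x • F.map (a • f)
      rw [hF X Y a f, smul_smul, Algebra.smul_def, mul_comm])

/-- `F` induces isomorphisms `k ⊗_O Hom(X, Y) ≅ Hom(F(X), F(Y))`. -/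
structure IsGenericFunctor (F : C ⥤ D) [F.Additive] : Prop where
  semilinear : IsSemilinear O k F
  bijective : ∀ X Y : C, Function.Bijective (baseChangeHom O k F semilinear X Y)

end Scalars

section Residue

variable (O : Type u) [CommRing O]
variable {C : Type w} [Category.{u} C] [Preadditive C] [Linear O C] [HasShift C ℤ]
variable (k : Type u) [CommRing k] [Algebra O k]
variable {D : Type w'} [Category.{v'} D] [Preadditive D] [Linear k D]

/-- `Tor_1^O(k, -)`. -/
abbrev Tor1 : ModuleCat.{u} O ⥤ ModuleCat.{u} O := (Tor (ModuleCat.{u} O) 1).obj (ModuleCat.of O k)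

/-- A natural short exact sequence
`k ⊗_O Hom(X, Y) ↪ Hom(F(X), F(Y)) ↠ Tor_1^O(k, Hom(X, Y[1]))`
whose first map is induced by `F`. -/
structure ResidueFunctorData (F : C ⥤ D) [F.Additive] where
  semilinear : IsSemilinear O k F
  δ (X Y : C) : (F.obj X ⟶ F.obj Y) →+ (Tor1 O k).obj (ModuleCat.of O (X ⟶ Y⟦(1 : ℤ)⟧))
  δ_smul (X Y : C) (a : O) (φ : F.obj X ⟶ F.obj Y) :
    δ X Y (algebraMap O k a • φ) = a • δ X Y φ
  injective (X Y : C) : Function.Injective (baseChangeHom O k F semilinear X Y)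
  exact (X Y : C) : Function.Exact (baseChangeHom O k F semilinear X Y) (δ X Y)
  surjective (X Y : C) : Function.Surjective (δ X Y)
  naturality_left {X' X : C} (Y : C) (f : X' ⟶ X) (φ : F.obj X ⟶ F.obj Y) :
    δ X' Y (F.map f ≫ φ) =
      (Tor1 O k).map (ModuleCat.ofHom (Linear.leftComp O (Y⟦(1 : ℤ)⟧) f)) (δ X Y φ)
  naturality_right (X : C) {Y Y' : C} (g : Y ⟶ Y') (φ : F.obj X ⟶ F.obj Y) :
    δ X Y' (φ ≫ F.map g) =
      (Tor1 O k).map (ModuleCat.ofHom (Linear.rightComp O X (g⟦(1 : ℤ)⟧'))) (δ X Y φ)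

end Residue

end ExcSeq

end

/-! A graded sequence is treated as a family indexed by `I × ℤ`, all Tate twists included, with a
level in `ℕ` coming from an embedding of `I`. Duality then says that `D l` has no morphisms to lower
levels and that some `D l ⟶ N l` has a cone of lower level.

The t-structure is glued level by level. A single level behaves like complexes of finitely generated
modules over a principal ideal domain, where truncating amounts to exchanging two factors of an
extension. The maps `D l ⟶ N l` replace the nonnegative part by objects `D l`, up to lower levels
(`levelLT_le_truncation`, `exists_tStructure`).

An object of the heart of level `≤ m` but not `< m` receives a nonzero morphism from some `D l` of
level `m`. Over a field it follows that the canonical map factors through every nonzero subobject of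
`H⁰(N l)`, and that a subobject of `H⁰(D l)` with nonzero image in `H⁰(N l)` is everything. So the
image `L` is simple; moreover, if the canonical map factors through `Z` in the heart, then `Z` has
simple head `L` when `D l ⟶ Z` is epi-like, and simple socle `L` when `Z ⟶ N l` is mono-like
(`hasSimpleHead_image`, `hasSimpleSocle_image`).

Over the discrete valuation ring, morphisms from `T^{≤ 0}` to `N l` are torsion-free, and the
torsion of morphisms from `T^{≤ 0}` to a fixed object of `T^{≥ 0}` is bounded. Hence `L⁺` exists,
and `H⁰(N l) / L⁺` is torsion-free.

Both scalar extensions preserve `T^{≤ 0}`, since they carry the `Δ` to the `Δ`. Over the fraction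
field the cones of the uniformizer die, so the functor is t-exact: it preserves the image `L` and
kills `L⁺ / L`. Over the residue field up to one degree of `T^{≥ 0}` is lost, but torsion-free
objects stay in `T^{≥ 0}`, because the obstruction is a `Tor₁` of a free module
(`ResidueFunctorData.isGE_map`). This applies to `L`, to `L⁺` and to `H⁰(N l) / L⁺`. So both
reductions lie in the heart, that of `L` is still a quotient of `H⁰(D l)`, that of `L⁺` is still a
subobject of `H⁰(N l)`, and the criterion over a field finishes the proof. -/

namespace ExcSeq

set_option linter.unusedSectionVars false

open ObjectProperty

/-! ### Calculus of triangles, extension hulls and extension products. -/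

section ExtensionHull

variable {C : Type w} [Category.{v} C] [Preadditive C] [HasZeroObject C] [HasShift C ℤ]
  [∀ n : ℤ, (shiftFunctor C n).Additive] [Pretriangulated C]

theorem distinguished_of_isos {X Y Z X' Y' Z' : C} {f : X ⟶ Y} {g : Y ⟶ Z} {h : Z ⟶ X⟦(1 : ℤ)⟧}
    {f' : X' ⟶ Y'} {g' : Y' ⟶ Z'} {h' : Z' ⟶ X'⟦(1 : ℤ)⟧}
    (hT : Triangle.mk f g h ∈ distTriang C) (e₁ : X' ≅ X) (e₂ : Y' ≅ Y) (e₃ : Z' ≅ Z)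
    (comm₁ : f' ≫ e₂.hom = e₁.hom ≫ f) (comm₂ : g' ≫ e₃.hom = e₂.hom ≫ g)
    (comm₃ : h' ≫ e₁.hom⟦(1 : ℤ)⟧' = e₃.hom ≫ h) : Triangle.mk f' g' h' ∈ distTriang C :=
  isomorphic_distinguished _ hT _ (Triangle.isoMk _ _ e₁ e₂ e₃ comm₁ comm₂ comm₃)

section Exactness

variable {X Y Z W : C} {f : X ⟶ Y} {g : Y ⟶ Z} {h : Z ⟶ X⟦(1 : ℤ)⟧}
  (hT : Triangle.mk f g h ∈ distTriang C)
include hT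

theorem dist_rotate : Triangle.mk g h (-f⟦(1 : ℤ)⟧') ∈ distTriang C := rot_of_distTriang _ hT

theorem dist_comp₁₂ : f ≫ g = 0 := comp_distTriang_mor_zero₁₂ _ hT

theorem dist_comp₃₁ : h ≫ f⟦(1 : ℤ)⟧' = 0 := comp_distTriang_mor_zero₃₁ _ hT

theorem dist_lift₂ (a : W ⟶ Y) (ha : a ≫ g = 0) : ∃ b : W ⟶ X, b ≫ f = a := by
  obtain ⟨b, hb⟩ := Triangle.coyoneda_exact₂ _ hT a ha
  exact ⟨b, hb.symm⟩

theorem dist_lift₃ (a : W ⟶ Z) (ha : a ≫ h = 0) : ∃ b : W ⟶ Y, b ≫ g = a := by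
  obtain ⟨b, hb⟩ := Triangle.coyoneda_exact₃ _ hT a ha
  exact ⟨b, hb.symm⟩

theorem dist_lift₁ (a : W ⟶ X⟦(1 : ℤ)⟧) (ha : a ≫ f⟦(1 : ℤ)⟧' = 0) : ∃ b : W ⟶ Z, b ≫ h = a := by
  obtain ⟨b, hb⟩ := Triangle.coyoneda_exact₁ _ hT a ha
  exact ⟨b, hb.symm⟩

theorem dist_desc₂ (a : Y ⟶ W) (ha : f ≫ a = 0) : ∃ b : Z ⟶ W, g ≫ b = a := by
  obtain ⟨b, hb⟩ := Triangle.yoneda_exact₂ _ hT a ha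
  exact ⟨b, hb.symm⟩

theorem dist_desc₃ (a : Z ⟶ W) (ha : g ≫ a = 0) : ∃ b : X⟦(1 : ℤ)⟧ ⟶ W, h ≫ b = a := by
  obtain ⟨b, hb⟩ := Triangle.yoneda_exact₃ _ hT a ha
  exact ⟨b, hb.symm⟩

theorem dist_eq_zero₁ (hW : ∀ b : W ⟶ Z⟦(-1 : ℤ)⟧, b = 0) (a : W ⟶ X) (ha : a ≫ f = 0) :
    a = 0 := by
  obtain ⟨b, rfl⟩ := Triangle.coyoneda_exact₂ _ (inv_rot_of_distTriang _ hT) a ha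
  exact (congrArg (· ≫ _) (hW b)).trans zero_comp

theorem dist_eq_zero₃ (hW : ∀ b : X⟦(1 : ℤ)⟧ ⟶ W, b = 0) (a : Z ⟶ W) (ha : g ≫ a = 0) :
    a = 0 := by
  obtain ⟨b, rfl⟩ := dist_desc₃ hT a ha
  rw [hW b, comp_zero]

end Exactness

theorem extensionHull_of_iso {P : ObjectProperty C} {X Y : C} (e : X ≅ Y)
    (hX : extensionHull P X) : extensionHull P Y :=
  extensionHull.ext (Triangle.mk e.hom (0 : Y ⟶ 0) 0)
    (distinguished_of_isos (contractible_distinguished X) (Iso.refl _) e.symm (Iso.refl _)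
      (by simp) (by simp) (by simp)) hX (.of_isZero _ (isZero_zero C))

instance extensionHull_closedUnderIso (P : ObjectProperty C) :
    IsClosedUnderIsomorphisms (extensionHull P) where
  of_iso e hX := extensionHull_of_iso e hX

instance extensionHull_containsZero (P : ObjectProperty C) :
    ContainsZero (extensionHull P) where
  exists_zero := ⟨0, isZero_zero C, .of_isZero _ (isZero_zero C)⟩

instance extensionHull_closed₂ (P : ObjectProperty C) :
    IsTriangulatedClosed₂ (extensionHull P) :=
  .mk' fun T hT h₁ h₃ => .ext T hT h₁ h₃

theorem le_extensionHull (P : ObjectProperty C) : P ≤ extensionHull P := fun X hX => .of_mem X hX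

theorem extensionHull_le {P Q : ObjectProperty C} [Q.IsClosedUnderIsomorphisms] [Q.ContainsZero]
    [Q.IsTriangulatedClosed₂] (h : P ≤ Q) : extensionHull P ≤ Q := by
  intro X hX
  induction hX with
  | of_mem X hX => exact h X hX
  | of_isZero X hX => exact Q.prop_of_isZero hX
  | ext T hT _ _ h₁ h₃ => exact Q.ext_of_isTriangulatedClosed₂ T hT h₁ h₃

theorem extensionHull_mono {P Q : ObjectProperty C} (h : P ≤ Q) :
    extensionHull P ≤ extensionHull Q :=
  extensionHull_le (h.trans (le_extensionHull Q))

theorem extensionHull_shift {P Q : ObjectProperty C} (a : ℤ)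
    (h : ∀ X, P X → extensionHull Q (X⟦a⟧)) {X : C} (hX : extensionHull P X) :
    extensionHull Q (X⟦a⟧) := by
  induction hX with
  | of_mem X hX => exact h X hX
  | of_isZero X hX => exact .of_isZero _ (Functor.map_isZero _ hX)
  | ext T hT _ _ h₁ h₃ => exact .ext _ (Triangle.shift_distinguished T hT a) h₁ h₃

theorem extensionHull_map {D : Type w'} [Category.{v'} D] [Preadditive D] [HasZeroObject D]
    [HasShift D ℤ] [∀ n : ℤ, (shiftFunctor D n).Additive] [Pretriangulated D]
    (F : C ⥤ D) [F.CommShift ℤ] [F.IsTriangulated] {P : ObjectProperty C} {Q : ObjectProperty D}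
    (h : ∀ X, P X → extensionHull Q (F.obj X)) {X : C} (hX : extensionHull P X) :
    extensionHull Q (F.obj X) := by
  induction hX with
  | of_mem X hX => exact h X hX
  | of_isZero X hX => exact .of_isZero _ (Functor.map_isZero _ hX)
  | ext T hT _ _ h₁ h₃ => exact .ext _ (F.map_distinguished T hT) h₁ h₃

theorem extensionHull_hom_eq_zero {P Q : ObjectProperty C}
    (h : ∀ X Y, P X → Q Y → ∀ f : X ⟶ Y, f = 0) {X Y : C} (hX : extensionHull P X)
    (hY : extensionHull Q Y) (f : X ⟶ Y) : f = 0 := by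
  have h₁ : extensionHull P ≤ Q.leftOrthogonal := by
    refine extensionHull_le fun X hX Y f hY => h X Y hX hY f
  have h₂ : extensionHull Q ≤ (rightOrthogonal (extensionHull P)) :=
    extensionHull_le fun Y hY X f hX => h₁ X hX f hY
  exact h₂ Y hY f hX

/-- The shift of a vanishing statement for morphisms. -/
theorem hom_shift_eq_zero {X Y : C} (a b : ℤ) (h : ∀ f : X ⟶ Y⟦b - a⟧, f = 0)
    (f : X⟦a⟧ ⟶ Y⟦b⟧) : f = 0 := by
  let e := (shiftFunctorAdd' C (b - a) a b (by lia)).app Y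
  obtain ⟨g, hg⟩ := (shiftFunctor C a).map_surjective (f ≫ e.hom)
  rw [h g, Functor.map_zero] at hg
  rw [← cancel_mono e.hom, ← hg, zero_comp]

theorem triangulatedHull_le {P Q : ObjectProperty C} [Q.IsTriangulated]
    [Q.IsClosedUnderIsomorphisms] (h : P ≤ Q) : triangulatedHull P ≤ Q :=
  fun _ hX => hX Q inferInstance inferInstance h

theorem triangulatedHull_mono {P Q : ObjectProperty C} (h : P ≤ Q) :
    triangulatedHull P ≤ triangulatedHull Q :=
  triangulatedHull_le (h.trans (le_triangulatedHull Q))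

/-- The objects isomorphic to a shift of an object of `P`. -/
def shiftClosure (P : ObjectProperty C) : ObjectProperty C :=
  fun X => ∃ (Y : C) (n : ℤ), P Y ∧ Nonempty (X ≅ Y⟦n⟧)

instance shiftClosure_isStableUnderShift (P : ObjectProperty C) :
    (shiftClosure P).IsStableUnderShift ℤ where
  isStableUnderShiftBy a := ⟨fun _ ⟨Y, n, hY, ⟨e⟩⟩ =>
    ⟨Y, n + a, hY, ⟨(shiftFunctor C a).mapIso e ≪≫ ((shiftFunctorAdd C n a).app Y).symm⟩⟩⟩

/-- Orthogonals of shift-stable classes are triangulated, so the vanishing propagates from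
generators first in the source, then in the target. -/
theorem triangulatedHull_hom_eq_zero {P Q : ObjectProperty C}
    (h : ∀ X Y, P X → Q Y → ∀ (n : ℤ) (f : X ⟶ Y⟦n⟧), f = 0) {X Y : C}
    (hX : triangulatedHull P X) (hY : triangulatedHull Q Y) (f : X ⟶ Y) : f = 0 := by
  have h₁ : triangulatedHull P ≤ (shiftClosure Q).leftOrthogonal := by
    refine triangulatedHull_le fun X hX Y f ⟨Z, n, hZ, ⟨e⟩⟩ => ?_
    rw [← cancel_mono e.hom, h X Z hX hZ n (f ≫ e.hom), zero_comp]
  have h₂ : triangulatedHull Q ≤ (triangulatedHull P).rightOrthogonal :=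
    triangulatedHull_le fun Y hY X f hX =>
      h₁ X hX f ⟨Y, 0, hY, ⟨((shiftFunctorZero C ℤ).app Y).symm⟩⟩
  exact h₂ Y hY f hX

theorem triangulatedHull_hom_shift_eq_zero {P Q : ObjectProperty C}
    (h : ∀ X Y, P X → Q Y → ∀ (n : ℤ) (f : X ⟶ Y⟦n⟧), f = 0) {X Y : C}
    (hX : triangulatedHull P X) (hY : triangulatedHull Q Y) (n : ℤ) (f : X ⟶ Y⟦n⟧) : f = 0 :=
  triangulatedHull_hom_eq_zero h hX ((triangulatedHull Q).le_shift n _ hY) f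

theorem extensionProduct_mono {P P' Q Q' : ObjectProperty C} (h : P ≤ P') (h' : Q ≤ Q') :
    extensionProduct P Q ≤ extensionProduct P' Q' :=
  (monotone_extensionProduct_left Q h).trans (monotone_extensionProduct_right P' h')

/-- Extensions without connecting morphism split, so that the order of the factors may be
exchanged. -/
theorem extensionProduct_of_mor₃_eq_zero {U V : ObjectProperty C} {T : Triangle C}
    (hT : T ∈ distTriang C) (h : T.mor₃ = 0) (h₁ : V T.obj₁) (h₃ : U T.obj₃) :
    extensionProduct U V T.obj₂ := by
  obtain ⟨e, -, -⟩ := exists_iso_binaryBiproduct_of_distTriang T hT h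
  exact ObjectProperty.prop_of_iso _ (e ≪≫ biprod.braiding _ _).symm
    ⟨_, _, _, _, _, binaryBiproductTriangle_distinguished T.obj₃ T.obj₁, h₃, h₁⟩

theorem extensionProduct_swap {U V : ObjectProperty C}
    (h : ∀ X Y, U X → V Y → ∀ f : X ⟶ Y⟦(1 : ℤ)⟧, f = 0) :
    extensionProduct V U ≤ extensionProduct U V := by
  rintro X ⟨Y, Z, f, g, k, hT, hY, hZ⟩
  exact extensionProduct_of_mor₃_eq_zero hT (h _ _ hZ hY k) hY hZ

theorem extensionProduct_self_le (U : ObjectProperty C) [U.IsTriangulatedClosed₂]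
    [U.IsClosedUnderIsomorphisms] : extensionProduct U U ≤ U :=
  extensionProduct_le_of_isTriangulatedClosed₂ le_rfl le_rfl

variable [IsTriangulated C]

/-- By associativity `(UV)(UV) = U(VU)V`; swapping the middle factors leads into `(UU)(VV) ≤ UV`. -/
theorem extensionProduct_closed₂ {U V : ObjectProperty C} [U.IsTriangulatedClosed₂]
    [U.IsClosedUnderIsomorphisms] [V.IsTriangulatedClosed₂] [V.IsClosedUnderIsomorphisms]
    (h : extensionProduct V U ≤ extensionProduct U V) :
    (extensionProduct U V).IsTriangulatedClosed₂ := by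
  refine .mk' fun T hT h₁ h₃ => ?_
  have h₂ : extensionProduct (extensionProduct U V) (extensionProduct U V) T.obj₂ :=
    ⟨_, _, _, _, _, hT, h₁, h₃⟩
  rw [extensionProduct_assoc, ← extensionProduct_assoc V] at h₂
  have h₄ := extensionProduct_mono (le_refl U) (extensionProduct_mono h (le_refl V)) _ h₂
  rw [extensionProduct_assoc, ← extensionProduct_assoc U] at h₄
  exact extensionProduct_mono (extensionProduct_self_le U) (extensionProduct_self_le V) _ h₄

theorem extensionProduct_isTriangulated {U V : ObjectProperty C} [U.IsTriangulated]
    [U.IsClosedUnderIsomorphisms] [V.IsTriangulated] [V.IsClosedUnderIsomorphisms]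
    (h : extensionProduct V U ≤ extensionProduct U V) :
    (extensionProduct U V).IsTriangulated where
  exists_zero := ⟨0, isZero_zero C, le_extensionProduct_left V _ U.prop_zero⟩
  toIsTriangulatedClosed₂ := extensionProduct_closed₂ h

/-- If every extension of an object of `A` by an object of `B` is also an extension in the
opposite order, then the same holds for the subcategories generated under extensions. -/
theorem extensionHull_swap {A B : ObjectProperty C} [A.IsClosedUnderIsomorphisms] [A.ContainsZero]
    (h : extensionProduct B A ≤ extensionProduct A (extensionHull B)) :
    extensionProduct (extensionHull B) (extensionHull A) ≤
      extensionProduct (extensionHull A) (extensionHull B) := by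
  -- Double induction: here the left factor is built up against a single object of `A`; `key''` then
  -- builds up the right factor.
  have key : ∀ X, extensionHull B X →
      extensionProduct (fun Z => Z = X) A ≤ extensionProduct A (extensionHull B) := by
    intro X hX
    induction hX with
    | of_mem X hX => exact (monotone_extensionProduct_left A (by rintro _ rfl; exact hX)).trans h
    | of_isZero X hX =>
      rintro Y ⟨X', Z, f, g, k, hT, rfl, hZ⟩
      have : IsIso g := (Triangle.isZero₁_iff_isIso₂ _ hT).1 hX
      exact le_extensionProduct_left _ _ (A.prop_of_iso (asIso g).symm hZ)
    | ext T hT _ _ h₁ h₃ =>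
      have e₁ : (fun Z => Z = T.obj₂) ≤
          extensionProduct (fun Z => Z = T.obj₁) (fun Z => Z = T.obj₃) := by
        rintro _ rfl
        exact ⟨_, _, _, _, _, hT, rfl, rfl⟩
      refine (monotone_extensionProduct_left A e₁).trans ?_
      rw [extensionProduct_assoc]
      refine (monotone_extensionProduct_right _ h₃).trans ?_
      rw [← extensionProduct_assoc]
      refine (monotone_extensionProduct_left _ h₁).trans ?_
      rw [extensionProduct_assoc]
      exact monotone_extensionProduct_right _ (extensionProduct_self_le _)
  have key' : extensionProduct (extensionHull B) A ≤ extensionProduct A (extensionHull B) := by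
    rintro X ⟨Y, Z, f, g, k, hT, hY, hZ⟩
    exact key Y hY X ⟨Y, Z, f, g, k, hT, rfl, hZ⟩
  have key'' : ∀ X, extensionHull A X →
      extensionProduct (extensionHull B) (fun Z => Z = X) ≤
        extensionProduct (extensionHull A) (extensionHull B) := by
    intro X hX
    induction hX with
    | of_mem X hX =>
      refine (monotone_extensionProduct_right _ ?_).trans
        (key'.trans (monotone_extensionProduct_left _ (le_extensionHull A)))
      rintro _ rfl
      exact hX
    | of_isZero X hX =>
      rintro Y ⟨X', Z, f, g, k, hT, hX', rfl⟩
      have : IsIso f := (Triangle.isZero₃_iff_isIso₁ _ hT).1 hX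
      exact le_extensionProduct_right _ _ (extensionHull_of_iso (asIso f) hX')
    | ext T hT _ _ h₁ h₃ =>
      have e₁ : (fun Z => Z = T.obj₂) ≤
          extensionProduct (fun Z => Z = T.obj₁) (fun Z => Z = T.obj₃) := by
        rintro _ rfl
        exact ⟨_, _, _, _, _, hT, rfl, rfl⟩
      refine (monotone_extensionProduct_right _ e₁).trans ?_
      rw [← extensionProduct_assoc]
      refine (monotone_extensionProduct_left _ h₁).trans ?_
      rw [extensionProduct_assoc]
      refine (monotone_extensionProduct_right _ h₃).trans ?_
      rw [← extensionProduct_assoc]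
      exact monotone_extensionProduct_left _ (extensionProduct_self_le _)
  rintro X ⟨Y, Z, f, g, k, hT, hY, hZ⟩
  exact key'' Z hZ X ⟨Y, Z, f, g, k, hT, hY, rfl⟩

end ExtensionHull

/-! ### Exceptional and dual families with a level function, and semi-orthogonal decompositions. -/

section Families

variable {C : Type w} [Category.{v} C] [Preadditive C] [HasZeroObject C] [HasShift C ℤ]
  [∀ n : ℤ, (shiftFunctor C n).Additive] [Pretriangulated C]
variable {Λ : Type x} (lev : Λ → ℕ) (N D : Λ → C)

/-- The triangulated subcategory generated by the objects of a family of level `< m`. -/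
def levelLT (m : ℕ) : ObjectProperty C := triangulatedHull fun X => ∃ l, lev l < m ∧ X = N l

/-- The triangulated subcategory generated by the objects of a family of level `m`. -/
def levelEq (m : ℕ) : ObjectProperty C := triangulatedHull fun X => ∃ l, lev l = m ∧ X = N l

instance levelLT_isTriangulated (m : ℕ) : (levelLT lev N m).IsTriangulated :=
  triangulatedHull_isTriangulated _

instance levelLT_closedUnderIso (m : ℕ) : (levelLT lev N m).IsClosedUnderIsomorphisms :=
  triangulatedHull_closedUnderIso _

instance levelEq_isTriangulated (m : ℕ) : (levelEq lev N m).IsTriangulated :=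
  triangulatedHull_isTriangulated _

instance levelEq_closedUnderIso (m : ℕ) : (levelEq lev N m).IsClosedUnderIsomorphisms :=
  triangulatedHull_closedUnderIso _

theorem levelLT_mono {m n : ℕ} (h : m ≤ n) : levelLT lev N m ≤ levelLT lev N n :=
  triangulatedHull_mono fun _ ⟨l, hl, e⟩ => ⟨l, hl.trans_le h, e⟩

theorem mem_levelLT {l : Λ} {m : ℕ} (h : lev l < m) : levelLT lev N m (N l) :=
  le_triangulatedHull _ _ ⟨l, h, rfl⟩

theorem mem_levelEq (l : Λ) : levelEq lev N (lev l) (N l) :=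
  le_triangulatedHull _ _ ⟨l, rfl, rfl⟩

theorem isZero_of_levelLT_zero {X : C} (h : levelLT lev N 0 X) : IsZero X := by
  have : levelLT lev N 0 ≤ (⊤ : ObjectProperty C).leftOrthogonal :=
    triangulatedHull_le (by rintro X ⟨l, hl, -⟩; exact absurd hl (Nat.not_lt_zero _))
  rw [IsZero.iff_id_eq_zero]
  exact this X h (𝟙 X) trivial

/-- An exceptional family, with linear order relaxed to a level function, the Tate twists being
part of the index set. -/
structure IsExceptionalFamily (E : Type u) [CommRing E] [Linear E C] : Prop where
  hom_ne : ∀ l m : Λ, lev l ≤ lev m → l ≠ m → ∀ (n : ℤ) (f : N l ⟶ (N m)⟦n⟧), f = 0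
  hom_self : ∀ (l : Λ) (n : ℤ), n ≠ 0 → ∀ f : N l ⟶ (N l)⟦n⟧, f = 0
  bijective_smul_id : ∀ l : Λ, Function.Bijective fun a : E => a • 𝟙 (N l)
  generates : ∀ X : C, triangulatedHull (fun X => ∃ l, X = N l) X

/-- A family dual to an exceptional family. -/
structure IsDualFamily : Prop where
  hom_lt : ∀ l m : Λ, lev m < lev l → ∀ (n : ℤ) (f : D l ⟶ (N m)⟦n⟧), f = 0
  exists_canonical : ∀ l : Λ, ∃ c : D l ⟶ N l, (levelLT lev N (lev l)).trW c

variable {lev N D} {E : Type u} [CommRing E] [Linear E C]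

theorem IsDualFamily.hom_levelLT (hD : IsDualFamily lev N D) {l : Λ} {m : ℕ} (h : m ≤ lev l)
    {X : C} (hX : levelLT lev N m X) (n : ℤ) (f : D l ⟶ X⟦n⟧) : f = 0 := by
  refine triangulatedHull_hom_shift_eq_zero (P := fun X => X = D l) ?_
    (le_triangulatedHull _ _ rfl) hX n f
  rintro _ _ rfl ⟨p, hp, rfl⟩ n f
  exact hD.hom_lt l p (by lia) n f

theorem IsDualFamily.levelEq_hom_levelLT (hD : IsDualFamily lev N D) {m : ℕ}
    {X Y : C} (hX : levelEq lev D m X) (hY : levelLT lev N m Y) (f : X ⟶ Y) : f = 0 := by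
  refine triangulatedHull_hom_eq_zero ?_ hX hY f
  rintro _ _ ⟨l, rfl, rfl⟩ ⟨p, hp, rfl⟩ n f
  exact hD.hom_lt l p hp n f

theorem IsDualFamily.del_mem (hD : IsDualFamily lev N D) (l : Λ) :
    levelLT lev N (lev l + 1) (D l) := by
  obtain ⟨c, Z, g, h, hT, hZ⟩ := hD.exists_canonical l
  exact (levelLT lev N (lev l + 1)).ext_of_isTriangulatedClosed₁ _ hT
    (mem_levelLT lev N (Nat.lt_succ_self _)) (levelLT_mono lev N (Nat.le_succ _) _ hZ)

namespace IsExceptionalFamily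

variable (hN : IsExceptionalFamily lev N E)
include hN

theorem levelLT_hom {m : ℕ} {p : Λ} (h : m ≤ lev p)
    {X : C} (hX : levelLT lev N m X) (n : ℤ) (f : X ⟶ (N p)⟦n⟧) : f = 0 := by
  refine triangulatedHull_hom_shift_eq_zero (Q := fun X => X = N p) ?_ hX
    (le_triangulatedHull _ _ rfl) n f
  rintro _ _ ⟨l, hl, rfl⟩ rfl n f
  exact hN.hom_ne l p (by lia) (by rintro rfl; lia) n f

theorem levelLT_hom_levelEq {m : ℕ}
    {X Y : C} (hX : levelLT lev N m X) (hY : levelEq lev N m Y) (f : X ⟶ Y) : f = 0 := by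
  refine triangulatedHull_hom_eq_zero ?_ hX hY f
  rintro _ _ ⟨l, hl, rfl⟩ ⟨p, hp, rfl⟩ n f
  exact hN.hom_ne l p (by lia) (by rintro rfl; lia) n f

/-- The increasing union of the `levelLT lev N m` is triangulated and contains the generators, so
induction on the level reaches every object. -/
theorem exists_levelLT (X : C) : ∃ m, levelLT lev N m X := by
  let Q : ObjectProperty C := fun X => ∃ m, levelLT lev N m X
  have : Q.IsClosedUnderIsomorphisms :=
    ⟨fun e ⟨m, hm⟩ => ⟨m, (levelLT lev N m).prop_of_iso e hm⟩⟩
  have : Q.IsTriangulated :=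
    { exists_zero := ⟨0, isZero_zero C, 0, (levelLT lev N 0).prop_zero⟩
      isStableUnderShiftBy := fun a =>
        ⟨fun X ⟨m, hm⟩ => ⟨m, (levelLT lev N m).le_shift a X hm⟩⟩
      toIsTriangulatedClosed₂ := .mk' fun T hT ⟨m, hm⟩ ⟨n, hn⟩ => ⟨max m n,
        (levelLT lev N (max m n)).ext_of_isTriangulatedClosed₂ T hT
          (levelLT_mono lev N (le_max_left m n) _ hm)
          (levelLT_mono lev N (le_max_right m n) _ hn)⟩ }
  refine hN.generates X Q inferInstance inferInstance ?_
  rintro _ ⟨l, rfl⟩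
  exact ⟨lev l + 1, mem_levelLT lev N (Nat.lt_succ_self _)⟩

/-- The cone of `c` has lower level, and lower levels have no morphisms to shifts of `N p`. -/
theorem canonical_comp_bijective {l : Λ} {Y : C} {c : Y ⟶ N l}
    (hc : (levelLT lev N (lev l)).trW c) {p : Λ} (hp : lev l ≤ lev p) (n : ℤ) :
    Function.Bijective fun f : N l ⟶ (N p)⟦n⟧ => c ≫ f := by
  have : (levelLT lev N (lev l)).trW.isLocal ((N p)⟦n⟧) := by
    rw [isLocal_trW]
    exact fun X f hX => hN.levelLT_hom hp hX n f
  exact this c hc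

/-- For `p` of lower level this is duality; otherwise morphisms from `D l` are the same as morphisms
from `N l`. -/
theorem del_hom_eq_zero (hD : IsDualFamily lev N D) {l p : Λ} (h : l ≠ p) (n : ℤ)
    (f : D l ⟶ (N p)⟦n⟧) : f = 0 := by
  rcases lt_or_ge (lev p) (lev l) with hlt | hle
  · exact hD.hom_lt l p hlt n f
  · obtain ⟨c, hc⟩ := hD.exists_canonical l
    obtain ⟨g, rfl⟩ := (hN.canonical_comp_bijective hc hle n).2 f
    simp [hN.hom_ne l p hle h n g]

theorem del_hom_self_eq_zero (hD : IsDualFamily lev N D) (l : Λ) {n : ℤ} (hn : n ≠ 0)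
    (f : D l ⟶ (N l)⟦n⟧) : f = 0 := by
  obtain ⟨c, hc⟩ := hD.exists_canonical l
  obtain ⟨g, rfl⟩ := (hN.canonical_comp_bijective hc le_rfl n).2 f
  simp [hN.hom_self l n hn g]

theorem bijective_smul_canonical {l : Λ} {Y : C} {c : Y ⟶ N l}
    (hc : (levelLT lev N (lev l)).trW c) : Function.Bijective fun a : E => a • c := by
  have h : Function.Bijective fun f : N l ⟶ N l => c ≫ f := by
    have : (levelLT lev N (lev l)).trW.isLocal (N l) := by
      rw [isLocal_trW]
      intro X f hX
      let e := (shiftFunctorZero C ℤ).symm.app (N l)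
      rw [← cancel_mono e.hom, hN.levelLT_hom le_rfl hX 0 (f ≫ e.hom), zero_comp]
    exact this c hc
  convert h.comp (hN.bijective_smul_id l) using 1
  ext a
  simp

section

variable [IsTriangulated C]

/-- Extensions in the wrong order split by semi-orthogonality, so the extension product is
triangulated; it contains the generators. -/
theorem levelLT_succ_le_nab (m : ℕ) :
    levelLT lev N (m + 1) ≤ extensionProduct (levelLT lev N m) (levelEq lev N m) := by
  have := extensionProduct_isTriangulated (U := levelLT lev N m) (V := levelEq lev N m)
    (extensionProduct_swap fun X Y hX hY f =>
      hN.levelLT_hom_levelEq hX ((levelEq lev N m).le_shift 1 Y hY) f)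
  refine triangulatedHull_le ?_
  rintro _ ⟨l, hl, rfl⟩
  rcases Nat.lt_succ_iff_lt_or_eq.1 hl with h | rfl
  · exact le_extensionProduct_left _ _ (mem_levelLT lev N h)
  · exact le_extensionProduct_right _ _ (mem_levelEq lev N l)

/-- An object of level `≤ m` without morphisms to the `N l` of level `m` is of level `< m`. -/
theorem mem_levelLT_of_hom_nab {m : ℕ} {X : C} (hX : levelLT lev N (m + 1) X)
    (h : ∀ l, lev l = m → ∀ (n : ℤ) (f : X ⟶ (N l)⟦n⟧), f = 0) : levelLT lev N m X := by
  obtain ⟨V, d, f, g, k, hT, hV, hd⟩ := hN.levelLT_succ_le_nab m X hX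
  have hg : g = 0 := by
    refine triangulatedHull_hom_eq_zero (P := fun Y => Y = X) ?_ (le_triangulatedHull _ _ rfl) hd g
    rintro _ _ rfl ⟨l, hl, rfl⟩ n f
    exact h l hl n f
  -- As `g = 0`, the identity of `d` factors through `V⟦1⟧`, which has no morphisms to `d`; hence `d
  -- = 0`.
  obtain ⟨r, hr⟩ := dist_desc₃ hT (𝟙 d) (by rw [hg, zero_comp])
  have hd0 : IsZero d := by
    rw [IsZero.iff_id_eq_zero, ← hr,
      hN.levelLT_hom_levelEq ((levelLT lev N m).le_shift 1 V hV) hd r, comp_zero]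
  have : IsIso f := (Triangle.isZero₃_iff_isIso₁ _ hT).1 hd0
  exact (levelLT lev N m).prop_of_iso (asIso f) hV

end

end IsExceptionalFamily

section

variable [IsTriangulated C]

theorem IsDualFamily.levelLT_succ_le_del (hD : IsDualFamily lev N D) (m : ℕ) :
    levelLT lev N (m + 1) ≤ extensionProduct (levelEq lev D m) (levelLT lev N m) := by
  have := extensionProduct_isTriangulated (U := levelEq lev D m) (V := levelLT lev N m)
    (extensionProduct_swap fun X Y hX hY f =>
      hD.levelEq_hom_levelLT hX ((levelLT lev N m).le_shift 1 Y hY) f)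
  refine triangulatedHull_le ?_
  rintro _ ⟨l, hl, rfl⟩
  rcases Nat.lt_succ_iff_lt_or_eq.1 hl with h | rfl
  · exact le_extensionProduct_right _ _ (mem_levelLT lev N h)
  · obtain ⟨c, Z, g, h, hT, hZ⟩ := hD.exists_canonical l
    exact ⟨_, _, _, _, _, hT, mem_levelEq lev D l, hZ⟩

/-- An object of level `≤ m` without morphisms from the `D l` of level `m` is of level `< m`. -/
theorem IsDualFamily.mem_levelLT_of_del_hom (hD : IsDualFamily lev N D) {m : ℕ} {X : C}
    (hX : levelLT lev N (m + 1) X)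
    (h : ∀ l, lev l = m → ∀ (n : ℤ) (f : D l ⟶ X⟦n⟧), f = 0) : levelLT lev N m X := by
  obtain ⟨U, V, f, g, k, hT, hU, hV⟩ := hD.levelLT_succ_le_del m X hX
  have hf : f = 0 := by
    refine triangulatedHull_hom_eq_zero (Q := fun Y => Y = X) ?_ hU (le_triangulatedHull _ _ rfl) f
    rintro _ _ ⟨l, hl, rfl⟩ rfl n f
    exact h l hl n f
  obtain ⟨r, hr⟩ := dist_lift₁ hT (𝟙 (U⟦(1 : ℤ)⟧)) (by rw [hf, Functor.map_zero, comp_zero])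
  have hU0 : IsZero U := by
    rw [IsZero.iff_id_eq_zero]
    refine (shiftFunctor C (1 : ℤ)).map_injective ?_
    rw [CategoryTheory.Functor.map_id, Functor.map_zero, ← hr,
      hD.levelEq_hom_levelLT ((levelEq lev D m).le_shift 1 U hU) hV r, zero_comp]
  have : IsIso g := (Triangle.isZero₁_iff_isIso₂ _ hT).1 hU0
  exact (levelLT lev N m).prop_of_iso (asIso g).symm hV

end

end Families

/-! ### Truncation inside a single level. -/

section Truncation

variable {C : Type w} [Category.{v} C] [Preadditive C] [HasZeroObject C] [HasShift C ℤ]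
  [∀ n : ℤ, (shiftFunctor C n).Additive] [Pretriangulated C]

theorem hom_eq_zero_of_shift_isos {X Y X' Y' : C} {a b k : ℤ} (h : ∀ f : X ⟶ Y⟦k⟧, f = 0)
    (hk : k = b - a) (e : X' ≅ X⟦a⟧) (e' : Y' ≅ Y⟦b⟧) (f : X' ⟶ Y') : f = 0 := by
  subst hk
  have := hom_shift_eq_zero a b h (e.inv ≫ f ≫ e'.hom)
  rw [← cancel_epi e.inv, ← cancel_mono e'.hom, Category.assoc, this, comp_zero, zero_comp]

/-- The isomorphism `X⟦a⟧⟦b⟧ ≅ X⟦c⟧` for `a + b = c`. -/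
noncomputable def shiftShiftIso (X : C) (a b c : ℤ) (h : a + b = c) : X⟦a⟧⟦b⟧ ≅ X⟦c⟧ :=
  ((shiftFunctorAdd' C a b c h).app X).symm

/-- The isomorphism `X⟦0⟧ ≅ X`. -/
noncomputable def shiftZeroIso (X : C) : X⟦(0 : ℤ)⟧ ≅ X := (shiftFunctorZero C ℤ).app X

theorem extensionHull_of_shift_iso {P Q : ObjectProperty C} (a : ℤ)
    (h : ∀ X, P X → extensionHull Q (X⟦a⟧)) {X Y : C} (e : Y ≅ X⟦a⟧) (hX : extensionHull P X) :
    extensionHull Q Y :=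
  extensionHull_of_iso e.symm (extensionHull_shift a h hX)

theorem triangulatedHull_le_extensionHull (P : ObjectProperty C) :
    triangulatedHull P ≤ extensionHull (shiftClosure P) := by
  have : ObjectProperty.IsTriangulated (extensionHull (shiftClosure P)) :=
    { isStableUnderShiftBy := fun a => ⟨fun X hX => extensionHull_shift a
        (fun X hX => .of_mem _ ((shiftClosure P).le_shift a X hX)) hX⟩ }
  exact triangulatedHull_le fun X hX => .of_mem _ ⟨X, 0, hX, ⟨(shiftZeroIso X).symm⟩⟩

/-- The third rotation of a triangle, with two of its objects replaced by isomorphic ones. -/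
theorem exists_dist_of_isos {b Y a A B : C} {i : b ⟶ Y} {p : Y ⟶ a} {f : a ⟶ b⟦(1 : ℤ)⟧}
    (hT : Triangle.mk i p f ∈ distTriang C) (ea : a ≅ A) (eb : b⟦(1 : ℤ)⟧ ≅ B) :
    ∃ (g : B ⟶ Y⟦(1 : ℤ)⟧) (h : Y⟦(1 : ℤ)⟧ ⟶ A⟦(1 : ℤ)⟧),
      Triangle.mk (ea.inv ≫ f ≫ eb.hom) g h ∈ distTriang C := by
  have hT' : Triangle.mk f (-i⟦(1 : ℤ)⟧') (-p⟦(1 : ℤ)⟧') ∈ distTriang C :=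
    dist_rotate (dist_rotate hT)
  refine ⟨_, _, distinguished_of_isos hT' (f' := ea.inv ≫ f ≫ eb.hom)
    (g' := eb.inv ≫ (-i⟦(1 : ℤ)⟧')) (h' := (-p⟦(1 : ℤ)⟧') ≫ ea.hom⟦(1 : ℤ)⟧')
    ea.symm eb.symm (Iso.refl _) (by simp) (by simp) ?_⟩
  simp [← Functor.map_comp]

theorem iso_of_dist {X Y Z Z' : C} {f : X ⟶ Y} {g : Y ⟶ Z} {h : Z ⟶ X⟦(1 : ℤ)⟧} {g' : Y ⟶ Z'}
    {h' : Z' ⟶ X⟦(1 : ℤ)⟧} (hT : Triangle.mk f g h ∈ distTriang C)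
    (hT' : Triangle.mk f g' h' ∈ distTriang C) : Nonempty (Z ≅ Z') := by
  obtain ⟨e, -⟩ := exists_iso_of_arrow_iso _ _ hT hT' (Iso.refl _)
  exact ⟨Triangle.π₃.mapIso e⟩

variable (E : Type u) [CommRing E] [Linear E C] {Λ : Type x}

/-- `Z` is a cone of the multiplication by an irreducible element on `X`. -/
def IsIrreducibleCone (X Z : C) : Prop :=
  ∃ (ϖ : E) (g : X ⟶ Z) (h : Z ⟶ X⟦(1 : ℤ)⟧), Irreducible ϖ ∧
    Triangle.mk (ϖ • 𝟙 X) g h ∈ distTriang C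

/-- The nonnegative shifts of the objects `D l`, `l ∈ J`. -/
def nonnegShifts (D : Λ → C) (J : Set Λ) : ObjectProperty C :=
  fun X => ∃ l ∈ J, ∃ n : ℤ, 0 ≤ n ∧ Nonempty (X ≅ (D l)⟦n⟧)

/-- The shifts by at most `a` of the objects `N l`, `l ∈ J`, and of the cones of irreducible
elements on them. -/
def coneShifts (N : Λ → C) (J : Set Λ) (a : ℤ) : ObjectProperty C :=
  fun X => ∃ l ∈ J, ∃ (Z : C) (n : ℤ), (Z = N l ∨ IsIrreducibleCone E (N l) Z) ∧ n ≤ a ∧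
    Nonempty (X ≅ Z⟦n⟧)

variable {E}

instance nonnegShifts_closedUnderIso (D : Λ → C) (J : Set Λ) :
    (nonnegShifts D J).IsClosedUnderIsomorphisms where
  of_iso e := by
    rintro ⟨l, hl, n, hn, ⟨e'⟩⟩
    exact ⟨l, hl, n, hn, ⟨e.symm ≪≫ e'⟩⟩

theorem nonnegShifts_mono (D : Λ → C) {J J' : Set Λ} (h : J ⊆ J') :
    nonnegShifts D J ≤ nonnegShifts D J' :=
  fun _ ⟨l, hl, n, hn, e⟩ => ⟨l, h hl, n, hn, e⟩

theorem coneShifts_mono (N : Λ → C) {J J' : Set Λ} (h : J ⊆ J') (a : ℤ) :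
    coneShifts E N J a ≤ coneShifts E N J' a :=
  fun _ ⟨l, hl, Z, n, hZ, hn, e⟩ => ⟨l, h hl, Z, n, hZ, hn, e⟩

theorem nonnegShifts_shift {D : Λ → C} {J : Set Λ} {a : ℤ} (ha : 0 ≤ a) {X : C}
    (hX : extensionHull (nonnegShifts D J) X) : extensionHull (nonnegShifts D J) (X⟦a⟧) :=
  extensionHull_shift a (fun _ ⟨l, hl, n, hn, ⟨e⟩⟩ => .of_mem _ ⟨l, hl, n + a, by lia,
    ⟨(shiftFunctor C a).mapIso e ≪≫ shiftShiftIso _ _ _ _ rfl⟩⟩) hX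

theorem coneShifts_shift {N : Λ → C} {J : Set Λ} {a b c : ℤ} (h : a + b ≤ c) {X : C}
    (hX : extensionHull (coneShifts E N J a) X) : extensionHull (coneShifts E N J c) (X⟦b⟧) :=
  extensionHull_shift b (fun _ ⟨l, hl, Z, n, hZ, hn, ⟨e⟩⟩ => .of_mem _ ⟨l, hl, Z, n + b, hZ,
    by lia, ⟨(shiftFunctor C b).mapIso e ≪≫ shiftShiftIso _ _ _ _ rfl⟩⟩) hX

section

variable [∀ n : ℤ, (shiftFunctor C n).Linear E]

/-- As `ϖ` kills `g`, the map `ϖ • 𝟙 Z` factors through `h`, which `ϖ` kills as well. This argument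
gives only the square, and the square is enough below. -/
theorem cone_sq_smul {X Z : C} {ϖ : E} {g : X ⟶ Z} {h : Z ⟶ X⟦(1 : ℤ)⟧}
    (hT : Triangle.mk (ϖ • 𝟙 X) g h ∈ distTriang C) : (ϖ ^ 2) • 𝟙 Z = 0 := by
  have h₁ : ϖ • g = 0 := by simpa using dist_comp₁₂ hT
  have h₂ : ϖ • h = 0 := by simpa using dist_comp₃₁ hT
  obtain ⟨k, hk⟩ := dist_desc₃ hT (ϖ • 𝟙 Z) (by simpa using h₁)
  rw [pow_two, mul_smul, ← hk, ← Linear.smul_comp, h₂, zero_comp]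

end

variable [IsTriangulated C]

/-- Factor `r` into irreducibles; the octahedral axiom filters the cone of a product by the cones of
its factors. -/
theorem extensionHull_irreducibleCone [IsDomain E] [IsPrincipalIdealRing E] {X : C} {r : E}
    (hr : r ≠ 0) : ∀ {Z : C} {g : X ⟶ Z} {h : Z ⟶ X⟦(1 : ℤ)⟧},
    Triangle.mk (r • 𝟙 X) g h ∈ distTriang C → extensionHull (IsIrreducibleCone E X) Z := by
  induction r using WfDvdMonoid.induction_on_irreducible with
  | zero => exact absurd rfl hr
  | unit r hu =>
    intro Z g h hT
    obtain ⟨s, hs⟩ := hu.exists_right_inv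
    have : IsIso (r • 𝟙 X) := ⟨s • 𝟙 X, by simp [smul_smul, mul_comm s, hs],
      by simp [smul_smul, hs]⟩
    exact .of_isZero _ ((Triangle.isZero₃_iff_isIso₁ _ hT).2 this)
  | mul a i ha hi ih =>
    intro Z g h hT
    obtain ⟨Z₁, g₁, h₁, hT₁⟩ := distinguished_cocone_triangle (a • 𝟙 X)
    obtain ⟨Z₂, g₂, h₂, hT₂⟩ := distinguished_cocone_triangle (i • 𝟙 X)
    have o := someOctahedron (show (a • 𝟙 X) ≫ (i • 𝟙 X) = (i * a) • 𝟙 X by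
      simp [smul_smul]) hT₁ hT₂ hT
    exact .ext _ o.mem (ih ha hT₁) (.of_mem _ ⟨i, g₂, h₂, hi, hT₂⟩)

variable {lev : Λ → ℕ} {N D : Λ → C} [∀ n : ℤ, (shiftFunctor C n).Linear E]

namespace IsExceptionalFamily

variable (hN : IsExceptionalFamily lev N E)
include hN

theorem hom_nab_eq_zero {l p : Λ} (h : lev l = lev p) {a b : ℤ} (hab : l = p → a ≠ b)
    (f : (N l)⟦a⟧ ⟶ (N p)⟦b⟧) : f = 0 := by
  refine hom_shift_eq_zero a b (fun f => ?_) f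
  by_cases hlp : l = p
  · subst hlp
    exact hN.hom_self l _ (by have := hab rfl; lia) f
  · exact hN.hom_ne l p h.le hlp _ f

theorem smul_id_eq_zero {l : Λ} {a : E} (h : a • 𝟙 (N l) = 0) : a = 0 :=
  (hN.bijective_smul_id l).1 (by simpa using h)

/-- The only case not settled by the long exact sequence is `l = p`, `j = 1`: there the composite to
`(N p)⟦1⟧` is a scalar killed by `ϖ`, hence zero. -/
theorem hom_cone_eq_zero [IsDomain E] {l p : Λ} (hlp : lev l = lev p) {ϖ : E} (hϖ : ϖ ≠ 0) {Z : C}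
    {g : N p ⟶ Z} {h : Z ⟶ (N p)⟦(1 : ℤ)⟧} (hT : Triangle.mk (ϖ • 𝟙 (N p)) g h ∈ distTriang C)
    {j : ℤ} (hlj : l = p → j ≠ 0) (f : (N l)⟦j⟧ ⟶ Z) : f = 0 := by
  have hfh : f ≫ h = 0 := by
    by_cases hl : l = p ∧ j = 1
    · obtain ⟨rfl, rfl⟩ := hl
      obtain ⟨k, hk⟩ := (shiftFunctor C (1 : ℤ)).map_surjective (f ≫ h)
      obtain ⟨a, rfl⟩ := (hN.bijective_smul_id l).2 k
      have h₁ : (f ≫ h) ≫ (ϖ • 𝟙 (N l))⟦(1 : ℤ)⟧' = 0 := by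
        rw [Category.assoc, dist_comp₃₁ hT, comp_zero]
      rw [← hk, ← Functor.map_comp] at h₁
      have h₂ : (ϖ * a) • 𝟙 (N l) = 0 :=
        (shiftFunctor C (1 : ℤ)).map_injective (by simpa [smul_smul] using h₁)
      have h₃ := (mul_eq_zero.1 (hN.smul_id_eq_zero h₂)).resolve_left hϖ
      rw [← hk, h₃]
      simp
    · exact hN.hom_nab_eq_zero hlp (fun h h' => hl ⟨h, h'⟩) _
  obtain ⟨e, rfl⟩ := dist_lift₃ hT f hfh
  have he : e ≫ (shiftZeroIso (N p)).inv = 0 := hN.hom_nab_eq_zero hlp hlj _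
  have he' : e = 0 := by rw [← cancel_mono (shiftZeroIso (N p)).inv, he, zero_comp]
  rw [he', zero_comp]

/-- A nonzero connecting map forces `l = p`, `n = 0`, `k = -1`. It is then a nonzero scalar `r` on
`N l`, so `Y⟦1⟧` is a cone of `r`. -/
theorem extensionProduct_coneShifts_nab_le [IsDomain E] [IsPrincipalIdealRing E] {m : ℕ} {l p : Λ}
    (hl : lev l = m) (hp : lev p = m) {b Y a : C} {i : b ⟶ Y} {q : Y ⟶ a} {f : a ⟶ b⟦(1 : ℤ)⟧}
    (hT : Triangle.mk i q f ∈ distTriang C) {n k : ℤ} (hn : 0 ≤ n) (hk : k ≤ -1)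
    (ea : a ≅ (N l)⟦n⟧) (eb : b ≅ (N p)⟦k⟧) (hf : f ≠ 0) :
    extensionHull (coneShifts E N {l | lev l = m} (-1)) Y := by
  have hlp : l = p ∧ n = k + 1 := by
    by_contra h
    refine hf (hom_eq_zero_of_shift_isos (X := (N l)⟦n⟧) (Y := (N p)⟦k + 1⟧) (a := 0) (b := 0)
      (k := 0) (fun g => ?_) rfl (ea ≪≫ (shiftZeroIso _).symm)
      ((shiftFunctor C (1 : ℤ)).mapIso eb ≪≫ shiftShiftIso _ k 1 _ rfl ≪≫
        (shiftZeroIso _).symm) f)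
    rw [← cancel_mono (shiftZeroIso _).hom, zero_comp]
    exact hN.hom_nab_eq_zero (hl.trans hp.symm) (fun h₁ h₂ => h ⟨h₁, h₂⟩) _
  obtain ⟨rfl, rfl⟩ := hlp
  obtain rfl : k = -1 := by lia
  obtain ⟨g, h, hT'⟩ := exists_dist_of_isos hT (ea ≪≫ shiftZeroIso (N l))
    ((shiftFunctor C (1 : ℤ)).mapIso eb ≪≫ shiftShiftIso _ (-1) 1 0 rfl ≪≫ shiftZeroIso (N l))
  obtain ⟨r, hr⟩ := (hN.bijective_smul_id l).2 ((ea ≪≫ shiftZeroIso (N l)).inv ≫ f ≫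
    ((shiftFunctor C (1 : ℤ)).mapIso eb ≪≫ shiftShiftIso _ (-1) 1 0 rfl ≪≫
      shiftZeroIso (N l)).hom)
  have hr0 : r ≠ 0 := by
    rintro rfl
    refine hf ?_
    rw [← cancel_epi (ea ≪≫ shiftZeroIso (N l)).inv, ← cancel_mono
      ((shiftFunctor C (1 : ℤ)).mapIso eb ≪≫ shiftShiftIso _ (-1) 1 0 rfl ≪≫ shiftZeroIso (N l)).hom,
      Category.assoc, ← hr]
    simp
  rw [← hr] at hT'
  refine extensionHull_of_shift_iso (-1) (P := IsIrreducibleCone E (N l)) (fun Z hZ => ?_)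
    ((shiftZeroIso Y).symm ≪≫ (shiftShiftIso Y 1 (-1) 0 rfl).symm)
    (extensionHull_irreducibleCone hr0 hT')
  exact .of_mem _ ⟨l, hl, Z, -1, Or.inr hZ, le_rfl, ⟨Iso.refl _⟩⟩

/-- A nonzero connecting map `N l ⟶ Z` is `s • g` with `s` prime to `ϖ`, because `ϖ • g = 0`. Such
an `s` is invertible on `Z`, so the triangle is a rotation of the one defining `Z`, and `Y ≅ N l`.
-/
theorem extensionProduct_coneShifts_cone_le [IsDomain E] [IsPrincipalIdealRing E] {m : ℕ} {l p : Λ}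
    (hl : lev l = m) (hp : lev p = m) {b Y a : C} {i : b ⟶ Y} {q : Y ⟶ a} {f : a ⟶ b⟦(1 : ℤ)⟧}
    (hT : Triangle.mk i q f ∈ distTriang C) {n k : ℤ} (hn : 0 ≤ n) (hk : k ≤ -1)
    {Z : C} (hZ : IsIrreducibleCone E (N p) Z)
    (ea : a ≅ (N l)⟦n⟧) (eb : b ≅ Z⟦k⟧) (hf : f ≠ 0) :
    nonnegShifts N {l | lev l = m} Y := by
  obtain ⟨ϖ, g, h, hϖ, hTZ⟩ := hZ
  have hlp : l = p ∧ n = k + 1 := by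
    by_contra h
    refine hf (hom_eq_zero_of_shift_isos (X := (N l)⟦n - (k + 1)⟧) (Y := Z) (a := k + 1)
      (b := k + 1) (k := 0) (fun g => ?_) (by lia) (ea ≪≫ (shiftShiftIso _ _ _ _ (by lia)).symm)
      ((shiftFunctor C (1 : ℤ)).mapIso eb ≪≫ shiftShiftIso _ k 1 _ rfl) f)
    rw [← cancel_mono (shiftZeroIso _).hom, zero_comp]
    exact hN.hom_cone_eq_zero (hl.trans hp.symm) hϖ.ne_zero hTZ
      (fun h₁ h₂ => h ⟨h₁, by lia⟩) _
  obtain ⟨rfl, rfl⟩ := hlp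
  obtain rfl : k = -1 := by lia
  obtain ⟨ea', -⟩ : ∃ _ : a ≅ N l, True := ⟨ea ≪≫ shiftZeroIso (N l), trivial⟩
  obtain ⟨eb', -⟩ : ∃ _ : b⟦(1 : ℤ)⟧ ≅ Z, True :=
    ⟨(shiftFunctor C (1 : ℤ)).mapIso eb ≪≫ shiftShiftIso _ (-1) 1 0 rfl ≪≫ shiftZeroIso Z, trivial⟩
  obtain ⟨g', h', hT'⟩ := exists_dist_of_isos hT ea' eb'
  obtain ⟨f', hf'⟩ : ∃ f', f' = ea'.inv ≫ f ≫ eb'.hom := ⟨_, rfl⟩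
  rw [← hf'] at hT'
  have hf'0 : f' ≠ 0 := by
    rintro rfl
    refine hf ?_
    rw [← cancel_epi ea'.inv, ← cancel_mono eb'.hom, Category.assoc, ← hf']
    simp
  obtain ⟨e, he⟩ := dist_lift₃ hTZ f' (hN.hom_self l 1 one_ne_zero _)
  obtain ⟨s, hs⟩ := (hN.bijective_smul_id l).2 e
  have hsg : s • g = f' := by rw [← he, ← hs]; simp
  have hϖs : ¬ ϖ ∣ s := by
    rintro ⟨t, rfl⟩
    have h₁ : ϖ • g = 0 := by simpa using dist_comp₁₂ hTZ
    exact hf'0 (by rw [← hsg, mul_comm, mul_smul, h₁, smul_zero])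
  -- The Bézout relation is taken with `ϖ ^ 2`, the power that kills `Z` by `cone_sq_smul`; then `y`
  -- inverts `s` on `Z`.
  obtain ⟨x, y, hxy⟩ := (hϖ.coprime_iff_not_dvd.2 hϖs).pow_left (m := 2)
  have hys : (y * s) • 𝟙 Z = 𝟙 Z := by
    have : (x * ϖ ^ 2 + y * s) • 𝟙 Z = 𝟙 Z := by rw [hxy, one_smul]
    rwa [add_smul, mul_smul, cone_sq_smul hTZ, smul_zero, zero_add] at this
  let σ : Z ≅ Z := ⟨s • 𝟙 Z, y • 𝟙 Z, by simpa [smul_smul] using hys,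
    by simpa [smul_smul, mul_comm] using hys⟩
  have hT'' : Triangle.mk f' (σ.inv ≫ h) (-(ϖ • 𝟙 (N l))⟦(1 : ℤ)⟧') ∈ distTriang C :=
    distinguished_of_isos (dist_rotate hTZ) (Iso.refl _) σ.symm (Iso.refl _)
      (by
        rw [Iso.symm_hom, Iso.comp_inv_eq, ← hsg]
        simp [σ]) (by simp) (by simp)
  obtain ⟨ε⟩ := iso_of_dist hT' hT''
  exact ⟨l, hl, 0, le_rfl, ⟨(shiftFunctor C (1 : ℤ)).preimageIso ε ≪≫ (shiftZeroIso _).symm⟩⟩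

/-- The level `m` part has truncation triangles. -/
theorem levelEq_le_extensionProduct [IsDomain E] [IsPrincipalIdealRing E] (m : ℕ) :
    levelEq lev N m ≤ extensionProduct (extensionHull (nonnegShifts N {l | lev l = m}))
      (extensionHull (coneShifts E N {l | lev l = m} (-1))) := by
  -- Zero objects are added because `extensionHull_swap` requires its first class to contain them.
  let A : ObjectProperty C := fun X => IsZero X ∨ nonnegShifts N {l | lev l = m} X
  have : A.IsClosedUnderIsomorphisms := ⟨fun e hX => hX.imp (fun h => h.of_iso e.symm)
    (fun h => (nonnegShifts N {l | lev l = m}).prop_of_iso e h)⟩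
  have : A.ContainsZero := ⟨0, isZero_zero C, Or.inl (isZero_zero C)⟩
  have hA : (extensionHull A : ObjectProperty C) ≤
      extensionHull (nonnegShifts N {l | lev l = m}) :=
    extensionHull_le fun X hX => hX.elim (fun h => .of_isZero _ h) (fun h => .of_mem _ h)
  have hswap : extensionProduct (coneShifts E N {l | lev l = m} (-1)) A ≤
      extensionProduct A (extensionHull (coneShifts E N {l | lev l = m} (-1))) := by
    rintro Y ⟨b, a, i, q, f, hT, hb, ha⟩
    by_cases hf : f = 0
    · exact extensionProduct_mono le_rfl (le_extensionHull _) _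
        (extensionProduct_of_mor₃_eq_zero hT hf hb ha)
    obtain ⟨l, hl, n, hn, ⟨ea⟩⟩ := ha.resolve_left fun h => hf (h.eq_of_src _ _)
    obtain ⟨p, hp, Z, k, hZ, hk, ⟨eb⟩⟩ := hb
    rcases hZ with rfl | hZ
    · exact le_extensionProduct_right _ _
        (hN.extensionProduct_coneShifts_nab_le hl hp hT hn hk ea eb hf)
    · exact le_extensionProduct_left _ _
        (Or.inr (hN.extensionProduct_coneShifts_cone_le hl hp hT hn hk hZ ea eb hf))
  have := extensionProduct_closed₂ (extensionHull_swap hswap)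
  have : ContainsZero (extensionProduct (extensionHull A)
      (extensionHull (coneShifts E N {l | lev l = m} (-1)))) :=
    ⟨0, isZero_zero C, le_extensionProduct_left _ _ (.of_isZero _ (isZero_zero C))⟩
  refine (triangulatedHull_le_extensionHull _).trans (le_trans (extensionHull_le ?_)
    (monotone_extensionProduct_left _ hA))
  rintro X ⟨_, n, ⟨l, hl, rfl⟩, ⟨e⟩⟩
  rcases lt_or_ge n 0 with hn | hn
  · exact le_extensionProduct_right _ _
      (.of_mem _ ⟨l, hl, N l, n, Or.inl rfl, by lia, ⟨e⟩⟩)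
  · exact le_extensionProduct_left _ _ (.of_mem _ (Or.inr ⟨l, hl, n, hn, ⟨e⟩⟩))

end IsExceptionalFamily

theorem IsDualFamily.nonnegShifts_swap (hD : IsDualFamily lev N D) (m : ℕ) :
    extensionProduct (levelLT lev N m) (extensionHull (nonnegShifts D {l | lev l = m})) ≤
      extensionProduct (extensionHull (nonnegShifts D {l | lev l = m})) (levelLT lev N m) := by
  refine extensionProduct_swap fun X Y hX hY f => ?_
  have hle : (extensionHull (nonnegShifts D {l | lev l = m}) : ObjectProperty C) ≤
      levelEq lev D m := by
    refine extensionHull_le ?_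
    rintro X ⟨l, hl, n, -, ⟨e⟩⟩
    obtain rfl : lev l = m := hl
    exact (levelEq lev D _).prop_of_iso e.symm
      ((levelEq lev D _).le_shift n _ (mem_levelEq lev D l))
  exact hD.levelEq_hom_levelLT (hle X hX) ((levelLT lev N m).le_shift 1 Y hY) f

/-- The triangle of a canonical map replaces `N l` by `D l`, at the cost of a factor of lower level
on the right. -/
theorem IsDualFamily.nonnegShifts_nab_le (hD : IsDualFamily lev N D) (m : ℕ) :
    (extensionHull (nonnegShifts N {l | lev l = m}) : ObjectProperty C) ≤
      extensionProduct (extensionHull (nonnegShifts D {l | lev l = m})) (levelLT lev N m) := by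
  have := extensionProduct_closed₂ (U := extensionHull (nonnegShifts D {l | lev l = m}))
    (V := levelLT lev N m) (hD.nonnegShifts_swap m)
  have : ContainsZero (extensionProduct (extensionHull (nonnegShifts D {l | lev l = m}))
      (levelLT lev N m)) :=
    ⟨0, isZero_zero C, le_extensionProduct_left _ _ (.of_isZero _ (isZero_zero C))⟩
  refine extensionHull_le ?_
  rintro X ⟨l, hl, n, hn, ⟨e⟩⟩
  obtain ⟨c, Z, g, h, hT, hZ⟩ := hD.exists_canonical l
  obtain rfl : lev l = m := hl
  refine ObjectProperty.prop_of_iso _ e.symm ⟨_, _, _, _, _, Triangle.shift_distinguished _ hT n,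
    .of_mem _ ⟨l, rfl, n, hn, ⟨Iso.refl _⟩⟩, (levelLT lev N (lev l)).le_shift n Z hZ⟩

end Truncation

/-! ### Gluing the levels into a t-structure. -/

section ExistenceTStructure

variable {C : Type w} [Category.{v} C] [Preadditive C] [HasZeroObject C] [HasShift C ℤ]
  [∀ n : ℤ, (shiftFunctor C n).Additive] [Pretriangulated C] [IsTriangulated C]
variable {E : Type u} [CommRing E] [IsDomain E] [Linear E C]
  [∀ n : ℤ, (shiftFunctor C n).Linear E] {Λ : Type x} {lev : Λ → ℕ} {N D : Λ → C}
variable (hN : IsExceptionalFamily lev N E) (hD : IsDualFamily lev N D)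
include hN hD

/-- Gluing step: an object is filtered by a part of lower level, a nonnegative part of level `m` and
a negative part of level `m`. The nonnegative part, rewritten through the `D l`, moves to the left
of the lower part, and the induction hypothesis truncates what remains in the middle. -/
theorem levelLT_le_truncation [IsPrincipalIdealRing E] (m : ℕ) :
    levelLT lev N m ≤ extensionProduct (extensionHull (nonnegShifts D {l | lev l < m}))
      (extensionHull (coneShifts E N {l | lev l < m} (-1))) := by
  induction m with
  | zero =>
    intro X hX
    exact le_extensionProduct_left _ _ (.of_isZero _ (isZero_of_levelLT_zero lev N hX))
  | succ m ih =>
    have h₁ : levelLT lev N (m + 1) ≤ extensionProduct (extensionProduct (levelLT lev N m)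
        (extensionHull (nonnegShifts N {l | lev l = m})))
        (extensionHull (coneShifts E N {l | lev l = m} (-1))) := by
      rw [extensionProduct_assoc]
      exact (hN.levelLT_succ_le_nab m).trans
        (monotone_extensionProduct_right _ (hN.levelEq_le_extensionProduct m))
    have h₂ : extensionProduct (levelLT lev N m)
        (extensionHull (nonnegShifts N {l | lev l = m})) ≤
        extensionProduct (extensionHull (nonnegShifts D {l | lev l = m})) (levelLT lev N m) := by
      refine (monotone_extensionProduct_right _ (hD.nonnegShifts_nab_le m)).trans ?_
      rw [← extensionProduct_assoc]
      refine (monotone_extensionProduct_left _ (hD.nonnegShifts_swap m)).trans ?_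
      rw [extensionProduct_assoc]
      exact monotone_extensionProduct_right _ (extensionProduct_self_le _)
    have h₃ := h₁.trans (monotone_extensionProduct_left _
      (h₂.trans (monotone_extensionProduct_right _ ih)))
    rw [← extensionProduct_assoc, extensionProduct_assoc] at h₃
    have hlt : {l | lev l < m} ⊆ {l | lev l < m + 1} := fun l (hl : lev l < m) => Nat.lt_succ_of_lt hl
    have heq : {l | lev l = m} ⊆ {l | lev l < m + 1} := fun l (hl : lev l = m) => by
      change lev l < m + 1
      lia
    refine h₃.trans (extensionProduct_mono ?_ ?_)
    · exact extensionProduct_le_of_isTriangulatedClosed₂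
        (extensionHull_mono (nonnegShifts_mono D heq)) (extensionHull_mono (nonnegShifts_mono D hlt))
    · exact extensionProduct_le_of_isTriangulatedClosed₂
        (extensionHull_mono (coneShifts_mono N hlt _)) (extensionHull_mono (coneShifts_mono N heq _))

theorem del_hom_nab_eq_zero {l p : Λ} {a b : ℤ} (hab : l = p → a ≠ b)
    (f : (D l)⟦a⟧ ⟶ (N p)⟦b⟧) : f = 0 := by
  refine hom_shift_eq_zero a b (fun f => ?_) f
  by_cases hlp : l = p
  · subst hlp
    exact hN.del_hom_self_eq_zero hD l (by have := hab rfl; lia) f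
  · exact hN.del_hom_eq_zero hD hlp _ f

theorem del_hom_cone_eq_zero {l p : Λ} {ϖ : E} (hϖ : ϖ ≠ 0) {Z : C}
    {g : N p ⟶ Z} {h : Z ⟶ (N p)⟦(1 : ℤ)⟧} (hT : Triangle.mk (ϖ • 𝟙 (N p)) g h ∈ distTriang C)
    {j : ℤ} (hlj : l = p → j ≠ 0) (f : (D l)⟦j⟧ ⟶ Z) : f = 0 := by
  have hfh : f ≫ h = 0 := by
    by_cases hl : l = p ∧ j = 1
    · obtain ⟨rfl, rfl⟩ := hl
      obtain ⟨c, hc⟩ := hD.exists_canonical l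
      obtain ⟨k, hk⟩ := (shiftFunctor C (1 : ℤ)).map_surjective (f ≫ h)
      obtain ⟨a, rfl⟩ := (hN.bijective_smul_canonical hc).2 k
      have h₁ : (f ≫ h) ≫ (ϖ • 𝟙 (N l))⟦(1 : ℤ)⟧' = 0 := by
        rw [Category.assoc, dist_comp₃₁ hT, comp_zero]
      rw [← hk, ← Functor.map_comp] at h₁
      have h₂ : (ϖ * a) • c = 0 :=
        (shiftFunctor C (1 : ℤ)).map_injective (by simpa [smul_smul] using h₁)
      have h₃ : ϖ * a = 0 := (hN.bijective_smul_canonical hc).1 (by simpa using h₂)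
      rw [← hk, (mul_eq_zero.1 h₃).resolve_left hϖ]
      simp
    · exact del_hom_nab_eq_zero hN hD (fun h h' => hl ⟨h, h'⟩) _
  obtain ⟨e, rfl⟩ := dist_lift₃ hT f hfh
  have he : e ≫ (shiftZeroIso (N p)).inv = 0 := del_hom_nab_eq_zero hN hD hlj _
  have he' : e = 0 := by rw [← cancel_mono (shiftZeroIso (N p)).inv, he, zero_comp]
  rw [he', zero_comp]

theorem nonnegShifts_hom_coneShifts {X Y : C} (hX : extensionHull (nonnegShifts D Set.univ) X)
    (hY : extensionHull (coneShifts E N Set.univ (-1)) Y) (f : X ⟶ Y) : f = 0 := by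
  refine extensionHull_hom_eq_zero ?_ hX hY f
  rintro X Y ⟨l, -, n, hn, ⟨e⟩⟩ ⟨p, -, Z, k, hZ, hk, ⟨e'⟩⟩ f
  rw [← cancel_epi e.inv, ← cancel_mono e'.hom, comp_zero, zero_comp]
  rcases hZ with rfl | ⟨ϖ, g, h, hϖ, hT⟩
  · exact del_hom_nab_eq_zero hN hD (fun _ => by lia) _
  · refine hom_eq_zero_of_shift_isos (X := (D l)⟦n - k⟧) (Y := Z) (a := k)
      (b := k) (k := 0) (fun g => ?_) (by lia) (shiftShiftIso _ _ _ _ (by lia)).symm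
      (Iso.refl _) _
    rw [← cancel_mono (shiftZeroIso _).hom, zero_comp]
    exact del_hom_cone_eq_zero hN hD hϖ.ne_zero hT (fun _ => by lia) _

variable [IsPrincipalIdealRing E]

/-- The t-structure attached to an exceptional family and a dual family. -/
theorem exists_tStructure : ∃ t : TStructure C,
    t.le 0 = extensionHull (nonnegShifts D Set.univ) ∧
      t.ge 0 = extensionHull (coneShifts E N Set.univ 0) := by
  let t : TStructure C :=
    { le := fun n X => extensionHull (nonnegShifts D Set.univ) (X⟦n⟧)
      ge := fun n X => extensionHull (coneShifts E N Set.univ 0) (X⟦n⟧)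
      le_isClosedUnderIsomorphisms := fun n =>
        ⟨fun e h => extensionHull_of_iso ((shiftFunctor C n).mapIso e) h⟩
      ge_isClosedUnderIsomorphisms := fun n =>
        ⟨fun e h => extensionHull_of_iso ((shiftFunctor C n).mapIso e) h⟩
      le_shift := fun n a n' h X hX => extensionHull_of_iso (shiftShiftIso X a n' n h).symm hX
      ge_shift := fun n a n' h X hX => extensionHull_of_iso (shiftShiftIso X a n' n h).symm hX
      -- For `Y` in `ge 1` it is `Y⟦1⟧` that has shifts bounded by `0`; for `Y` itself the bound is
      -- `-1`.
      zero' := fun X Y f hX hY => nonnegShifts_hom_coneShifts hN hD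
        (extensionHull_of_iso (shiftZeroIso X) hX)
        (extensionHull_of_iso (shiftShiftIso Y 1 (-1) 0 rfl ≪≫ shiftZeroIso Y)
          (coneShifts_shift (b := -1) (by lia) hY)) f
      le_zero_le := fun X hX => extensionHull_of_iso (shiftShiftIso X 0 1 1 rfl)
        (nonnegShifts_shift zero_le_one hX)
      ge_one_le := fun X hX => extensionHull_of_iso (shiftShiftIso X 1 (-1) 0 rfl)
        (coneShifts_shift (by lia) hX)
      exists_triangle_zero_one := fun X => by
        obtain ⟨m, hm⟩ := hN.exists_levelLT X
        obtain ⟨A, B, f, g, h, hT, hA, hB⟩ := levelLT_le_truncation hN hD m X hm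
        exact ⟨A, B, extensionHull_of_iso (shiftZeroIso A).symm
            (extensionHull_mono (nonnegShifts_mono D (Set.subset_univ _)) _ hA),
          coneShifts_shift (by lia)
            (extensionHull_mono (coneShifts_mono N (Set.subset_univ _) _) _ hB), f, g, h, hT⟩ }
  refine ⟨t, ?_, ?_⟩ <;> ext X <;>
    exact ⟨fun h => extensionHull_of_iso (shiftZeroIso X) h,
      fun h => extensionHull_of_iso (shiftZeroIso X).symm h⟩

end ExistenceTStructure

/-! ### Monomorphisms, epimorphisms and `H⁰` tested in the triangulated category. -/

section HeartComparison

variable {C : Type w} [Category.{v} C] [Preadditive C] [HasZeroObject C] [HasShift C ℤ]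
  [∀ n : ℤ, (shiftFunctor C n).Additive] [Pretriangulated C] (t : TStructure C)

instance heart_isLE (X : HeartCat t) : t.IsLE X.obj 0 := ((t.mem_heart_iff _).1 X.property).1

instance heart_isGE (X : HeartCat t) : t.IsGE X.obj 0 := ((t.mem_heart_iff _).1 X.property).2

/-- A morphism which is a monomorphism with respect to morphisms from `T^{≤ 0}`. -/
def IsTMono {X Y : C} (f : X ⟶ Y) : Prop :=
  ∀ ⦃W : C⦄, t.IsLE W 0 → ∀ g : W ⟶ X, g ≫ f = 0 → g = 0

/-- A morphism which is an epimorphism with respect to morphisms to `T^{≥ 0}`. -/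
def IsTEpi {X Y : C} (f : X ⟶ Y) : Prop :=
  ∀ ⦃W : C⦄, t.IsGE W 0 → ∀ g : Y ⟶ W, f ≫ g = 0 → g = 0

variable {t}

theorem IsTMono.comp {X Y Z : C} {f : X ⟶ Y} {g : Y ⟶ Z} (hf : IsTMono t f) (hg : IsTMono t g) :
    IsTMono t (f ≫ g) :=
  fun _ hW a ha => hf hW a (hg hW _ (by rw [Category.assoc, ha]))

theorem IsTEpi.comp {X Y Z : C} {f : X ⟶ Y} {g : Y ⟶ Z} (hf : IsTEpi t f) (hg : IsTEpi t g) :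
    IsTEpi t (f ≫ g) :=
  fun _ hW a ha => hg hW a (hf hW _ (by rw [← Category.assoc, ha]))

theorem IsTMono.eq {X Y W : C} {f : X ⟶ Y} (hf : IsTMono t f) [hW : t.IsLE W 0] {a b : W ⟶ X}
    (h : a ≫ f = b ≫ f) : a = b :=
  sub_eq_zero.1 (hf hW _ (by rw [Preadditive.sub_comp, h, sub_self]))

theorem IsTEpi.eq {X Y W : C} {f : X ⟶ Y} (hf : IsTEpi t f) [hW : t.IsGE W 0] {a b : Y ⟶ W}
    (h : f ≫ a = f ≫ b) : a = b :=
  sub_eq_zero.1 (hf hW _ (by rw [Preadditive.comp_sub, h, sub_self]))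

theorem IsTMono.of_mono {X Y : C} (f : X ⟶ Y) [Mono f] : IsTMono t f :=
  fun _ _ g hg => by rwa [← cancel_mono f, zero_comp]

theorem IsTEpi.of_epi {X Y : C} (f : X ⟶ Y) [Epi f] : IsTEpi t f :=
  fun _ _ g hg => by rwa [← cancel_epi f, comp_zero]

theorem IsTMono.of_dist {X Y Z : C} {f : X ⟶ Y} {g : Y ⟶ Z} {h : Z ⟶ X⟦(1 : ℤ)⟧}
    (hT : Triangle.mk f g h ∈ distTriang C) [t.IsGE Z 0] : IsTMono t f := by
  intro W hW a ha
  have := t.isGE_shift Z 0 (-1) 1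
  exact dist_eq_zero₁ hT (fun b => t.zero b 0 1) a ha

theorem IsTEpi.of_dist {X Y Z : C} {f : X ⟶ Y} {g : Y ⟶ Z} {h : Z ⟶ X⟦(1 : ℤ)⟧}
    (hT : Triangle.mk f g h ∈ distTriang C) [t.IsLE X 0] : IsTEpi t g := by
  intro W hW a ha
  have := t.isLE_shift X 0 1 (-1)
  exact dist_eq_zero₃ hT (fun b => t.zero b (-1) 0) a ha

theorem IsTMono.mono {X Y : HeartCat t} {f : X ⟶ Y} (hf : IsTMono t f.hom) : Mono f := by
  refine Preadditive.mono_of_cancel_zero f fun {W} g hg => ?_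
  ext
  exact hf inferInstance g.hom (congrArg (·.hom) hg)

theorem IsTEpi.epi {X Y : HeartCat t} {f : X ⟶ Y} (hf : IsTEpi t f.hom) : Epi f := by
  refine Preadditive.epi_of_cancel_zero f fun {W} g hg => ?_
  ext
  exact hf inferInstance g.hom (congrArg (·.hom) hg)

variable (t) [IsTriangulated C]

instance isGE_truncLE_obj (X : C) [t.IsGE X 0] : t.IsGE ((t.truncLE 0).obj X) 0 := by
  unfold TStructure.truncLE
  infer_instance

/-- The morphism `τ^{≤ 0} X ⟶ X`. -/
noncomputable def leHom (X : C) : (t.truncLE 0).obj X ⟶ X := (t.truncLEι 0).app X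

/-- The morphism `τ^{≤ 0} X ⟶ H⁰(X)`. -/
noncomputable def leToH0 (X : C) : (t.truncLE 0).obj X ⟶ ((H0 t).obj X).obj :=
  (t.truncGEπ 0).app ((t.truncLE 0).obj X)

instance isIso_leHom (X : C) [t.IsLE X 0] : IsIso (leHom t X) :=
  (t.isLE_iff_isIso_truncLEι_app 0 X).1 inferInstance

instance isIso_leToH0 (X : C) [t.IsGE X 0] : IsIso (leToH0 t X) :=
  (t.isGE_iff_isIso_truncGEπ_app 0 ((t.truncLE 0).obj X)).1 inferInstance

theorem leHom_naturality {X Y : C} (c : X ⟶ Y) :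
    (t.truncLE 0).map c ≫ leHom t Y = leHom t X ≫ c := (t.truncLEι 0).naturality c

theorem leToH0_naturality {X Y : C} (c : X ⟶ Y) :
    leToH0 t X ≫ ((H0 t).map c).hom = (t.truncLE 0).map c ≫ leToH0 t Y :=
  ((t.truncGEπ 0).naturality _).symm

theorem exists_dist_leHom (X : C) : ∃ (B : C) (_ : t.IsGE B 1) (g : X ⟶ B) (h : B ⟶ _),
    Triangle.mk (leHom t X) g h ∈ distTriang C :=
  ⟨_, inferInstance, _, _, t.triangleLEGE_distinguished 0 1 (by lia) X⟩

theorem exists_dist_leToH0 (X : C) : ∃ (A : C) (_ : t.IsLE A (-1)) (f : A ⟶ _)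
    (h : _ ⟶ A⟦(1 : ℤ)⟧), Triangle.mk f (leToH0 t X) h ∈ distTriang C :=
  ⟨_, inferInstance, _, _, t.triangleLEGE_distinguished (-1) 0 (by lia) ((t.truncLE 0).obj X)⟩

/-- The morphism `X ⟶ H⁰(X)` for `X` in `T^{≤ 0}`. -/
noncomputable def toH0 (X : C) [t.IsLE X 0] : X ⟶ ((H0 t).obj X).obj :=
  inv (leHom t X) ≫ leToH0 t X

/-- The morphism `H⁰(X) ⟶ X` for `X` in `T^{≥ 0}`. -/
noncomputable def fromH0 (X : C) [t.IsGE X 0] : ((H0 t).obj X).obj ⟶ X :=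
  inv (leToH0 t X) ≫ leHom t X

theorem toH0_H0_map_fromH0 {X Y : C} [t.IsLE X 0] [t.IsGE Y 0] (c : X ⟶ Y) :
    toH0 t X ≫ ((H0 t).map c).hom ≫ fromH0 t Y = c := by
  rw [toH0, fromH0, Category.assoc, reassoc_of% (leToH0_naturality t c), IsIso.hom_inv_id_assoc,
    leHom_naturality, IsIso.inv_hom_id_assoc]

theorem exists_dist_toH0 (X : C) [t.IsLE X 0] :
    ∃ (A : C) (_ : t.IsLE A (-1)) (f : A ⟶ X) (h : _ ⟶ A⟦(1 : ℤ)⟧),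
      Triangle.mk f (toH0 t X) h ∈ distTriang C := by
  obtain ⟨A, hA, f, h, hT⟩ := exists_dist_leToH0 t X
  exact ⟨A, hA, f ≫ leHom t X, h, distinguished_of_isos hT (Iso.refl _)
    (asIso (leHom t X)).symm (Iso.refl _) (by simp) (by simp [toH0]) (by simp)⟩

theorem exists_dist_fromH0 (X : C) [t.IsGE X 0] :
    ∃ (B : C) (_ : t.IsGE B 1) (g : X ⟶ B) (h : B ⟶ _),
      Triangle.mk (fromH0 t X) g h ∈ distTriang C := by
  obtain ⟨B, hB, g, h, hT⟩ := exists_dist_leHom t X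
  refine ⟨B, hB, g, h ≫ (leToH0 t X)⟦(1 : ℤ)⟧', distinguished_of_isos hT
    (asIso (leToH0 t X)).symm (Iso.refl _) (Iso.refl _) (by simp [fromH0]) (by simp) ?_⟩
  rw [Category.assoc, ← Functor.map_comp]
  simp

theorem isTEpi_toH0 (X : C) [t.IsLE X 0] : IsTEpi t (toH0 t X) := by
  obtain ⟨A, hA, f, h, hT⟩ := exists_dist_toH0 t X
  have := t.isLE_of_le A (-1) 0
  exact .of_dist hT

theorem isTMono_fromH0 (X : C) [t.IsGE X 0] : IsTMono t (fromH0 t X) := by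
  obtain ⟨B, hB, g, h, hT⟩ := exists_dist_fromH0 t X
  have := t.isGE_of_ge B 0 1
  exact .of_dist hT

theorem exists_toH0_comp (X : C) [t.IsLE X 0] {W : C} [t.IsGE W 0] (f : X ⟶ W) :
    ∃ g : ((H0 t).obj X).obj ⟶ W, toH0 t X ≫ g = f := by
  obtain ⟨A, hA, a, h, hT⟩ := exists_dist_toH0 t X
  exact dist_desc₂ hT f (t.zero _ (-1) 0)

theorem exists_comp_fromH0 (X : C) [t.IsGE X 0] {W : C} [t.IsLE W 0] (f : W ⟶ X) :
    ∃ g : W ⟶ ((H0 t).obj X).obj, g ≫ fromH0 t X = f := by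
  obtain ⟨B, hB, g, h, hT⟩ := exists_dist_fromH0 t X
  exact dist_lift₂ hT f (t.zero _ 0 1)

theorem exists_dist_of_epi {X Y : HeartCat t} (f : X ⟶ Y) [Epi f] :
    ∃ (K : HeartCat t) (i : K ⟶ X) (δ : Y.obj ⟶ K.obj⟦(1 : ℤ)⟧),
      Triangle.mk i.hom f.hom δ ∈ distTriang C :=
  AbelianSubcategory.exists_distinguished_triangle_of_epi (heart_hom_shift_neg t)
    (heart_admissible t) f

/-- The triangle of the epimorphism `cokernel.π f` starts with its kernel, and a monomorphism is a
kernel of its cokernel. -/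
theorem exists_dist_of_mono {X Y : HeartCat t} (f : X ⟶ Y) [Mono f] :
    ∃ δ : (cokernel f).obj ⟶ X.obj⟦(1 : ℤ)⟧,
      Triangle.mk f.hom (cokernel.π f).hom δ ∈ distTriang C := by
  obtain ⟨K, i, δ, hT⟩ := exists_dist_of_epi t (cokernel.π f)
  have h₁ := AbelianSubcategory.isLimitKernelForkOfDistTriang (heart_hom_shift_neg t) i
    (cokernel.π f) δ hT
  have h₂ := Abelian.monoIsKernelOfCokernel _ (cokernelIsCokernel f)
  obtain ⟨e, he⟩ : ∃ e : K ≅ X, e.hom ≫ f = i :=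
    ⟨IsLimit.conePointUniqueUpToIso h₁ h₂,
      IsLimit.conePointUniqueUpToIso_hom_comp h₁ h₂ WalkingParallelPair.zero⟩
  have he' : f.hom = e.inv.hom ≫ i.hom := by
    rw [← he]
    exact congrArg (·.hom) (e.inv_hom_id_assoc f).symm
  refine ⟨δ ≫ e.hom.hom⟦(1 : ℤ)⟧', distinguished_of_isos hT ((t.heart.ι.mapIso e).symm)
    (Iso.refl _) (Iso.refl _) ?_ ?_ ?_⟩
  · exact (Category.comp_id _).trans he'
  · exact (Category.comp_id _).trans (Category.id_comp _).symm
  · refine (Category.assoc _ _ _).trans ((congrArg (δ ≫ ·) ?_).trans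
      ((Category.comp_id _).trans (Category.id_comp _).symm))
    exact ((shiftFunctor C (1 : ℤ)).mapIso (t.heart.ι.mapIso e)).hom_inv_id

variable {t}

theorem isTMono_of_mono {X Y : HeartCat t} (f : X ⟶ Y) [Mono f] : IsTMono t f.hom := by
  obtain ⟨δ, hT⟩ := exists_dist_of_mono t f
  exact .of_dist hT

end HeartComparison

/-! ### Compatibility of levels with truncation, subobjects and quotients. -/

section FamilyTStructure

variable {C : Type w} [Category.{v} C] [Preadditive C] [HasZeroObject C] [HasShift C ℤ]
  [∀ n : ℤ, (shiftFunctor C n).Additive] [Pretriangulated C]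
variable {Λ : Type x} {lev : Λ → ℕ} {N D : Λ → C}

/-- `t` is the t-structure attached to the families `N` and `D`. -/
structure IsFamilyTStructure (E : Type u) [CommRing E] [Linear E C] (N D : Λ → C)
    (t : TStructure C) : Prop where
  le_zero : t.le 0 = extensionHull (nonnegShifts D Set.univ)
  ge_zero : t.ge 0 = extensionHull (coneShifts E N Set.univ 0)

variable {E : Type u} [CommRing E] [Linear E C] {t : TStructure C}

namespace IsFamilyTStructure

variable (ht : IsFamilyTStructure E N D t)
include ht

theorem isLE_iff (X : C) : t.IsLE X 0 ↔ extensionHull (nonnegShifts D Set.univ) X := by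
  rw [← t.le_iff_isLE, ht.le_zero]

theorem isGE_iff (X : C) : t.IsGE X 0 ↔ extensionHull (coneShifts E N Set.univ 0) X := by
  rw [← t.ge_iff_isGE, ht.ge_zero]

theorem del_isLE (l : Λ) : t.IsLE (D l) 0 :=
  (ht.isLE_iff _).2 (.of_mem _ ⟨l, trivial, 0, le_rfl, ⟨(shiftZeroIso _).symm⟩⟩)

theorem nab_isGE (l : Λ) : t.IsGE (N l) 0 :=
  (ht.isGE_iff _).2 (.of_mem _ ⟨l, trivial, N l, 0, Or.inl rfl, le_rfl, ⟨(shiftZeroIso _).symm⟩⟩)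

/-- `T^{≥ 0}` is the right orthogonal of `T^{≤ -1}`, which is generated under extensions by the `(D
l)⟦n⟧` with `n ≥ 1`. -/
theorem isGE_iff_del_hom (X : C) :
    t.IsGE X 0 ↔ ∀ (l : Λ) (n : ℤ), 1 ≤ n → ∀ f : (D l)⟦n⟧ ⟶ X, f = 0 := by
  refine ⟨fun hX l n hn f => ?_, fun h => ?_⟩
  · have := ht.del_isLE l
    have := t.isLE_shift (D l) 0 n (-n)
    exact t.zero f (-n) 0
  · rw [t.isGE_iff_orthogonal (-1) 0 (by lia)]
    intro Y f hY
    have hY' : extensionHull (nonnegShifts D Set.univ) (Y⟦(-1 : ℤ)⟧) :=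
      (ht.isLE_iff _).1 (t.isLE_shift Y (-1) (-1) 0)
    let e : Y ≅ (Y⟦(-1 : ℤ)⟧)⟦(1 : ℤ)⟧ :=
      (shiftZeroIso Y).symm ≪≫ (shiftShiftIso Y (-1) 1 0 rfl).symm
    have h₁ := extensionHull_shift (Q := fun Z => ∃ l, ∃ n : ℤ, 1 ≤ n ∧ Nonempty (Z ≅ (D l)⟦n⟧)) 1
      (fun Z ⟨l, _, n, hn, ⟨e⟩⟩ => .of_mem _ ⟨l, n + 1, by lia,
        ⟨(shiftFunctor C (1 : ℤ)).mapIso e ≪≫ shiftShiftIso _ _ _ _ rfl⟩⟩) hY'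
    have h₂ := extensionHull_hom_eq_zero (Q := fun Z => Z = X)
      (by
        rintro Z _ ⟨l, n, hn, ⟨e⟩⟩ rfl f
        rw [← cancel_epi e.inv, h l n hn (e.inv ≫ f), comp_zero]) h₁
      (.of_mem _ rfl) (e.inv ≫ f)
    rw [← cancel_epi e.inv, h₂, comp_zero]

end IsFamilyTStructure

variable [IsTriangulated C] [∀ n : ℤ, (shiftFunctor C n).Linear E] [IsDomain E]
  [IsPrincipalIdealRing E]
variable (hN : IsExceptionalFamily lev N E) (hD : IsDualFamily lev N D)
  (ht : IsFamilyTStructure E N D t)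
include hN hD ht

/-- The left term is built from `D l` of level `< m`, which have level `< m` in terms of the `N l`
too; hence so does the right term. -/
theorem exists_truncation {m : ℕ} {X : C} (hX : levelLT lev N m X) :
    ∃ (A B : C) (f : A ⟶ X) (g : X ⟶ B) (h : B ⟶ A⟦(1 : ℤ)⟧),
      Triangle.mk f g h ∈ distTriang C ∧ extensionHull (nonnegShifts D {l | lev l < m}) A ∧
      levelLT lev N m A ∧ levelLT lev N m B ∧ t.IsLE A 0 ∧ t.IsGE B 1 := by
  obtain ⟨A, B, f, g, h, hT, hA, hB⟩ := levelLT_le_truncation hN hD m X hX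
  have hle : (extensionHull (nonnegShifts D {l | lev l < m}) : ObjectProperty C) ≤
      levelLT lev N m := by
    refine extensionHull_le ?_
    rintro X ⟨l, hl, n, -, ⟨e⟩⟩
    exact (levelLT lev N m).prop_of_iso e.symm
      ((levelLT lev N m).le_shift n _ (levelLT_mono lev N hl _ (hD.del_mem l)))
  refine ⟨A, B, f, g, h, hT, hA, hle A hA,
    (levelLT lev N m).ext_of_isTriangulatedClosed₃ _ hT (hle A hA) hX, ?_, ?_⟩
  · exact (ht.isLE_iff A).2 (extensionHull_mono (nonnegShifts_mono D (Set.subset_univ _)) _ hA)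
  · have : t.IsGE (B⟦(1 : ℤ)⟧) 0 := (ht.isGE_iff _).2 (coneShifts_shift (by lia)
      (extensionHull_mono (coneShifts_mono N (Set.subset_univ _) _) _ hB))
    exact t.isGE_of_shift B 1 1 0

/-- The right term of the truncation triangle lies both in `T^{≤ 0}` and in `T^{≥ 1}`, so it
vanishes. -/
theorem extensionHull_of_isLE {m : ℕ} {X : C} (hX : levelLT lev N m X) [t.IsLE X 0] :
    extensionHull (nonnegShifts D {l | lev l < m}) X := by
  obtain ⟨A, B, f, g, h, hT, hA, -, -, hA', hB⟩ := exists_truncation hN hD ht hX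
  have hB' : t.IsLE B 0 := by
    have : t.IsLE (A⟦(1 : ℤ)⟧) 0 := by
      have := t.isLE_shift A 0 1 (-1)
      exact t.isLE_of_le _ (-1) 0
    exact t.isLE₂ _ (dist_rotate hT) 0 ‹_› this
  have : IsIso f := (Triangle.isZero₃_iff_isIso₁ _ hT).1 (t.isZero B 0 1)
  exact extensionHull_of_iso (asIso f) hA

/-- Truncation triangles are unique, so up to a shift this one is given by `exists_truncation`. -/
theorem levelLT_of_dist {m : ℕ} {A X B : C} {f : A ⟶ X} {g : X ⟶ B} {h : B ⟶ A⟦(1 : ℤ)⟧}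
    (hT : Triangle.mk f g h ∈ distTriang C) (hX : levelLT lev N m X) {n : ℤ} [t.IsLE A n]
    [t.IsGE B (n + 1)] : levelLT lev N m A ∧ levelLT lev N m B := by
  obtain ⟨A', B', f', g', h', hT', -, hA, hB, hA', hB'⟩ :=
    exists_truncation hN hD ht ((levelLT lev N m).le_shift n X hX)
  have h₁ := t.isLE_shift A n n 0
  have h₂ := t.isGE_shift B (n + 1) n 1
  obtain ⟨e, -⟩ := t.triangle_iso_exists hT' (Triangle.shift_distinguished _ hT n)
    (Iso.refl _) 0 1 hA' hB' h₁ h₂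
  have h₃ := (levelLT lev N m).prop_of_iso (Triangle.π₁.mapIso e) hA
  have h₄ := (levelLT lev N m).prop_of_iso (Triangle.π₃.mapIso e) hB
  exact ⟨((levelLT lev N m).prop_shift_iff_of_isStableUnderShift A n).1 h₃,
    ((levelLT lev N m).prop_shift_iff_of_isStableUnderShift B n).1 h₄⟩

/-- Morphisms from `D l` to objects of the same level are detected on `N p`. -/
theorem del_hom_del_injective {l p : Λ} (h : lev l = lev p) {c : D p ⟶ N p}
    (hc : (levelLT lev N (lev p)).trW c) (n : ℤ) (f : D l ⟶ (D p)⟦n⟧)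
    (hf : f ≫ c⟦n⟧' = 0) : f = 0 := by
  obtain ⟨Z, g, k, hT, hZ⟩ := hc
  have : (levelLT lev N (lev p)).leftOrthogonal (D l) := fun Y f hY => by
    rw [← cancel_mono (shiftZeroIso Y).inv, zero_comp]
    exact hD.hom_levelLT h.ge hY 0 _
  rw [← isColocal_trW] at this
  exact (this _ (trW.shift ⟨Z, g, k, hT, hZ⟩ n)).1 (by simpa using hf)

/-- `D l` is projective relative to objects of level at most its own. Such an `X` is built from `(D
p)⟦k⟧` with `k ≥ 0`: lower `p` contribute nothing by duality, and for `p` of the same level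
morphisms are detected on `N p`. -/
theorem del_hom_shift_eq_zero {l : Λ} {X : C} (hX : levelLT lev N (lev l + 1) X) [t.IsLE X 0]
    {n : ℤ} (hn : 1 ≤ n) (f : D l ⟶ X⟦n⟧) : f = 0 := by
  have h := extensionHull_shift (Q := fun Y => ∀ f : D l ⟶ Y, f = 0) n
    (P := nonnegShifts D {p | lev p < lev l + 1}) ?_ (extensionHull_of_isLE hN hD ht hX)
  · exact extensionHull_hom_eq_zero (P := fun Y => Y = D l) (by rintro _ Y rfl hY f; exact hY f)
      (.of_mem _ rfl) h f
  · rintro Y ⟨p, hp, k, hk, ⟨e⟩⟩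
    refine .of_mem _ fun f => ?_
    let e' := (shiftFunctor C n).mapIso e ≪≫ shiftShiftIso (D p) k n _ rfl
    rw [← cancel_mono e'.hom, zero_comp]
    rcases Nat.lt_succ_iff_lt_or_eq.1 hp with hlt | heq
    · exact hD.hom_levelLT le_rfl (levelLT_mono lev N hlt _ (hD.del_mem p)) _ _
    · obtain ⟨c, hc⟩ := hD.exists_canonical p
      refine del_hom_del_injective hN hD ht heq.symm hc _ _ ?_
      rw [← cancel_epi (shiftZeroIso (D l)).hom, comp_zero]
      exact del_hom_nab_eq_zero hN hD (fun _ => by lia) _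

theorem H0_levelLT_of_isLE {m : ℕ} {X : C} (hX : levelLT lev N m X) [t.IsLE X 0] :
    levelLT lev N m ((H0 t).obj X).obj := by
  obtain ⟨A, hA, f, h, hT⟩ := exists_dist_toH0 t X
  have : t.IsGE ((H0 t).obj X).obj (-1 + 1) := heart_isGE t _
  exact (levelLT_of_dist hN hD ht hT hX (n := -1)).2

theorem H0_levelLT_of_isGE {m : ℕ} {X : C} (hX : levelLT lev N m X) [t.IsGE X 0] :
    levelLT lev N m ((H0 t).obj X).obj := by
  obtain ⟨B, hB, f, h, hT⟩ := exists_dist_fromH0 t X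
  have : t.IsGE B (0 + 1) := hB
  exact (levelLT_of_dist hN hD ht hT hX (n := 0)).1

/-- The objects of level `< m` in the heart form a subcategory closed under subobjects and
quotients. -/
theorem levelLT_of_short_exact {m : ℕ} {M X Y : C} {f : M ⟶ X} {g : X ⟶ Y} {h : Y ⟶ M⟦(1 : ℤ)⟧}
    (hT : Triangle.mk f g h ∈ distTriang C) (hX : levelLT lev N m X) [t.IsLE M 0] [t.IsGE M 0]
    [t.IsLE Y 0] [t.IsGE Y 0] : levelLT lev N m M ∧ levelLT lev N m Y := by
  suffices ∀ k, levelLT lev N (m + k) M → levelLT lev N (m + k) Y →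
      levelLT lev N m M ∧ levelLT lev N m Y by
    obtain ⟨a, ha⟩ := hN.exists_levelLT M
    obtain ⟨b, hb⟩ := hN.exists_levelLT Y
    exact this (max a b) (levelLT_mono lev N (by lia) _ ha) (levelLT_mono lev N (by lia) _ hb)
  intro k
  induction k with
  | zero => exact fun h₁ h₂ => ⟨h₁, h₂⟩
  | succ k ih =>
    intro hM hY
    -- The excess level is removed one unit at a time. Morphisms `D l ⟶ M⟦n⟧` vanish by the
    -- t-structure for `n < 0`, by injectivity of `M ⟶ X` for `n = 0`, and by relative projectivity
    -- for `n > 0`.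
    have key : levelLT lev N (m + k) M := by
      refine hD.mem_levelLT_of_del_hom hM fun l hl n a => ?_
      have := ht.del_isLE l
      rcases lt_trichotomy n 0 with hn | rfl | hn
      · have := t.isGE_shift M 0 n (-n)
        exact t.zero a 0 (-n)
      · rw [← cancel_mono (shiftZeroIso M).hom, zero_comp]
        refine IsTMono.of_dist (t := t) hT this _ ?_
        rw [← cancel_mono (shiftZeroIso X).inv, zero_comp]
        exact hD.hom_levelLT (by lia) hX 0 _
      · exact del_hom_shift_eq_zero hN hD ht (by rw [hl]; exact hM) hn a
    exact ih key ((levelLT lev N (m + k)).ext_of_isTriangulatedClosed₃ _ hT key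
      (levelLT_mono lev N (Nat.le_add_right _ _) _ hX))

theorem levelLT_of_mono {m : ℕ} {M X : HeartCat t} (f : M ⟶ X) [Mono f]
    (hX : levelLT lev N m X.obj) : levelLT lev N m M.obj := by
  obtain ⟨δ, hT⟩ := exists_dist_of_mono t f
  exact (levelLT_of_short_exact hN hD ht hT hX).1

/-- An object of the heart of level `≤ m` but not of level `< m` receives a nonzero morphism
from some `D l` of level `m`. -/
theorem exists_del_hom_ne_zero {m : ℕ} {S : HeartCat t} (hS : levelLT lev N (m + 1) S.obj)
    (hS' : ¬ levelLT lev N m S.obj) : ∃ l, lev l = m ∧ ∃ φ : D l ⟶ S.obj, φ ≠ 0 := by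
  by_contra! H
  refine hS' (hD.mem_levelLT_of_del_hom hS fun l hl n a => ?_)
  have := ht.del_isLE l
  rcases lt_trichotomy n 0 with hn | rfl | hn
  · have := t.isGE_shift S.obj 0 n (-n)
    exact t.zero a 0 (-n)
  · rw [← cancel_mono (shiftZeroIso S.obj).hom, zero_comp]
    exact H l hl _
  · subst hl
    exact del_hom_shift_eq_zero hN hD ht hS hn a

end FamilyTStructure

/-! ### Criteria for simple heads and socles in an abelian category. -/

section HeadSocle

variable {A : Type w} [Category.{v} A] [Abelian A]

attribute [local instance] Abelian.hasFiniteBiproducts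

theorem isSemisimpleObj_of_simple (S : A) [h : Simple S] : IsSemisimpleObj S :=
  ⟨1, fun _ => S, fun _ => h, ⟨(biproductUniqueIso fun _ : Fin 1 => S).symm⟩⟩

theorem isSocle_of_simple {S X : A} (s : S ⟶ X) [Mono s] [Simple S]
    (h : ∀ (S' : A) (s' : S' ⟶ X), Simple S' → ∃ r : S' ⟶ S, r ≫ s = s') : IsSocle s where
  mono := inferInstance
  semisimple := isSemisimpleObj_of_simple S
  factors := by
    rintro S' s' - ⟨n, T, hT, ⟨e⟩⟩
    choose r hr using fun j => h (T j) (biproduct.ι T j ≫ e.inv ≫ s') (hT j)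
    refine ⟨e.hom ≫ biproduct.desc r, ?_⟩
    rw [← cancel_epi e.inv]
    refine biproduct.hom_ext' _ _ fun j => ?_
    simp [hr]

theorem isHead_of_simple {X Q : A} (q : X ⟶ Q) [Epi q] [Simple Q]
    (h : ∀ (Q' : A) (q' : X ⟶ Q'), Simple Q' → ∃ r : Q ⟶ Q', q ≫ r = q') : IsHead q where
  epi := inferInstance
  semisimple := isSemisimpleObj_of_simple Q
  factors := by
    rintro Q' q' - ⟨n, T, hT, ⟨e⟩⟩
    choose r hr using fun j => h (T j) (q' ≫ e.hom ≫ biproduct.π T j) (hT j)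
    refine ⟨biproduct.lift r ≫ e.inv, ?_⟩
    rw [← cancel_mono e.hom]
    refine biproduct.hom_ext _ _ fun j => ?_
    simp [hr]

variable {X Y I : A} {f : X ⟶ Y} {e : X ⟶ I} {i : I ⟶ Y} [Epi e] [Mono i] (hf : e ≫ i = f)
include hf

/-- A nonzero subobject of `I` is a nonzero subobject of `Y`, so `f` factors through it; hence so
does the epimorphism `e`. -/
theorem simple_image (hf0 : f ≠ 0)
    (hY : ∀ (S : A) (s : S ⟶ Y), Mono s → s ≠ 0 → ∃ ψ : X ⟶ S, ψ ≫ s = f) : Simple I where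
  mono_isIso_iff_nonzero {S} s _ := by
    constructor
    · rintro h rfl
      have : IsIso (0 : S ⟶ I) := h
      have hI : 𝟙 I = 0 := by rw [← IsIso.inv_hom_id (0 : S ⟶ I), comp_zero]
      exact hf0 (by rw [← hf, ← Category.id_comp i, hI, zero_comp, comp_zero])
    · intro hs
      obtain ⟨ψ, hψ⟩ := hY S (s ≫ i) inferInstance
        (fun h => hs (by rwa [← cancel_mono i, zero_comp]))
      have hψe : ψ ≫ s = e := by rw [← cancel_mono i, Category.assoc, hψ, hf]
      have : Epi (ψ ≫ s) := hψe ▸ inferInstance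
      have : Epi s := epi_of_epi ψ s
      exact isIso_of_mono_of_epi s

/-- `I` maps into every subobject of `Y` through which `f` factors. For `Z` this gives the embedding
of `I`; for a simple subobject of `Z` it gives a nonzero map between simple objects, hence an
isomorphism. -/
theorem hasSimpleSocle (hf0 : f ≠ 0)
    (hY : ∀ (S : A) (s : S ⟶ Y), Mono s → s ≠ 0 → ∃ ψ : X ⟶ S, ψ ≫ s = f)
    {Z : A} (q : X ⟶ Z) (r : Z ⟶ Y) [Mono r] (hqr : q ≫ r = f) : HasSimpleSocle Z I := by
  have lift : ∀ {S : A} (ψ : X ⟶ S) (s : S ⟶ Y), Mono s → ψ ≫ s = f → ∃ τ : I ⟶ S, τ ≫ s = i := by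
    intro S ψ s _ hψ
    have h : kernel.ι e ≫ ψ = 0 := by
      rw [← cancel_mono s, Category.assoc, hψ, ← hf, kernel.condition_assoc, zero_comp, zero_comp]
    refine ⟨Abelian.epiDesc e ψ h, ?_⟩
    rw [← cancel_epi e, Abelian.comp_epiDesc_assoc, hψ, hf]
  have hI := simple_image hf hf0 hY
  obtain ⟨σ, hσ⟩ := lift q r inferInstance hqr
  have : Mono (σ ≫ r) := hσ ▸ inferInstance
  have : Mono σ := mono_of_mono σ r
  refine ⟨hI, σ, isSocle_of_simple σ fun S s hS => ?_⟩
  by_cases hs : s = 0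
  · exact ⟨0, by rw [hs, zero_comp]⟩
  have : Mono s := mono_of_nonzero_from_simple hs
  obtain ⟨ψ, hψ⟩ := hY S (s ≫ r) inferInstance
    (fun h => hs (by rwa [← cancel_mono r, zero_comp]))
  obtain ⟨τ, hτ⟩ := lift ψ (s ≫ r) inferInstance hψ
  have hτ0 : τ ≠ 0 := by
    rintro rfl
    exact hf0 (by rw [← hf, ← hτ, zero_comp, comp_zero])
  have : IsIso τ := isIso_of_hom_simple hτ0
  refine ⟨inv τ, ?_⟩
  rw [← cancel_mono r, Category.assoc, hσ, ← hτ, IsIso.inv_hom_id_assoc]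

/-- For a simple quotient `S` of `Z`, the kernel of `X ⟶ S` must die in `I`, since otherwise it
would be all of `X`. So `X ⟶ I` factors through `S`, which is therefore isomorphic to `I`. -/
theorem hasSimpleHead (hf0 : f ≠ 0)
    (hY : ∀ (S : A) (s : S ⟶ Y), Mono s → s ≠ 0 → ∃ ψ : X ⟶ S, ψ ≫ s = f)
    (hX : ∀ (M : A) (m : M ⟶ X), Mono m → m ≫ f ≠ 0 → Epi m)
    {Z : A} (q : X ⟶ Z) (r : Z ⟶ Y) [Epi q] (hqr : q ≫ r = f) : HasSimpleHead Z I := by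
  have hI := simple_image hf hf0 hY
  have hρ : kernel.ι q ≫ e = 0 := by
    rw [← cancel_mono i, Category.assoc, hf, ← hqr, kernel.condition_assoc, zero_comp, zero_comp]
  obtain ⟨ρ, hρe⟩ : ∃ ρ : Z ⟶ I, q ≫ ρ = e := ⟨_, Abelian.comp_epiDesc q e hρ⟩
  have : Epi (q ≫ ρ) := hρe ▸ inferInstance
  have : Epi ρ := epi_of_epi q ρ
  refine ⟨hI, ρ, isHead_of_simple ρ fun S s hS => ?_⟩
  by_cases hs : s = 0
  · exact ⟨0, by rw [hs, comp_zero]⟩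
  have : Epi s := epi_of_nonzero_to_simple hs
  have hqs : q ≫ s ≠ 0 := fun h => hs (by rwa [← cancel_epi q, comp_zero])
  have hk : kernel.ι (q ≫ s) ≫ e = 0 := by
    by_contra hk
    have : Epi (kernel.ι (q ≫ s)) := hX _ _ inferInstance
      (fun h => hk (by rw [← cancel_mono i, Category.assoc, hf, h, zero_comp]))
    exact hqs (by rw [← cancel_epi (kernel.ι (q ≫ s)), kernel.condition, comp_zero])
  obtain ⟨w, hw⟩ : ∃ w : S ⟶ I, (q ≫ s) ≫ w = e := ⟨_, Abelian.comp_epiDesc (q ≫ s) e hk⟩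
  have hw0 : w ≠ 0 := by
    rintro rfl
    exact hf0 (by rw [← hf, ← hw, comp_zero, zero_comp])
  have : IsIso w := isIso_of_hom_simple hw0
  refine ⟨inv w, ?_⟩
  rw [← cancel_epi q, reassoc_of% hρe, ← hw, Category.assoc, Category.assoc, IsIso.hom_inv_id,
    Category.comp_id]

end HeadSocle

/-! ### Factorizations through the heart and the image of `H⁰`. -/

section ImageH0

variable {C : Type w} [Category.{v} C] [Preadditive C] [HasZeroObject C] [HasShift C ℤ]
  [∀ n : ℤ, (shiftFunctor C n).Additive] [Pretriangulated C] [IsTriangulated C] {t : TStructure C}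

theorem exists_H0_factorization {X Y : C} [t.IsLE X 0] [t.IsGE Y 0] {c : X ⟶ Y} {Z : HeartCat t}
    {q : X ⟶ Z.obj} {r : Z.obj ⟶ Y} (hqr : q ≫ r = c) :
    ∃ (q' : (H0 t).obj X ⟶ Z) (r' : Z ⟶ (H0 t).obj Y), toH0 t X ≫ q'.hom = q ∧
      r'.hom ≫ fromH0 t Y = r ∧ q' ≫ r' = (H0 t).map c := by
  obtain ⟨q', hq⟩ := exists_toH0_comp t X q
  obtain ⟨r', hr⟩ := exists_comp_fromH0 t Y r
  refine ⟨ObjectProperty.homMk q', ObjectProperty.homMk r', hq, hr, ?_⟩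
  ext
  refine (isTEpi_toH0 t X).eq ((isTMono_fromH0 t Y).eq ?_)
  have h := toH0_H0_map_fromH0 t c
  rw [Category.assoc, Category.assoc, h]
  change toH0 t X ≫ (q' ≫ r') ≫ fromH0 t Y = c
  rw [Category.assoc, hr, reassoc_of% hq, hqr]

theorem IsTEpi.of_comp {X Y Z : C} {f : X ⟶ Y} {g : Y ⟶ Z} (h : IsTEpi t (f ≫ g)) : IsTEpi t g :=
  fun _ hW a ha => h hW a (by rw [Category.assoc, ha, comp_zero])

theorem IsTMono.of_comp {X Y Z : C} {f : X ⟶ Y} {g : Y ⟶ Z} (h : IsTMono t (f ≫ g)) :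
    IsTMono t f :=
  fun _ hW a ha => h hW a (by rw [← Category.assoc, ha, zero_comp])

theorem nonempty_iso_image_H0 {X Y : C} [t.IsLE X 0] [t.IsGE Y 0] {c : X ⟶ Y} {Z : HeartCat t}
    {q : X ⟶ Z.obj} {r : Z.obj ⟶ Y} (hqr : q ≫ r = c) (hq : IsTEpi t q) (hr : IsTMono t r) :
    Nonempty (Z ≅ (imageSubobject ((H0 t).map c) : HeartCat t)) := by
  obtain ⟨q', r', h₁, h₂, h⟩ := exists_H0_factorization hqr
  have : Epi q' := IsTEpi.epi (IsTEpi.of_comp (h₁.symm ▸ hq))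
  have : Mono r' := IsTMono.mono (IsTMono.of_comp (h₂.symm ▸ hr))
  have : StrongEpi q' := strongEpi_of_epi q'
  exact ⟨image.isoStrongEpiMono q' r' h ≪≫ (imageSubobjectIso _).symm⟩

end ImageH0

/-! ### Simplicity of the image over a field. -/

section FieldCoefficients

variable {C : Type w} [Category.{v} C] [Preadditive C] [HasZeroObject C] [HasShift C ℤ]
  [∀ n : ℤ, (shiftFunctor C n).Additive] [Pretriangulated C] [IsTriangulated C]
variable {Λ : Type x} {lev : Λ → ℕ} {N D : Λ → C}
variable {E : Type u} [Field E] [Linear E C] [∀ n : ℤ, (shiftFunctor C n).Linear E]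
  {t : TStructure C}
variable (hN : IsExceptionalFamily lev N E) (hD : IsDualFamily lev N D)
  (ht : IsFamilyTStructure E N D t)
include hN hD ht

theorem exists_smul_canonical {l p : Λ} {c : D l ⟶ N l} (hc : (levelLT lev N (lev l)).trW c)
    {φ : D p ⟶ N l} (hφ : φ ≠ 0) : ∃ h : p = l, ∃ a : E, a ≠ 0 ∧ φ = a • (eqToHom (by rw [h]) ≫ c) := by
  have hpl : p = l := by
    by_contra h
    refine hφ ?_
    rw [← cancel_mono (shiftZeroIso (N l)).inv, zero_comp]
    exact hN.del_hom_eq_zero hD h 0 _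
  subst hpl
  obtain ⟨a, ha⟩ := (hN.bijective_smul_canonical hc).2 φ
  refine ⟨rfl, a, ?_, by simpa using ha.symm⟩
  rintro rfl
  exact hφ (by rw [← ha]; simp)

theorem exists_del_hom_of_ne_zero {l : Λ} {S : HeartCat t} (hS : levelLT lev N (lev l + 1) S.obj)
    {s : S.obj ⟶ N l} (hs : s ≠ 0) : ∃ p, lev p = lev l ∧ ∃ φ : D p ⟶ S.obj, φ ≠ 0 := by
  refine exists_del_hom_ne_zero hN hD ht hS fun h => hs ?_
  rw [← cancel_mono (shiftZeroIso (N l)).inv, zero_comp]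
  exact hN.levelLT_hom le_rfl h 0 _

/-- The map `H⁰(D l) ⟶ H⁰(N l)` factors through all nonzero subobjects of its target. -/
theorem exists_factor_H0_map {l : Λ} {c : D l ⟶ N l} (hc : (levelLT lev N (lev l)).trW c)
    (S : HeartCat t) (s : S ⟶ (H0 t).obj (N l)) (_ : Mono s) (hs : s ≠ 0) :
    ∃ ψ : (H0 t).obj (D l) ⟶ S, ψ ≫ s = (H0 t).map c := by
  have := ht.del_isLE l
  have := ht.nab_isGE l
  have hm : IsTMono t (s.hom ≫ fromH0 t (N l)) := (isTMono_of_mono s).comp (isTMono_fromH0 t _)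
  have hs0 : s.hom ≫ fromH0 t (N l) ≠ 0 := fun h => hs (by
    ext
    exact isTMono_fromH0 t (N l) inferInstance _ h)
  have hS : levelLT lev N (lev l + 1) S.obj := levelLT_of_mono hN hD ht s
    (H0_levelLT_of_isGE hN hD ht (mem_levelLT lev N (Nat.lt_succ_self _)))
  -- `S` maps nontrivially to `N l`, so it is not of lower level and receives some `D p`. The
  -- composite `D p ⟶ N l` is nonzero, which forces `p = l` and a multiple of `c`.
  obtain ⟨p, hp, φ, hφ⟩ := exists_del_hom_of_ne_zero hN hD ht hS hs0
  obtain ⟨rfl, a, ha, h⟩ := exists_smul_canonical hN hD ht hc (φ := φ ≫ s.hom ≫ fromH0 t (N l))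
    fun h => hφ (hm (ht.del_isLE p) _ h)
  obtain ⟨q', r', -, h₂, h₃⟩ := exists_H0_factorization (t := t) (c := c) (Z := S)
    (q := a⁻¹ • φ) (r := s.hom ≫ fromH0 t (N p)) (by
      rw [Linear.smul_comp, h, eqToHom_refl, Category.id_comp, smul_smul, inv_mul_cancel₀ ha,
        one_smul])
  have : r' = s := by
    ext
    exact (isTMono_fromH0 t (N p)).eq h₂
  exact ⟨q', this ▸ h₃⟩

/-- A subobject of `H⁰(D l)` with nonzero image in `H⁰(N l)` is everything. -/
theorem epi_of_comp_H0_map_ne_zero {l : Λ} {c : D l ⟶ N l} (hc : (levelLT lev N (lev l)).trW c)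
    (M : HeartCat t) (m : M ⟶ (H0 t).obj (D l)) (_ : Mono m) (hm : m ≫ (H0 t).map c ≠ 0) :
    Epi m := by
  have := ht.del_isLE l
  have := ht.nab_isGE l
  have hs0 : m.hom ≫ ((H0 t).map c).hom ≫ fromH0 t (N l) ≠ 0 := fun h => hm (by
    ext
    exact isTMono_fromH0 t (N l) inferInstance _ (by simpa using h))
  have hM : levelLT lev N (lev l + 1) M.obj := levelLT_of_mono hN hD ht m
    (H0_levelLT_of_isLE hN hD ht (hD.del_mem l))
  obtain ⟨p, hp, φ, hφ⟩ := exists_del_hom_of_ne_zero hN hD ht hM hs0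
  have := ht.del_isLE p
  obtain ⟨A, hA, f, h, hT⟩ := exists_dist_toH0 t (D l)
  have hAl : levelLT lev N (lev l + 1) A := by
    have : t.IsGE ((H0 t).obj (D l)).obj (-1 + 1) := heart_isGE t _
    exact (levelLT_of_dist hN hD ht hT (hD.del_mem l) (n := -1)).1
  have := t.isLE_of_le A (-1) 0
  -- `D p` has no morphisms to `A⟦1⟧`, so `D p ⟶ M ⟶ H⁰(D l)` lifts to `D l`.
  obtain ⟨b, hb⟩ := dist_lift₃ hT (φ ≫ m.hom)
    (del_hom_shift_eq_zero hN hD ht (l := p) (by rwa [hp]) le_rfl _)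
  have hb0 : b ≠ 0 := by
    rintro rfl
    rw [zero_comp] at hb
    exact hφ (isTMono_of_mono m inferInstance _ hb.symm)
  have inj : ∀ g : D p ⟶ D l, g ≫ c = 0 → g = 0 := fun g hg => by
    rw [← cancel_mono (shiftZeroIso (D l)).inv, zero_comp]
    refine del_hom_del_injective hN hD ht hp hc 0 _ ?_
    have := (shiftFunctorZero C ℤ).inv.naturality c
    change c ≫ (shiftZeroIso (N l)).inv = (shiftZeroIso (D l)).inv ≫ c⟦(0 : ℤ)⟧' at this
    rw [Category.assoc, ← this, reassoc_of% hg, zero_comp]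
  obtain ⟨rfl, a, ha, h'⟩ := exists_smul_canonical hN hD ht hc (φ := b ≫ c) fun h => hb0 (inj b h)
  -- Composition with `c` is injective on such lifts, so `b` itself is an invertible scalar; hence
  -- `D l ⟶ H⁰(D l)` factors through `M` up to a unit.
  have hba : b = a • 𝟙 _ := by
    rw [← sub_eq_zero]
    refine inj _ ?_
    rw [Preadditive.sub_comp, h']
    simp
  refine IsTEpi.epi (IsTEpi.of_comp (f := φ) ?_)
  rw [← hb, hba]
  have : IsIso (a • 𝟙 (D p)) := ⟨a⁻¹ • 𝟙 _, by simp [smul_smul, ha], by simp [smul_smul, ha]⟩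
  exact (IsTEpi.of_epi _).comp (isTEpi_toH0 t _)

theorem H0_map_canonical_ne_zero {l : Λ} {c : D l ⟶ N l} (hc : (levelLT lev N (lev l)).trW c) :
    (H0 t).map c ≠ 0 := by
  intro h
  have := ht.del_isLE l
  have := ht.nab_isGE l
  have h₁ : c = 0 := by
    rw [← toH0_H0_map_fromH0 t c, h]
    exact (congrArg (toH0 t _ ≫ ·) zero_comp).trans comp_zero
  exact one_ne_zero ((hN.bijective_smul_canonical hc).1
    (show (1 : E) • c = (0 : E) • c by rw [h₁, smul_zero, smul_zero]))

theorem hasSimpleHead_image {l : Λ} {c : D l ⟶ N l} (hc : (levelLT lev N (lev l)).trW c)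
    {Z : HeartCat t} {q : D l ⟶ Z.obj} {r : Z.obj ⟶ N l} (hqr : q ≫ r = c) (hq : IsTEpi t q) :
    HasSimpleHead Z (imageSubobject ((H0 t).map c) : HeartCat t) := by
  have := ht.del_isLE l
  have := ht.nab_isGE l
  obtain ⟨q', r', h₁, h₂, h⟩ := exists_H0_factorization hqr
  have : Epi q' := IsTEpi.epi (IsTEpi.of_comp (h₁.symm ▸ hq))
  exact hasSimpleHead (imageSubobject_arrow_comp _) (H0_map_canonical_ne_zero hN hD ht hc)
    (exists_factor_H0_map hN hD ht hc) (epi_of_comp_H0_map_ne_zero hN hD ht hc) q' r' h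

theorem hasSimpleSocle_image {l : Λ} {c : D l ⟶ N l} (hc : (levelLT lev N (lev l)).trW c)
    {Z : HeartCat t} {q : D l ⟶ Z.obj} {r : Z.obj ⟶ N l} (hqr : q ≫ r = c) (hr : IsTMono t r) :
    HasSimpleSocle Z (imageSubobject ((H0 t).map c) : HeartCat t) := by
  have := ht.del_isLE l
  have := ht.nab_isGE l
  obtain ⟨q', r', h₁, h₂, h⟩ := exists_H0_factorization hqr
  have : Mono r' := IsTMono.mono (IsTMono.of_comp (h₂.symm ▸ hr))
  exact hasSimpleSocle (imageSubobject_arrow_comp _) (H0_map_canonical_ne_zero hN hD ht hc)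
    (exists_factor_H0_map hN hD ht hc) q' r' h

end FieldCoefficients

/-! ### Torsion quotients and saturated subobjects. -/

theorem pow_smul_eq_zero_of_irreducible {E : Type u} [CommRing E] [IsDomain E]
    [IsDiscreteValuationRing E] {M : Type v} [AddCommGroup M] [Module E M] {ϖ ϖ' : E}
    (h : Irreducible ϖ) (h' : Irreducible ϖ') {n : ℕ} {x : M} (hx : ϖ' ^ n • x = 0) :
    ϖ ^ n • x = 0 := by
  obtain ⟨a, ha⟩ := ((IsDiscreteValuationRing.associated_of_irreducible E h' h).pow_pow
    (n := n)).dvd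
  rw [ha, mul_comm, mul_smul, hx, smul_zero]

section Saturation

variable {A : Type w} [Category.{v} A] [Abelian A] {E : Type u} [CommRing E] [Linear E A]

theorem smul_id_cokernel_ofLE_eq_zero_iff {Y : A} {L M : Subobject Y} (h : L ≤ M) (a : E) :
    a • 𝟙 (cokernel (Subobject.ofLE L M h)) = 0 ↔ a • (M.arrow ≫ cokernel.π L.arrow) = 0 := by
  constructor
  · intro ha
    have hd : Subobject.ofLE L M h ≫ M.arrow ≫ cokernel.π L.arrow = 0 := by
      rw [Subobject.ofLE_arrow_assoc, cokernel.condition]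
    rw [← cokernel.π_desc _ _ hd, ← Category.id_comp (cokernel.desc _ _ hd), ← Linear.comp_smul,
      ← Linear.smul_comp, ha, zero_comp, comp_zero]
  · intro ha
    have hy : (a • M.arrow) ≫ cokernel.π L.arrow = 0 := by rw [Linear.smul_comp, ha]
    have hy' : Abelian.monoLift L.arrow _ hy ≫ Subobject.ofLE L M h = a • 𝟙 _ := by
      rw [← cancel_mono M.arrow, Category.assoc, Subobject.ofLE_arrow, Abelian.monoLift_comp,
        Linear.smul_comp, Category.id_comp]
    rw [← cancel_epi (cokernel.π (Subobject.ofLE L M h)), comp_zero, Linear.comp_smul,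
      Category.comp_id, ← Category.id_comp (cokernel.π _), ← Linear.smul_comp, ← hy',
      Category.assoc, cokernel.condition, comp_zero]

/-- The subobjects containing `L` whose quotient by `L` is torsion. -/
def torsionOver (E : Type u) [CommRing E] [Linear E A] {Y : A} (L : Subobject Y) :
    Set (Subobject Y) :=
  {M | ∃ h : L ≤ M, IsTorsionObj E (cokernel (Subobject.ofLE L M h))}

variable [IsDomain E] [IsDiscreteValuationRing E]

theorem mem_torsionOver_iff {Y : A} {L M : Subobject Y} {ϖ : E} (hϖ : Irreducible ϖ) :
    M ∈ torsionOver E L ↔ L ≤ M ∧ ∃ n : ℕ, ϖ ^ n • (M.arrow ≫ cokernel.π L.arrow) = 0 := by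
  constructor
  · rintro ⟨h, ϖ', hϖ', n, -, hn⟩
    exact ⟨h, n, pow_smul_eq_zero_of_irreducible hϖ hϖ'
      ((smul_id_cokernel_ofLE_eq_zero_iff h _).1 hn)⟩
  · rintro ⟨h, n, hn⟩
    refine ⟨h, ϖ, hϖ, n + 1, by lia, (smul_id_cokernel_ofLE_eq_zero_iff h _).2 ?_⟩
    rw [pow_succ', mul_smul, hn, smul_zero]

variable {Y : A} {L : Subobject Y} {ϖ : E} (hϖ : Irreducible ϖ) {n : ℕ}
  (hn : ∀ (S : A) (f : S ⟶ cokernel L.arrow) (m : ℕ), ϖ ^ m • f = 0 → ϖ ^ n • f = 0)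
include hϖ hn

/-- As `ϖ ^ n` kills all power torsion mapping to `Y / L`, the largest torsion extension of `L` is
the preimage in `Y` of the kernel of `ϖ ^ n` on `Y / L`. -/
theorem isGreatest_torsionOver : IsGreatest (torsionOver E L)
    (kernelSubobject (ϖ ^ n • cokernel.π L.arrow)) := by
  constructor
  · rw [mem_torsionOver_iff hϖ]
    refine ⟨le_kernelSubobject _ _ (by rw [Linear.comp_smul, cokernel.condition, smul_zero]), n, ?_⟩
    rw [← Linear.comp_smul, kernelSubobject_arrow_comp]
  · intro M hM
    obtain ⟨h, m, hm⟩ := (mem_torsionOver_iff hϖ).1 hM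
    refine le_kernelSubobject _ _ ?_
    rw [Linear.comp_smul]
    exact hn _ _ m hm

/-- After an epimorphic refinement, `f` lifts to `x` in `Y` with `ϖ • x` in `M`. Then `x` is torsion
modulo `L`, so it lies in `M` by maximality. -/
theorem hom_cokernel_eq_zero_of_isGreatest {M : Subobject Y}
    (hM : IsGreatest (torsionOver E L) M) {S : A} (f : S ⟶ cokernel M.arrow) (hf : ϖ • f = 0) :
    f = 0 := by
  obtain ⟨S', p, _, x, hx⟩ := surjective_up_to_refinements_of_epi (cokernel.π M.arrow) f
  obtain ⟨h, m, hm⟩ := (mem_torsionOver_iff hϖ).1 hM.1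
  have hy : (ϖ • x) ≫ cokernel.π M.arrow = 0 := by
    rw [Linear.smul_comp, ← hx, ← Linear.comp_smul, hf, comp_zero]
  have hxL : ϖ ^ (m + 1) • (x ≫ cokernel.π L.arrow) = 0 := by
    have h₁ := Abelian.monoLift_comp M.arrow _ hy
    rw [pow_succ, mul_smul, ← Linear.smul_comp, ← h₁, Category.assoc, ← Linear.comp_smul, hm,
      comp_zero]
  have hxn := hn _ _ _ hxL
  rw [← Linear.comp_smul] at hxn
  obtain ⟨y, hy⟩ : ∃ y : S' ⟶ (M : A), y ≫ M.arrow = x := by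
    have hle := (isGreatest_torsionOver hϖ hn).1
    refine ⟨factorThruKernelSubobject _ x hxn ≫ Subobject.ofLE _ M (hM.2 hle), ?_⟩
    rw [Category.assoc, Subobject.ofLE_arrow, factorThruKernelSubobject_comp_arrow]
  rw [← cancel_epi p, hx, ← hy, Category.assoc, cokernel.condition, comp_zero, comp_zero]

end Saturation

/-! ### Bounded torsion, and existence of `L⁺`. -/

section TorsionBound

variable {C : Type w} [Category.{v} C] [Preadditive C] [HasZeroObject C] [HasShift C ℤ]
  [∀ n : ℤ, (shiftFunctor C n).Additive] [Pretriangulated C] [IsTriangulated C]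
variable {Λ : Type x} {lev : Λ → ℕ} {N D : Λ → C}
variable {E : Type u} [CommRing E] [IsDomain E] [Linear E C]
  [∀ n : ℤ, (shiftFunctor C n).Linear E] {t : TStructure C}
variable (ht : IsFamilyTStructure E N D t)
include ht

/-- The cone of `a` on `N l` lies in `T^{≥ 0}`, because the cones of irreducible elements were put
among its generators. So `a` is injective on morphisms from `T^{≤ 0}`. -/
theorem hom_nab_torsionFree [IsPrincipalIdealRing E] {S : C} [hS : t.IsLE S 0] {l : Λ} {a : E}
    (ha : a ≠ 0) (f : S ⟶ N l) (hf : a • f = 0) : f = 0 := by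
  obtain ⟨Z, g, h, hT⟩ := distinguished_cocone_triangle (a • 𝟙 (N l))
  have : t.IsGE Z 0 := by
    rw [ht.isGE_iff]
    refine extensionHull_mono (fun X hX => ?_) Z (extensionHull_irreducibleCone ha hT)
    exact ⟨l, trivial, X, 0, Or.inr hX, le_rfl, ⟨(shiftZeroIso X).symm⟩⟩
  exact IsTMono.of_dist (t := t) hT hS f (by simpa using hf)

theorem hom_nab_shift_torsionFree [IsPrincipalIdealRing E] {S : C} [t.IsLE S 0] {l : Λ} {a : E}
    (ha : a ≠ 0) {k : ℤ} (hk : k ≤ 0) (f : S ⟶ (N l)⟦k⟧) (hf : a • f = 0) : f = 0 := by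
  have : t.IsLE (S⟦-k⟧) 0 := by
    have := t.isLE_shift S 0 (-k) k
    exact t.isLE_of_le _ k 0
  let e := shiftShiftIso (N l) k (-k) 0 (by lia) ≪≫ shiftZeroIso (N l)
  have h : f⟦-k⟧' ≫ e.hom = 0 := by
    refine hom_nab_torsionFree ht ha _ ?_
    rw [← Linear.smul_comp, ← Functor.map_smul, hf, Functor.map_zero, zero_comp]
  refine (shiftFunctor C (-k)).map_injective ?_
  rw [← cancel_mono e.hom, h, Functor.map_zero, zero_comp]

variable [IsDiscreteValuationRing E]

/-- The torsion in the groups of morphisms from objects of `T^{≤ 0}` to an object of `T^{≥ 0}` is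
bounded. -/
theorem exists_torsion_bound {ϖ : E} (hϖ : Irreducible ϖ) (Q : C) [hQ : t.IsGE Q 0] :
    ∃ n : ℕ, ∀ S : C, t.IsLE S 0 → ∀ (f : S ⟶ Q) (m : ℕ), ϖ ^ m • f = 0 → ϖ ^ n • f = 0 := by
  rw [ht.isGE_iff] at hQ
  induction hQ with
  | of_mem X hX =>
    obtain ⟨l, -, Z, k, hZ | ⟨ϖ', g, h, hϖ', hT⟩, hk, ⟨e⟩⟩ := hX
    · subst hZ
      refine ⟨0, fun S hS f m hf => ?_⟩
      have : f = 0 := by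
        rw [← cancel_mono e.hom, zero_comp]
        refine hom_nab_shift_torsionFree ht (pow_ne_zero m hϖ.ne_zero) hk _ ?_
        rw [← Linear.smul_comp, hf, zero_comp]
      rw [this, smul_zero]
    · refine ⟨2, fun S hS f m hf => ?_⟩
      have h₁ : ϖ ^ 2 • 𝟙 Z = 0 := pow_smul_eq_zero_of_irreducible hϖ hϖ' (cone_sq_smul hT)
      have h₂ : ϖ ^ 2 • 𝟙 (Z⟦k⟧) = 0 := by
        rw [← CategoryTheory.Functor.map_id, ← Functor.map_smul, h₁, Functor.map_zero]
      rw [← cancel_mono e.hom, zero_comp, Linear.smul_comp, ← Category.comp_id (f ≫ e.hom),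
        ← Linear.comp_smul, h₂, comp_zero]
  | of_isZero X hX => exact ⟨0, fun S hS f m hf => hX.eq_of_tgt _ _⟩
  | ext T hT _ h₃ ih₁ ih₃ =>
    obtain ⟨X₁, X₂, X₃, i, p, δ⟩ := T
    obtain ⟨n₁, h₁⟩ := ih₁
    obtain ⟨n₃, h₃'⟩ := ih₃
    have : t.IsGE X₃ 0 := (ht.isGE_iff _).2 h₃
    have hi : IsTMono t i := .of_dist hT
    -- Bounds add up: `ϖ ^ n₃ • f` comes from `X₁`, and its lift is again torsion because `i` is
    -- injective on morphisms from `T^{≤ 0}`.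
    refine ⟨n₁ + n₃, fun S hS f m hf => ?_⟩
    have hp : ϖ ^ n₃ • (f ≫ p) = 0 := h₃' S hS _ m (by rw [← Linear.smul_comp, hf, zero_comp])
    obtain ⟨b, hb⟩ := dist_lift₂ hT (ϖ ^ n₃ • f) (by rw [Linear.smul_comp, hp])
    have hb' : ϖ ^ m • b = 0 := hi hS _ (by
      rw [Linear.smul_comp, hb, smul_comm, hf, smul_zero])
    rw [pow_add, mul_smul]
    refine (congrArg (ϖ ^ n₁ • ·) hb.symm).trans ?_
    change ϖ ^ n₁ • (b ≫ i) = 0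
    rw [← Linear.smul_comp, h₁ S hS b m hb', zero_comp]

theorem exists_heart_torsion_bound {ϖ : E} (hϖ : Irreducible ϖ) (Q : HeartCat t) :
    ∃ n : ℕ, ∀ (S : HeartCat t) (f : S ⟶ Q) (m : ℕ), ϖ ^ m • f = 0 → ϖ ^ n • f = 0 := by
  obtain ⟨n, hn⟩ := exists_torsion_bound ht hϖ Q.obj
  refine ⟨n, fun S f m hf => ?_⟩
  ext
  exact hn S.obj inferInstance f.hom m (congrArg (·.hom) hf)

theorem exists_isGreatest_torsionOver {Y : HeartCat t} (L : Subobject Y) :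
    ∃ M, IsGreatest (torsionOver E L) M := by
  obtain ⟨ϖ, hϖ⟩ := IsDiscreteValuationRing.exists_irreducible E
  obtain ⟨n, hn⟩ := exists_heart_torsion_bound ht hϖ (cokernel L.arrow)
  exact ⟨_, isGreatest_torsionOver hϖ hn⟩

theorem hom_cokernel_torsionFree {Y : HeartCat t} {L M : Subobject Y}
    (hM : IsGreatest (torsionOver E L) M) {ϖ : E} (hϖ : Irreducible ϖ) {S : C} [t.IsLE S 0]
    (f : S ⟶ (cokernel M.arrow).obj) (hf : ϖ • f = 0) : f = 0 := by
  obtain ⟨n, hn⟩ := exists_heart_torsion_bound ht hϖ (cokernel L.arrow)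
  obtain ⟨g, hg⟩ := exists_toH0_comp t S f
  have hg0 : (ObjectProperty.homMk g : (H0 t).obj S ⟶ cokernel M.arrow) = 0 := by
    refine hom_cokernel_eq_zero_of_isGreatest hϖ hn hM _ ?_
    ext
    refine isTEpi_toH0 t S inferInstance _ ?_
    change toH0 t S ≫ (ϖ • g) = 0
    rw [Linear.comp_smul, hg, hf]
  rw [← hg]
  exact (congrArg (toH0 t S ≫ ·) (congrArg (·.hom) hg0)).trans comp_zero

theorem hom_subobject_torsionFree {l : Λ} [t.IsGE (N l) 0] (M : Subobject ((H0 t).obj (N l)))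
    {ϖ : E} (hϖ : ϖ ≠ 0) {S : C} [hS : t.IsLE S 0] (f : S ⟶ (M : HeartCat t).obj)
    (hf : ϖ • f = 0) : f = 0 := by
  refine ((isTMono_of_mono M.arrow).comp (isTMono_fromH0 t (N l))) hS _ ?_
  refine hom_nab_torsionFree ht hϖ _ ?_
  rw [← Linear.smul_comp, hf, zero_comp]

end TorsionBound

/-! ### Exactness of a triangulated functor between two such t-structures. -/

section TriangulatedFunctor

variable {C : Type w} [Category.{v} C] [Preadditive C] [HasZeroObject C] [HasShift C ℤ]
  [∀ n : ℤ, (shiftFunctor C n).Additive] [Pretriangulated C]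
variable {C' : Type w'} [Category.{v'} C'] [Preadditive C'] [HasZeroObject C'] [HasShift C' ℤ]
  [∀ n : ℤ, (shiftFunctor C' n).Additive] [Pretriangulated C']
variable (G : C ⥤ C') [G.CommShift ℤ] [G.IsTriangulated]
variable {Λ : Type x} {lev : Λ → ℕ} {N D : Λ → C} {N' D' : Λ → C'}

theorem exists_map_dist {X Y Z : C} {f : X ⟶ Y} {g : Y ⟶ Z} {h : Z ⟶ X⟦(1 : ℤ)⟧}
    (hT : Triangle.mk f g h ∈ distTriang C) :
    ∃ δ, Triangle.mk (G.map f) (G.map g) δ ∈ distTriang C' :=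
  ⟨_, G.map_distinguished _ hT⟩

theorem triangulatedHull_map {P : ObjectProperty C} {Q : ObjectProperty C'} [Q.IsTriangulated]
    [Q.IsClosedUnderIsomorphisms] (h : ∀ X, P X → Q (G.obj X)) {X : C}
    (hX : triangulatedHull P X) : Q (G.obj X) := by
  have : (Q.inverseImage G).IsTriangulated :=
    { exists_zero := ⟨0, isZero_zero C, Q.prop_of_isZero (Functor.map_isZero _ (isZero_zero C))⟩
      isStableUnderShiftBy := fun a => ⟨fun X hX =>
        Q.prop_of_iso ((G.commShiftIso a).app X).symm (Q.le_shift a _ hX)⟩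
      toIsTriangulatedClosed₂ := .mk' fun T hT h₁ h₃ =>
        Q.ext_of_isTriangulatedClosed₂ _ (G.map_distinguished T hT) h₁ h₃ }
  exact triangulatedHull_le (Q := Q.inverseImage G) h X hX

variable (eN : ∀ l, G.obj (N l) ≅ N' l) (eD : ∀ l, G.obj (D l) ≅ D' l)

include eN in
theorem levelLT_map {m : ℕ} {X : C} (hX : levelLT lev N m X) : levelLT lev N' m (G.obj X) := by
  refine triangulatedHull_map G ?_ hX
  rintro _ ⟨l, hl, rfl⟩
  exact (levelLT lev N' m).prop_of_iso (eN l).symm (mem_levelLT lev N' hl)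

/-- The image of a morphism `D l ⟶ N l`, transported to the families `D'` and `N'`. -/
def mapHom {l : Λ} {X : C} {X' : C'} (e : G.obj X ≅ X') (c : X ⟶ N l) : X' ⟶ N' l :=
  e.inv ≫ G.map c ≫ (eN l).hom

theorem trW_mapHom {l : Λ} {X : C} {X' : C'} (e : G.obj X ≅ X') {c : X ⟶ N l}
    (hc : (levelLT lev N (lev l)).trW c) :
    (levelLT lev N' (lev l)).trW (mapHom G eN e c) := by
  obtain ⟨Z, g, h, hT, hZ⟩ := hc
  obtain ⟨δ, hT'⟩ := exists_map_dist G hT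
  refine ⟨G.obj Z, (eN l).inv ≫ G.map g, δ ≫ e.hom⟦(1 : ℤ)⟧',
    distinguished_of_isos hT' e.symm (eN l).symm (Iso.refl _) (by simp [mapHom]) (by simp) ?_,
    levelLT_map G eN hZ⟩
  rw [Category.assoc, ← Functor.map_comp]
  simp

include eN eD in
theorem isDualFamily_map (hD : IsDualFamily lev N D)
    (h : ∀ X Y : C, (∀ (n : ℤ) (f : X ⟶ Y⟦n⟧), f = 0) → ∀ f : G.obj X ⟶ G.obj Y, f = 0) :
    IsDualFamily lev N' D' where
  hom_lt l m hlm n f := by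
    let e : G.obj ((N m)⟦n⟧) ≅ (N' m)⟦n⟧ :=
      (G.commShiftIso n).app (N m) ≪≫ (shiftFunctor C' n).mapIso (eN m)
    rw [← cancel_epi (eD l).hom, ← cancel_mono e.inv, comp_zero, zero_comp]
    refine h _ _ (fun k g => ?_) _
    rw [← cancel_mono (shiftShiftIso (N m) n k _ rfl).hom, zero_comp]
    exact hD.hom_lt l m hlm _ _
  exists_canonical l := by
    obtain ⟨c, hc⟩ := hD.exists_canonical l
    exact ⟨_, trW_mapHom G eN (eD l) hc⟩

variable {O : Type u} [CommRing O] [Linear O C] {k : Type u'} [Field k] [Linear k C']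
  {t : TStructure C} {t' : TStructure C'}
variable (ht : IsFamilyTStructure O N D t) (ht' : IsFamilyTStructure k N' D' t')

section RightExact

include ht ht' eD

theorem isLE_map (X : C) [hX : t.IsLE X 0] : t'.IsLE (G.obj X) 0 := by
  rw [ht.isLE_iff] at hX
  rw [ht'.isLE_iff]
  refine extensionHull_map G ?_ hX
  rintro X ⟨l, -, n, hn, ⟨e⟩⟩
  exact .of_mem _ ⟨l, trivial, n, hn, ⟨G.mapIso e ≪≫ (G.commShiftIso n).app (D l) ≪≫
    (shiftFunctor C' n).mapIso (eD l)⟩⟩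

variable [IsTriangulated C]

theorem isTEpi_map_toH0 (X : C) [t.IsLE X 0] : IsTEpi t' (G.map (toH0 t X)) := by
  obtain ⟨A, hA, f, h, hT⟩ := exists_dist_toH0 t X
  obtain ⟨δ, hT'⟩ := exists_map_dist G hT
  have := t.isLE_of_le A (-1) 0
  have := isLE_map G eD ht ht' A
  exact .of_dist hT'

theorem isTEpi_map_of_epi {X Y : HeartCat t} (f : X ⟶ Y) [Epi f] : IsTEpi t' (G.map f.hom) := by
  obtain ⟨K, i, δ, hT⟩ := exists_dist_of_epi t f
  obtain ⟨δ', hT'⟩ := exists_map_dist G hT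
  have := isLE_map G eD ht ht' K.obj
  exact .of_dist hT'

end RightExact

include ht ht' eN in
-- `b` bounds the failure of left t-exactness, which only the cones can cause: `b = 0` serves for
-- the fraction field, `b = 1` for the residue field.
theorem isGE_map {b : ℤ} (hb : 0 ≤ b)
    (h : ∀ l Z, IsIrreducibleCone O (N l) Z → t'.IsGE (G.obj Z) (-b)) (X : C) [hX : t.IsGE X 0] :
    t'.IsGE (G.obj X) (-b) := by
  rw [ht.isGE_iff] at hX
  induction hX with
  | of_mem X hX =>
    obtain ⟨l, -, Z, n, hZ, hn, ⟨e⟩⟩ := hX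
    have hGZ : t'.IsGE (G.obj Z) (-b) := by
      rcases hZ with rfl | hZ
      · have := ht'.nab_isGE l
        have := t'.isGE_of_iso (eN l).symm 0
        exact t'.isGE_of_ge _ (-b) 0
      · exact h l Z hZ
    have : t'.IsGE ((G ⋙ shiftFunctor C' n).obj Z) (-b - n) :=
      t'.isGE_shift (G.obj Z) (-b) n (-b - n)
    have := t'.isGE_of_iso (G.mapIso e ≪≫ (G.commShiftIso n).app Z).symm (-b - n)
    exact t'.isGE_of_ge _ (-b) (-b - n)
  | of_isZero X hX =>
    exact t'.isGE_of_iso (Functor.map_isZero G hX).isoZero.symm (-b)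
  | ext T hT _ _ h₁ h₃ => exact t'.isGE₂ _ (G.map_distinguished T hT) _ h₁ h₃

/-- The image of a monomorphism of the heart whose cokernel stays in `T^{≥ 0}`. -/
theorem isTMono_map_of_mono [IsTriangulated C] {X Y : HeartCat t} (f : X ⟶ Y) [Mono f]
    [t'.IsGE (G.obj (cokernel f).obj) 0] : IsTMono t' (G.map f.hom) := by
  obtain ⟨δ, hT⟩ := exists_dist_of_mono t f
  obtain ⟨δ', hT'⟩ := exists_map_dist G hT
  exact .of_dist hT'

theorem isTMono_map_fromH0 [IsTriangulated C] (X : C) [t.IsGE X 0]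
    (h : ∀ Y : C, t.IsGE Y 1 → t'.IsGE (G.obj Y) 0) : IsTMono t' (G.map (fromH0 t X)) := by
  obtain ⟨B, hB, g, δ, hT⟩ := exists_dist_fromH0 t X
  obtain ⟨δ', hT'⟩ := exists_map_dist G hT
  have := h B hB
  exact .of_dist hT'

variable [IsTriangulated C'] [∀ n : ℤ, (shiftFunctor C' n).Linear k]

include eN in
-- Morphisms `X' ⟶ N' l` form a line over `k`. This makes the results independent of the choice of
-- canonical maps.
theorem exists_smul_mapHom (hN' : IsExceptionalFamily lev N' k) {l : Λ} {X : C} {X' : C'}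
    (e : G.obj X ≅ X') {c : X ⟶ N l} (hc : (levelLT lev N (lev l)).trW c) {c' : X' ⟶ N' l}
    (hc' : (levelLT lev N' (lev l)).trW c') :
    ∃ a : k, a ≠ 0 ∧ a • mapHom G eN e c = c' := by
  obtain ⟨a, ha⟩ := (hN'.bijective_smul_canonical (trW_mapHom G eN e hc)).2 c'
  refine ⟨a, ?_, ha⟩
  rintro rfl
  exact one_ne_zero ((hN'.bijective_smul_canonical hc').1
    (show (1 : k) • c' = (0 : k) • c' by rw [← ha]; simp))

include eN in
theorem exists_map_factorization (hN' : IsExceptionalFamily lev N' k) {l : Λ} {X : C} {X' : C'}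
    (e : G.obj X ≅ X') {c : X ⟶ N l} (hc : (levelLT lev N (lev l)).trW c) {c' : X' ⟶ N' l}
    (hc' : (levelLT lev N' (lev l)).trW c') {Z : C} {q : X ⟶ Z} {r : Z ⟶ N l} (hqr : q ≫ r = c) :
    ∃ (q' : X' ⟶ G.obj Z) (r' : G.obj Z ⟶ N' l), q' ≫ r' = c' ∧
      (IsTEpi t' (G.map q) → IsTEpi t' q') ∧ (IsTMono t' (G.map r) → IsTMono t' r') := by
  obtain ⟨a, ha, rfl⟩ := exists_smul_mapHom G eN hN' e hc hc'
  have : IsIso (a • 𝟙 (N' l)) := ⟨a⁻¹ • 𝟙 _, by simp [smul_smul, ha], by simp [smul_smul, ha]⟩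
  refine ⟨e.inv ≫ G.map q, G.map r ≫ (eN l).hom ≫ (a • 𝟙 _), ?_,
    fun h => (IsTEpi.of_epi _).comp h, fun h => h.comp (IsTMono.of_mono _)⟩
  rw [← hqr]
  simp [mapHom]

end TriangulatedFunctor

/-! ### Extension of scalars to the fraction field. -/

section GenericFunctor

variable {C : Type w} [Category.{v} C] [Preadditive C] [HasZeroObject C] [HasShift C ℤ]
  [∀ n : ℤ, (shiftFunctor C n).Additive] [Pretriangulated C]
variable {C' : Type w'} [Category.{v'} C'] [Preadditive C'] [HasZeroObject C'] [HasShift C' ℤ]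
  [∀ n : ℤ, (shiftFunctor C' n).Additive] [Pretriangulated C']
variable (G : C ⥤ C') [G.CommShift ℤ] [G.IsTriangulated]
variable {O : Type u} [CommRing O] [Linear O C] {k : Type u'} [Field k] [Algebra O k] [Linear k C']

theorem IsGenericFunctor.hom_eq_zero [G.Additive] (hG : IsGenericFunctor O k G) {X Y : C}
    (h : ∀ f : X ⟶ Y, f = 0) (f : G.obj X ⟶ G.obj Y) : f = 0 := by
  have : Subsingleton (X ⟶ Y) := ⟨fun a b => (h a).trans (h b).symm⟩
  obtain ⟨x, rfl⟩ := (hG.bijective X Y).2 f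
  rw [Subsingleton.elim x 0, map_zero]

theorem isZero_map_of_smul_id (hG : IsSemilinear O k G) {X : C} {a : O}
    (ha : algebraMap O k a ≠ 0) (h : a • 𝟙 X = 0) : IsZero (G.obj X) := by
  rw [IsZero.iff_id_eq_zero]
  have := hG X X a (𝟙 X)
  rw [h, Functor.map_zero, CategoryTheory.Functor.map_id] at this
  exact (smul_eq_zero_iff_right ha).1 this.symm

theorem nonempty_iso_map_ofLE [IsTriangulated C] {t : TStructure C} (hG : IsSemilinear O k G)
    {Y : HeartCat t} {L M : Subobject Y} (h : L ≤ M) {a : O} (ha : algebraMap O k a ≠ 0)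
    (h' : a • 𝟙 (cokernel (Subobject.ofLE L M h)) = 0) :
    Nonempty (G.obj (L : HeartCat t).obj ≅ G.obj (M : HeartCat t).obj) := by
  obtain ⟨δ, hT⟩ := exists_dist_of_mono t (Subobject.ofLE L M h)
  obtain ⟨δ', hT'⟩ := exists_map_dist G hT
  have : IsIso (G.map (Subobject.ofLE L M h).hom) := (Triangle.isZero₃_iff_isIso₁ _ hT').1
    (isZero_map_of_smul_id G hG ha (congrArg (·.hom) h'))
  exact ⟨asIso (G.map (Subobject.ofLE L M h).hom)⟩

/-- `ϖ ^ 2` kills the cone and becomes invertible in `k`, so the image of the cone is zero. -/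
theorem isGE_zero_map_irreducibleCone [FaithfulSMul O k] (hG : IsSemilinear O k G)
    {t' : TStructure C'} {X Z : C}
    [∀ n : ℤ, (shiftFunctor C n).Linear O] (hZ : IsIrreducibleCone O X Z) [IsDomain O] :
    t'.IsGE (G.obj Z) 0 := by
  obtain ⟨ϖ, g, h, hϖ, hT⟩ := hZ
  have : IsZero (G.obj Z) := isZero_map_of_smul_id G hG (a := ϖ ^ 2)
    (by simpa using hϖ.ne_zero) (cone_sq_smul hT)
  exact t'.isGE_of_iso this.isoZero.symm 0

theorem isGE_map_irreducibleCone
    {t' : TStructure C'} {X Z : C} [t'.IsGE (G.obj X) 0] (hZ : IsIrreducibleCone O X Z) :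
    t'.IsGE (G.obj Z) (-1) := by
  obtain ⟨ϖ, g, h, hϖ, hT⟩ := hZ
  have := t'.isGE_of_ge (G.obj X) (-1) 0
  have h₁ : t'.IsGE ((G ⋙ shiftFunctor C' (1 : ℤ)).obj X) (-1) :=
    t'.isGE_shift (G.obj X) 0 1 (-1)
  have h₂ := t'.isGE_of_iso ((G.commShiftIso (1 : ℤ)).app X).symm (-1)
  exact t'.isGE₂ _ (G.map_distinguished _ (dist_rotate hT)) (-1) this h₂

end GenericFunctor

/-! ### Reduction to the residue field and the `Tor₁` obstruction. -/

section ResidueFunctor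

/-- A finitely generated module without `ϖ`-torsion is torsion-free, hence free over a discrete
valuation ring. -/
theorem subsingleton_Tor1 {O : Type u} [CommRing O] [IsDomain O] [IsDiscreteValuationRing O]
    (k : Type u) [CommRing k] [Algebra O k] (M : Type u) [AddCommGroup M] [Module O M]
    [Module.Finite O M] {ϖ : O} (hϖ : Irreducible ϖ) (h : ∀ x : M, ϖ • x = 0 → x = 0)
    (x : (Tor1 O k).obj (ModuleCat.of O M)) : x = 0 := by
  have hpow : ∀ (n : ℕ) (x : M), ϖ ^ n • x = 0 → x = 0 := by
    intro n
    induction n with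
    | zero => simp
    | succ n ih =>
      intro x hx
      rw [pow_succ, mul_smul] at hx
      exact h x (ih _ hx)
  have : Module.IsTorsionFree O M := .of_smul_eq_zero fun a x hax => by
    by_contra! hcon
    obtain ⟨n, hn⟩ := IsDiscreteValuationRing.associated_pow_irreducible hcon.1 hϖ
    obtain ⟨b, hb⟩ := hn.dvd
    exact hcon.2 (hpow n x (by rw [hb, mul_comm, mul_smul, hax, smul_zero]))
  have : Module.Free O M := inferInstance
  have : Projective (ModuleCat.of O M) := inferInstance
  have hz := isZero_Tor_succ_of_projective (ModuleCat.{u} O) (ModuleCat.of O k) (ModuleCat.of O M) 0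
  have := ModuleCat.subsingleton_of_isZero hz
  exact Subsingleton.elim _ _

variable {C : Type w} [Category.{u} C] [Preadditive C] [HasZeroObject C] [HasShift C ℤ]
  [∀ n : ℤ, (shiftFunctor C n).Additive] [Pretriangulated C]
variable {C' : Type w'} [Category.{v'} C'] [Preadditive C'] [HasZeroObject C'] [HasShift C' ℤ]
  [∀ n : ℤ, (shiftFunctor C' n).Additive] [Pretriangulated C']
variable {O : Type u} [CommRing O] [IsDomain O] [IsDiscreteValuationRing O] [Linear O C]
  {k : Type u} [Field k] [Algebra O k] [Linear k C']
variable {G : C ⥤ C'} [G.CommShift ℤ] [G.IsTriangulated] (R : ResidueFunctorData O k G)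
include R

theorem ResidueFunctorData.hom_eq_zero {X Y : C} (h : ∀ f : X ⟶ Y, f = 0)
    [Module.Finite O (X ⟶ Y⟦(1 : ℤ)⟧)] {ϖ : O} (hϖ : Irreducible ϖ)
    (h' : ∀ f : X ⟶ Y⟦(1 : ℤ)⟧, ϖ • f = 0 → f = 0) (f : G.obj X ⟶ G.obj Y) : f = 0 := by
  have : Subsingleton (X ⟶ Y) := ⟨fun a b => (h a).trans (h b).symm⟩
  obtain ⟨x, rfl⟩ := (R.exact X Y f).1 (subsingleton_Tor1 k _ hϖ h' _)
  rw [Subsingleton.elim x 0, map_zero]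

variable {Λ : Type x} {N D : Λ → C} {N' D' : Λ → C'} (eD : ∀ l, G.obj (D l) ≅ D' l)
variable {t : TStructure C} {t' : TStructure C'} [∀ n : ℤ, (shiftFunctor C n).Linear O]
  (ht : IsFamilyTStructure O N D t) (ht' : IsFamilyTStructure k N' D' t')
  (hfin : ∀ X Y : C, Module.Finite O (X ⟶ Y))
include eD ht ht' hfin

/-- Test on `(D l)⟦n⟧` with `n ≥ 1`. Its morphisms to `X` vanish, and its morphisms to `X⟦1⟧` are
those from `(D l)⟦n - 1⟧` to `X`; this object is still in `T^{≤ 0}`, so they are torsion-free and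
`Tor₁` vanishes. -/
theorem ResidueFunctorData.isGE_map {X : C} [t.IsGE X 0] {ϖ : O} (hϖ : Irreducible ϖ)
    (hX : ∀ S : C, t.IsLE S 0 → ∀ f : S ⟶ X, ϖ • f = 0 → f = 0) : t'.IsGE (G.obj X) 0 := by
  rw [ht'.isGE_iff_del_hom]
  intro l n hn f
  let e : G.obj ((D l)⟦n⟧) ≅ (D' l)⟦n⟧ :=
    (G.commShiftIso n).app (D l) ≪≫ (shiftFunctor C' n).mapIso (eD l)
  rw [← cancel_epi e.hom, comp_zero]
  have := ht.del_isLE l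
  have := t.isLE_shift (D l) 0 n (-n)
  have hS : t.IsLE ((D l)⟦n - 1⟧) 0 := by
    have := t.isLE_shift (D l) 0 (n - 1) (1 - n)
    exact t.isLE_of_le _ (1 - n) 0
  have := hfin ((D l)⟦n⟧) (X⟦(1 : ℤ)⟧)
  refine R.hom_eq_zero (fun f => t.zero f (-n) 0) hϖ (fun g hg => ?_) _
  let e' := shiftShiftIso (D l) (n - 1) 1 n (by lia)
  obtain ⟨g', hg'⟩ := (shiftFunctor C (1 : ℤ)).map_surjective (e'.hom ≫ g)
  have h₀ : g' = 0 := by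
    refine hX _ hS _ ((shiftFunctor C (1 : ℤ)).map_injective ?_)
    rw [Functor.map_smul, hg', ← Linear.comp_smul, hg, comp_zero, Functor.map_zero]
  rw [← cancel_epi e'.hom, ← hg', h₀, Functor.map_zero, comp_zero]

end ResidueFunctor

/-! ### Tate twists as linear triangulated functors. -/

section Twist

variable {E : Type u} [CommRing E]
variable {C : Type w} [Category.{v} C] [Preadditive C] [Linear E C] [HasZeroObject C]
  [HasShift C ℤ] [∀ n : ℤ, (shiftFunctor C n).Additive] [Pretriangulated C]

/-- The functor `F` is linear and triangulated for a suitable choice of compatibilities with the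
shifts. -/
def IsLinearTriangulated (E : Type u) [CommRing E] [Linear E C] (F : C ⥤ C) : Prop :=
  (∃ _ : F.CommShift ℤ, F.IsTriangulated) ∧ F.Linear E

theorem IsLinearTriangulated.id : IsLinearTriangulated E (𝟭 C) :=
  ⟨⟨inferInstance, inferInstance⟩, inferInstance⟩

theorem IsLinearTriangulated.comp {F F' : C ⥤ C} (h : IsLinearTriangulated E F)
    (h' : IsLinearTriangulated E F') : IsLinearTriangulated E (F ⋙ F') := by
  obtain ⟨⟨_, _⟩, _⟩ := h
  obtain ⟨⟨_, _⟩, _⟩ := h'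
  exact ⟨⟨inferInstance, inferInstance⟩, inferInstance⟩

theorem IsLinearTriangulated.inverse {e : C ≌ C} (h : IsLinearTriangulated E e.functor) :
    IsLinearTriangulated E e.inverse := by
  obtain ⟨⟨_, _⟩, _⟩ := h
  let := e.commShiftInverse ℤ
  have := e.commShift_of_functor ℤ
  exact ⟨⟨inferInstance, (Equivalence.IsTriangulated.mk' e inferInstance).rightAdjoint_isTriangulated⟩, inferInstance⟩

theorem IsLinearTriangulated.powNat {e : C ≌ C} (h : IsLinearTriangulated E e.functor) :
    ∀ n : ℕ, IsLinearTriangulated E (e.powNat n).functor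
  | 0 => .id
  | 1 => h
  | n + 2 => h.comp (powNat h (n + 1))

variable (τ : TateTwist E C)

theorem isLinearTriangulated_twist (k : ℤ) : IsLinearTriangulated E (τ.twist k) := by
  have h : IsLinearTriangulated E τ.equiv.functor := ⟨⟨τ.commShift, τ.isTriangulated⟩, τ.linear⟩
  cases k with
  | ofNat n => exact h.powNat n
  | negSucc n => exact IsLinearTriangulated.powNat (e := τ.equiv.symm) h.inverse (n + 1)

/-- A choice of the compatibility of the Tate twists with the shifts. -/
noncomputable instance twistCommShift (k : ℤ) : (τ.twist k).CommShift ℤ :=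
  (isLinearTriangulated_twist τ k).1.choose

instance twist_isTriangulated (k : ℤ) : (τ.twist k).IsTriangulated :=
  (isLinearTriangulated_twist τ k).1.choose_spec

instance twist_linear (k : ℤ) : (τ.twist k).Linear E := (isLinearTriangulated_twist τ k).2

instance twist_isEquivalence (k : ℤ) : (τ.twist k).IsEquivalence :=
  inferInstanceAs (τ.equiv ^ k).functor.IsEquivalence

theorem nonempty_twist_succ (k : ℤ) (X : C) :
    Nonempty ((τ.twist k).obj (τ.equiv.functor.obj X) ≅ (τ.twist (k + 1)).obj X) := by
  -- The cases follow the recursion defining powers of an equivalence, which separates the exponents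
  -- `0`, `1` and `n + 2`.
  match k with
  | Int.ofNat 0 => exact ⟨Iso.refl _⟩
  | Int.ofNat (n + 1) => exact ⟨Iso.refl _⟩
  | Int.negSucc 0 => exact ⟨(τ.equiv.unitIso.app X).symm⟩
  | Int.negSucc (n + 1) =>
    exact ⟨(τ.equiv.symm.powNat (n + 1)).functor.mapIso (τ.equiv.unitIso.app X).symm⟩

theorem nonempty_twist_pred (k : ℤ) (X : C) :
    Nonempty ((τ.twist k).obj (τ.equiv.inverse.obj X) ≅ (τ.twist (k - 1)).obj X) := by
  obtain ⟨e⟩ := nonempty_twist_succ τ (k - 1) (τ.equiv.inverse.obj X)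
  rw [sub_add_cancel] at e
  exact ⟨e.symm ≪≫ (τ.twist (k - 1)).mapIso (τ.equiv.counitIso.app X)⟩

theorem nonempty_twist_twist (a b c : ℤ) (h : a + b = c) (X : C) :
    Nonempty ((τ.twist a).obj ((τ.twist b).obj X) ≅ (τ.twist c).obj X) := by
  subst h
  induction b using Int.induction_on generalizing X with
  | zero =>
    rw [add_zero]
    exact ⟨Iso.refl _⟩
  | succ b ih =>
    obtain ⟨e₁⟩ := nonempty_twist_succ τ b X
    obtain ⟨e₂⟩ := ih (τ.equiv.functor.obj X)
    obtain ⟨e₃⟩ := nonempty_twist_succ τ (a + b) X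
    rw [add_assoc] at e₃
    exact ⟨(τ.twist a).mapIso e₁.symm ≪≫ e₂ ≪≫ e₃⟩
  | pred b ih =>
    obtain ⟨e₁⟩ := nonempty_twist_pred τ (-b) X
    obtain ⟨e₂⟩ := ih (τ.equiv.inverse.obj X)
    obtain ⟨e₃⟩ := nonempty_twist_pred τ (a + -b) X
    rw [add_sub_assoc] at e₃
    exact ⟨(τ.twist a).mapIso e₁.symm ≪≫ e₂ ≪≫ e₃⟩

theorem nonempty_map_twist {E' : Type u'} [CommRing E'] {C' : Type w'} [Category.{v'} C']
    [Preadditive C'] [Linear E' C'] [HasZeroObject C'] [HasShift C' ℤ]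
    [∀ n : ℤ, (shiftFunctor C' n).Additive] [Pretriangulated C'] (τ' : TateTwist E' C')
    {G : C ⥤ C'} (h : τ.equiv.functor ⋙ G ≅ G ⋙ τ'.equiv.functor) (k : ℤ) (X : C) :
    Nonempty (G.obj ((τ.twist k).obj X) ≅ (τ'.twist k).obj (G.obj X)) := by
  induction k using Int.induction_on generalizing X with
  | zero => exact ⟨Iso.refl _⟩
  | succ k ih =>
    obtain ⟨e₁⟩ := nonempty_twist_succ τ k X
    obtain ⟨e₂⟩ := ih (τ.equiv.functor.obj X)
    obtain ⟨e₃⟩ := nonempty_twist_succ τ' k (G.obj X)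
    exact ⟨G.mapIso e₁.symm ≪≫ e₂ ≪≫ (τ'.twist k).mapIso (h.app X) ≪≫ e₃⟩
  | pred k ih =>
    obtain ⟨e₁⟩ := nonempty_twist_pred τ (-k) X
    obtain ⟨e₂⟩ := ih (τ.equiv.inverse.obj X)
    obtain ⟨e₃⟩ := nonempty_twist_pred τ' (-k) (G.obj X)
    let e : G.obj (τ.equiv.inverse.obj X) ≅ τ'.equiv.inverse.obj (G.obj X) :=
      τ'.equiv.unitIso.app _ ≪≫ τ'.equiv.inverse.mapIso
        ((h.app _).symm ≪≫ G.mapIso (τ.equiv.counitIso.app X))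
    exact ⟨G.mapIso e₁.symm ≪≫ e₂ ≪≫ (τ'.twist (-k)).mapIso e ≪≫ e₃⟩

theorem twist_hom_eq_zero {X Y : C} {n : ℤ} {a b : ℤ}
    (h : ∀ f : X ⟶ (τ.twist (b - a)).obj (Y⟦n⟧), f = 0)
    (f : (τ.twist a).obj X ⟶ ((τ.twist b).obj Y)⟦n⟧) : f = 0 := by
  obtain ⟨e⟩ := nonempty_twist_twist τ a (b - a) b (by lia) (Y⟦n⟧)
  let e' : ((τ.twist b).obj Y)⟦n⟧ ≅ (τ.twist a).obj ((τ.twist (b - a)).obj (Y⟦n⟧)) :=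
    (((τ.twist b).commShiftIso n).app Y).symm ≪≫ e.symm
  obtain ⟨g, hg⟩ := (τ.twist a).map_surjective (f ≫ e'.hom)
  rw [← cancel_mono e'.hom, ← hg, h g, Functor.map_zero, zero_comp]

theorem finite_hom (hfin : IsGradedHomFinite τ) (X Y : C) : Module.Finite E (X ⟶ Y) := by
  have := hfin X Y
  exact Module.Finite.of_surjective
    (DirectSum.component E ℤ (fun k => X ⟶ (τ.twist k).obj Y) 0)
    (fun f => ⟨DirectSum.lof E ℤ (fun k => X ⟶ (τ.twist k).obj Y) 0 f,
      DirectSum.component.lof_self _ _ _⟩)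

/-- `φ` is only a module isomorphism, so the identity must be shown to generate. For the generator
`g`, writing `g = 𝟙 ≫ g` in terms of `g` gives `φ 𝟙 * φ (g ≫ g) = 1`, so `φ 𝟙` is a unit. -/
theorem bijective_smul_id_of_linearEquiv {X : C} (φ : (X ⟶ X) ≃ₗ[E] E) :
    Function.Bijective fun a : E => a • 𝟙 X := by
  obtain ⟨g, hg⟩ := φ.surjective 1
  have key : ∀ f : X ⟶ X, φ f • g = f := fun f => φ.injective (by simp [hg])
  have h₁ : (φ (𝟙 X) * φ (g ≫ g)) = 1 := by
    have : φ (𝟙 X) • (φ (g ≫ g) • g) = g := by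
      rw [key, ← Linear.smul_comp, key, Category.id_comp]
    have := congrArg φ this
    simpa [hg] using this
  refine ⟨fun a b hab => ?_, fun f => ⟨φ f * φ (g ≫ g), ?_⟩⟩
  · have h₂ := congrArg φ hab
    simp only [map_smul, smul_eq_mul] at h₂
    calc a = a * φ (𝟙 X) * φ (g ≫ g) := by rw [mul_assoc, h₁, mul_one]
      _ = b := by rw [h₂, mul_assoc, h₁, mul_one]
  · refine φ.injective ?_
    simp only [map_smul, smul_eq_mul]
    rw [mul_assoc, mul_comm (φ (g ≫ g)), h₁, mul_one]

end Twist

/-! ### From graded sequences to families indexed by `I × ℤ`. -/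

section Bridge

variable {E : Type u} [CommRing E]
variable {C : Type w} [Category.{v} C] [Preadditive C] [Linear E C] [HasZeroObject C]
  [HasShift C ℤ] [∀ n : ℤ, (shiftFunctor C n).Additive] [Pretriangulated C]
variable {I : Type x} [LinearOrder I] (τ : TateTwist E C) (nab del : I → C) (f : I ↪o ℕ)

/-- The family of all Tate twists of the objects of a family. -/
def twistFamily (p : I × ℤ) : C := (τ.twist p.2).obj (nab p.1)

/-- The level of a twisted object. -/
def twistLevel (p : I × ℤ) : ℕ := f p.1

theorem Tlt_eq (i : I) : Tlt τ nab i = levelLT (twistLevel f) (twistFamily τ nab) (f i) := by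
  refine le_antisymm (triangulatedHull_mono ?_) (triangulatedHull_mono ?_)
  · rintro X ⟨j, hj, k, rfl⟩
    exact ⟨(j, k), f.lt_iff_lt.2 hj, rfl⟩
  · rintro X ⟨⟨j, k⟩, hj, rfl⟩
    exact ⟨j, f.lt_iff_lt.1 hj, k, rfl⟩

theorem Tle_eq (i : I) : Tle τ nab i = levelLT (twistLevel f) (twistFamily τ nab) (f i + 1) := by
  refine le_antisymm (triangulatedHull_mono ?_) (triangulatedHull_mono ?_)
  · rintro X ⟨j, hj, k, rfl⟩
    exact ⟨(j, k), Nat.lt_succ_of_le (f.le_iff_le.2 hj), rfl⟩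
  · rintro X ⟨⟨j, k⟩, hj, rfl⟩
    exact ⟨j, f.le_iff_le.1 (Nat.le_of_lt_succ hj), k, rfl⟩

variable {τ nab del}

theorem isExceptionalFamily_twist (h : IsGradedExceptional τ nab) :
    IsExceptionalFamily (twistLevel f) (twistFamily τ nab) E where
  hom_ne := by
    rintro ⟨i, a⟩ ⟨j, b⟩ hij hne n φ
    refine twist_hom_eq_zero τ (fun g => ?_) φ
    rcases (f.le_iff_le.1 hij).lt_or_eq with hlt | heq
    · exact h.hom_lt i j hlt _ _ g
    · obtain rfl : i = j := heq
      refine h.hom_self i _ _ (fun h' => hne ?_) g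
      rw [show a = b by have := h'.2; lia]
  hom_self := by
    rintro ⟨i, a⟩ n hn φ
    exact twist_hom_eq_zero τ (fun g => h.hom_self i _ _ (fun h' => hn h'.1) g) φ
  bijective_smul_id := by
    rintro ⟨i, a⟩
    have h₁ := bijective_smul_id_of_linearEquiv (h.end_self i).some
    have h₂ : Function.Bijective ((τ.twist a).map : (nab i ⟶ nab i) → _) :=
      ⟨(τ.twist a).map_injective, (τ.twist a).map_surjective⟩
    have h₃ : (fun r : E => r • 𝟙 ((τ.twist a).obj (nab i))) =
        (τ.twist a).map ∘ fun r : E => r • 𝟙 (nab i) := by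
      funext r
      simp
    exact h₃ ▸ h₂.comp h₁
  generates X := triangulatedHull_mono
    (by rintro X ⟨j, -, k, rfl⟩; exact ⟨(j, k), rfl⟩) X (h.generates X)

theorem extensionHull_genLE : extensionHull (genLE τ del) =
    extensionHull (nonnegShifts (twistFamily τ del) Set.univ) := by
  refine le_antisymm (a := (extensionHull (genLE τ del) : ObjectProperty C))
    (extensionHull_le ?_) (extensionHull_le ?_)
  · rintro X ⟨j, n, k, hn, rfl⟩
    exact .of_mem _ ⟨(j, k), trivial, n, hn, ⟨((τ.twist k).commShiftIso n).app _⟩⟩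
  · rintro X ⟨⟨j, k⟩, -, n, hn, ⟨e⟩⟩
    exact extensionHull_of_iso ((((τ.twist k).commShiftIso n).app (del j)) ≪≫ e.symm)
      (.of_mem _ ⟨j, n, k, hn, rfl⟩)

theorem isIrreducibleCone_twist {X Z : C} (k : ℤ) (hZ : IsIrreducibleCone E X Z) :
    IsIrreducibleCone E ((τ.twist k).obj X) ((τ.twist k).obj Z) := by
  obtain ⟨ϖ, g, h, hϖ, hT⟩ := hZ
  obtain ⟨δ, hT'⟩ := exists_map_dist (τ.twist k) hT
  rw [Functor.map_smul, CategoryTheory.Functor.map_id] at hT'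
  exact ⟨ϖ, _, δ, hϖ, hT'⟩

theorem extensionHull_genGE : extensionHull (genGE τ nab) =
    extensionHull (coneShifts E (twistFamily τ nab) Set.univ 0) := by
  refine le_antisymm (a := (extensionHull (genGE τ nab) : ObjectProperty C))
    (extensionHull_le ?_) (extensionHull_le ?_)
  · rintro X (⟨j, n, k, hn, rfl⟩ | ⟨j, ϖ, Z, g, h, hϖ, hT, n, k, hn, rfl⟩)
    · exact .of_mem _ ⟨(j, k), trivial, _, n, Or.inl rfl, hn,
        ⟨((τ.twist k).commShiftIso n).app _⟩⟩
    · exact .of_mem _ ⟨(j, k), trivial, _, n,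
        Or.inr (isIrreducibleCone_twist k ⟨ϖ, g, h, hϖ, hT⟩), hn,
        ⟨((τ.twist k).commShiftIso n).app _⟩⟩
  · rintro X ⟨⟨j, k⟩, -, Z, n, rfl | ⟨ϖ, g, h, hϖ, hT⟩, hn, ⟨e⟩⟩
    · exact extensionHull_of_iso ((((τ.twist k).commShiftIso n).app (nab j)) ≪≫ e.symm)
        (.of_mem _ (Or.inl ⟨j, n, k, hn, rfl⟩))
    -- `genGE` contains twists of cones rather than cones on twisted objects; uniqueness of cones
    -- identifies the two.
    · obtain ⟨Z', g', h', hT'⟩ := distinguished_cocone_triangle (ϖ • 𝟙 (nab j))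
      obtain ⟨δ, hT''⟩ := exists_map_dist (τ.twist k) hT'
      rw [Functor.map_smul, CategoryTheory.Functor.map_id] at hT''
      obtain ⟨ε⟩ := iso_of_dist hT'' hT
      exact extensionHull_of_iso ((((τ.twist k).commShiftIso n).app Z') ≪≫
        (shiftFunctor C n).mapIso ε ≪≫ e.symm)
        (.of_mem _ (Or.inr ⟨j, ϖ, Z', g', h', hϖ, hT', n, k, hn, rfl⟩))

theorem isExcTStructure_iff (t : TStructure C) : IsExcTStructure τ nab del t ↔
    IsFamilyTStructure E (twistFamily τ nab) (twistFamily τ del) t :=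
  ⟨fun h => ⟨h.le_zero.trans extensionHull_genLE, h.ge_zero.trans extensionHull_genGE⟩,
    fun h => ⟨h.le_zero.trans extensionHull_genLE.symm, h.ge_zero.trans extensionHull_genGE.symm⟩⟩

end Bridge

/-! ### Canonical maps as morphisms with cone in `T_{< i}`. -/

section CanonicalMaps

variable {E : Type u} [CommRing E]
variable {C : Type w} [Category.{v} C] [Preadditive C] [Linear E C] [HasZeroObject C]
  [HasShift C ℤ] [∀ n : ℤ, (shiftFunctor C n).Additive] [Pretriangulated C] [IsTriangulated C]
variable {I : Type x} [LinearOrder I] {τ : TateTwist E C} {nab del : I → C} (f : I ↪o ℕ)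

instance Tlt_isTriangulated (i : I) : (Tlt τ nab i).IsTriangulated :=
  triangulatedHull_isTriangulated _

instance Tlt_closedUnderIso (i : I) : (Tlt τ nab i).IsClosedUnderIsomorphisms :=
  triangulatedHull_closedUnderIso _

instance Tle_closedUnderIso (i : I) : (Tle τ nab i).IsClosedUnderIsomorphisms :=
  triangulatedHull_closedUnderIso _

instance Pi_isLocalization (i : I) :
    (Pi τ nab i).IsLocalization ((Tlt τ nab i).inverseImage (Tle τ nab i).ι).trW :=
  inferInstanceAs ((verdierW τ nab i).Q.IsLocalization (verdierW τ nab i))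

theorem Tlt_le_Tle (i : I) : Tlt τ nab i ≤ Tle τ nab i :=
  triangulatedHull_mono fun _ ⟨j, hj, k, e⟩ => ⟨j, le_of_lt hj, k, e⟩

/-- Morphisms to an object which is orthogonal to `T_{< i}` are the same in `T_{≤ i}` and in the
Verdier quotient. -/
theorem Pi_map_bijective {i : I} {X Y : (Tle τ nab i).FullSubcategory}
    (hY : ∀ Z : C, Tlt τ nab i Z → ∀ g : Z ⟶ Y.obj, g = 0) :
    Function.Bijective ((Pi τ nab i).map : (X ⟶ Y) → _) := by
  have h : ((Tlt τ nab i).inverseImage (Tle τ nab i).ι).rightOrthogonal Y := fun Z g hZ => by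
    ext
    exact hY _ hZ g.hom
  exact rightOrthogonal.map_bijective_of_isTriangulated h (Pi τ nab i) X

theorem isCanonicalMap_of_trW {i : I} {c : del i ⟶ nab i} (hc : (Tlt τ nab i).trW c) :
    IsCanonicalMap τ nab del c := by
  obtain ⟨Z, g, h, hT, hZ⟩ := hc
  have hdel : Tle τ nab i (del i) := (Tle τ nab i).ext_of_isTriangulatedClosed₁ _ hT
    (nab_mem_Tle τ nab i) (Tlt_le_Tle i Z hZ)
  refine ⟨hdel, ?_⟩
  -- The Verdier quotient needs a cone formed in `T_{≤ i}`; in the ambient category it is isomorphic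
  -- to `Z`.
  obtain ⟨Z', g', h', hT'⟩ := distinguished_cocone_triangle
    (ObjectProperty.homMk c : (⟨del i, hdel⟩ : (Tle τ nab i).FullSubcategory) ⟶
      ⟨nab i, nab_mem_Tle τ nab i⟩)
  obtain ⟨δ, hT''⟩ := exists_map_dist (Tle τ nab i).ι hT'
  obtain ⟨ε⟩ := iso_of_dist hT hT''
  exact (verdierW τ nab i).Q_inverts _ ⟨Z', g', h', hT', (Tlt τ nab i).prop_of_iso ε hZ⟩

variable (hN : IsExceptionalFamily (twistLevel f) (twistFamily τ nab) E)
include hN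

theorem Tlt_hom_eq_zero {i : I} {p : I × ℤ} (hp : f i ≤ f p.1) {Z : C} (hZ : Tlt τ nab i Z)
    (n : ℤ) (g : Z ⟶ (twistFamily τ nab p)⟦n⟧) : g = 0 := by
  rw [Tlt_eq τ nab f] at hZ
  exact hN.levelLT_hom (p := p) hp hZ n g

theorem Tlt_hom_nab_eq_zero {i : I} {Z : C} (hZ : Tlt τ nab i Z) (g : Z ⟶ nab i) : g = 0 := by
  have := Tlt_hom_eq_zero f hN (p := (i, 0)) le_rfl hZ 0 (g ≫ (shiftZeroIso (nab i)).inv)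
  rw [← cancel_mono (shiftZeroIso (nab i)).inv, zero_comp]
  exact this

/-- `∇_i` is right orthogonal to `T_{< i}`, so the given isomorphism in the quotient comes from a
morphism of `T_{≤ i}`. -/
theorem exists_isCanonicalMap (h : IsDualSequence τ nab del) (i : I) :
    ∃ c : del i ⟶ nab i, IsCanonicalMap τ nab del c := by
  obtain ⟨hdel, ⟨e⟩⟩ := h.quotient i
  obtain ⟨c, hc⟩ := (Pi_map_bijective (X := ⟨del i, hdel⟩) (Y := ⟨nab i, nab_mem_Tle τ nab i⟩)
    (fun Z hZ g => Tlt_hom_nab_eq_zero f hN hZ g)).2 e.hom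
  refine ⟨c.hom, hdel, ?_⟩
  change IsIso ((Pi τ nab i).map c)
  rw [hc]
  infer_instance

omit hN in
theorem IsCanonicalMap.comp_bijective {i : I} {c : del i ⟶ nab i}
    (hc : IsCanonicalMap τ nab del c) {Y : C} (hY : Tle τ nab i Y)
    (hY' : ∀ Z : C, Tlt τ nab i Z → ∀ g : Z ⟶ Y, g = 0) :
    Function.Bijective fun g : nab i ⟶ Y => c ≫ g := by
  obtain ⟨hdel, hiso⟩ := hc
  let Y' : (Tle τ nab i).FullSubcategory := ⟨Y, hY⟩
  let del' : (Tle τ nab i).FullSubcategory := ⟨del i, hdel⟩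
  let nab' : (Tle τ nab i).FullSubcategory := ⟨nab i, nab_mem_Tle τ nab i⟩
  let c' : del' ⟶ nab' := ObjectProperty.homMk c
  have : IsIso ((Pi τ nab i).map c') := hiso
  have h₁ := Pi_map_bijective (X := del') (Y := Y') hY'
  have h₂ := Pi_map_bijective (X := nab') (Y := Y') hY'
  constructor
  · intro a b hab
    have : (ObjectProperty.homMk a : nab' ⟶ Y') = ObjectProperty.homMk b := by
      refine h₂.1 ?_
      rw [← cancel_epi ((Pi τ nab i).map c'), ← Functor.map_comp, ← Functor.map_comp]
      congr 1
      ext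
      exact hab
    exact congrArg (·.hom) this
  · intro b
    obtain ⟨a, ha⟩ := h₂.2 (inv ((Pi τ nab i).map c') ≫
      (Pi τ nab i).map (ObjectProperty.homMk b : del' ⟶ Y'))
    have : c' ≫ a = ObjectProperty.homMk b := by
      refine h₁.1 ?_
      rw [Functor.map_comp, ha, IsIso.hom_inv_id_assoc]
    exact ⟨a.hom, congrArg (·.hom) this⟩

/-- Composition with `c` is bijective on morphisms to all shifts of objects of the level of `i`. So
the cone has no morphisms to that level, and `mem_levelLT_of_hom_nab` applies. -/
theorem IsCanonicalMap.trW {i : I} {c : del i ⟶ nab i} (hc : IsCanonicalMap τ nab del c) :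
    (levelLT (twistLevel f) (twistFamily τ nab) (f i)).trW c := by
  obtain ⟨Z, g, h, hT⟩ := distinguished_cocone_triangle c
  refine ⟨Z, g, h, hT, hN.mem_levelLT_of_hom_nab ?_ ?_⟩
  · rw [← Tle_eq τ nab f]
    exact (Tle τ nab i).ext_of_isTriangulatedClosed₃ _ hT hc.choose (nab_mem_Tle τ nab i)
  · intro p hp n a
    have bij (n : ℤ) : Function.Bijective
        fun b : nab i ⟶ (twistFamily τ nab p)⟦n⟧ => c ≫ b := by
      refine hc.comp_bijective ?_ fun Z hZ b => Tlt_hom_eq_zero f hN (by exact hp.ge) hZ n b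
      refine (Tle τ nab i).le_shift n _ ?_
      exact le_triangulatedHull _ _ ⟨p.1, f.le_iff_le.1 hp.le, p.2, rfl⟩
    have ha : g ≫ a = 0 := (bij n).1 (by
      change c ≫ g ≫ a = c ≫ 0
      rw [← Category.assoc, dist_comp₁₂ hT, zero_comp, comp_zero])
    obtain ⟨b, rfl⟩ := dist_desc₃ hT a ha
    let e := shiftShiftIso (twistFamily τ nab p) (n - 1) 1 n (by lia)
    obtain ⟨b', hb'⟩ := (shiftFunctor C (1 : ℤ)).map_surjective (b ≫ e.inv)
    obtain ⟨d, rfl⟩ := (bij (n - 1)).2 b'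
    rw [← cancel_mono e.inv, Category.assoc, ← hb', Functor.map_comp,
      reassoc_of% (dist_comp₃₁ hT), zero_comp, zero_comp]

theorem isCanonicalMap_iff {i : I} {c : del i ⟶ nab i} : IsCanonicalMap τ nab del c ↔
    (levelLT (twistLevel f) (twistFamily τ nab) (f i)).trW c :=
  ⟨fun h => h.trW f hN, fun h => isCanonicalMap_of_trW (by rwa [Tlt_eq τ nab f])⟩

omit hN in
theorem levelLT_twist (k : ℤ) {m : ℕ} {X : C}
    (hX : levelLT (twistLevel f) (twistFamily τ nab) m X) :
    levelLT (twistLevel f) (twistFamily τ nab) m ((τ.twist k).obj X) := by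
  refine triangulatedHull_map (τ.twist k) ?_ hX
  rintro _ ⟨⟨j, a⟩, hj, rfl⟩
  obtain ⟨e⟩ := nonempty_twist_twist τ k a _ rfl (nab j)
  exact prop_of_iso _ e.symm
    (mem_levelLT (twistLevel f) (twistFamily τ nab) (l := (j, k + a)) hj)

theorem isDualFamily_twist (h : IsDualSequence τ nab del) :
    IsDualFamily (twistLevel f) (twistFamily τ nab) (twistFamily τ del) where
  hom_lt := by
    rintro ⟨j, a⟩ ⟨i, b⟩ hij n φ
    exact twist_hom_eq_zero τ (fun g => h.hom_lt i j (f.lt_iff_lt.1 hij) _ _ g) φ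
  exists_canonical := by
    rintro ⟨i, k⟩
    obtain ⟨c, hc⟩ := exists_isCanonicalMap f hN h i
    obtain ⟨Z, g, h, hT, hZ⟩ := hc.trW f hN
    obtain ⟨δ, hT'⟩ := exists_map_dist (τ.twist k) hT
    exact ⟨(τ.twist k).map c, _, _, δ, hT', levelLT_twist f k hZ⟩

end CanonicalMaps

/-! ### The canonical map factored through `L` or `L⁺`. -/

section ImageFactorization

variable {C : Type w} [Category.{v} C] [Preadditive C] [HasZeroObject C] [HasShift C ℤ]
  [∀ n : ℤ, (shiftFunctor C n).Additive] [Pretriangulated C] [IsTriangulated C] (t : TStructure C)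

/-- The subobject `im(H⁰(X) ⟶ H⁰(Y))` of `H⁰(Y)`. -/
noncomputable abbrev imageH0 {X Y : C} (c : X ⟶ Y) : Subobject ((H0 t).obj Y) :=
  imageSubobject ((H0 t).map c)

theorem toH0_factor_arrow {X Y : C} [t.IsLE X 0] [t.IsGE Y 0] (c : X ⟶ Y)
    {M : Subobject ((H0 t).obj Y)} (h : imageH0 t c ≤ M) :
    (toH0 t X ≫ (factorThruImageSubobject ((H0 t).map c) ≫ Subobject.ofLE _ M h).hom) ≫
      M.arrow.hom ≫ fromH0 t Y = c := by
  have h₁ : (factorThruImageSubobject ((H0 t).map c) ≫ Subobject.ofLE _ M h) ≫ M.arrow =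
      (H0 t).map c := by
    rw [Category.assoc, Subobject.ofLE_arrow, imageSubobject_arrow_comp]
  have h₂ : (factorThruImageSubobject ((H0 t).map c) ≫ Subobject.ofLE _ M h).hom ≫ M.arrow.hom =
      ((H0 t).map c).hom := congrArg (·.hom) h₁
  rw [Category.assoc, reassoc_of% h₂, toH0_H0_map_fromH0]

end ImageFactorization

/-! ### Images of `L` and `L⁺` under a change of scalars. -/

section BaseChange

variable {C : Type w} [Category.{v} C] [Preadditive C] [HasZeroObject C] [HasShift C ℤ]
  [∀ n : ℤ, (shiftFunctor C n).Additive] [Pretriangulated C] [IsTriangulated C]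
variable {C' : Type w'} [Category.{v'} C'] [Preadditive C'] [HasZeroObject C'] [HasShift C' ℤ]
  [∀ n : ℤ, (shiftFunctor C' n).Additive] [Pretriangulated C'] [IsTriangulated C']
variable {G : C ⥤ C'} [G.CommShift ℤ] [G.IsTriangulated]
variable {O : Type u} [CommRing O] [IsDomain O] [IsDiscreteValuationRing O] [Linear O C]
  [∀ n : ℤ, (shiftFunctor C n).Linear O]
  {k : Type u'} [Field k] [Algebra O k] [Linear k C'] [∀ n : ℤ, (shiftFunctor C' n).Linear k]
variable {Λ : Type x} {lev : Λ → ℕ} {N D : Λ → C} {N' D' : Λ → C'}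
  (eN : ∀ l, G.obj (N l) ≅ N' l) (eD : ∀ l, G.obj (D l) ≅ D' l)
variable {t : TStructure C} {t' : TStructure C'}
  (ht : IsFamilyTStructure O N D t) (ht' : IsFamilyTStructure k N' D' t')
variable (hN' : IsExceptionalFamily lev N' k) (hD' : IsDualFamily lev N' D')
variable {l : Λ} {c : D l ⟶ N l} (hc : (levelLT lev N (lev l)).trW c)
  {c' : D' l ⟶ N' l} (hc' : (levelLT lev N' (lev l)).trW c')

include eD ht ht' in
theorem isTEpi_map_image : letI := ht.del_isLE l
    IsTEpi t' (G.map (toH0 t (D l) ≫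
      (factorThruImageSubobject ((H0 t).map c) ≫ Subobject.ofLE _ _ (le_refl (imageH0 t c))).hom)) := by
  have := ht.del_isLE l
  have h₁ := isTEpi_map_toH0 G eD ht ht' (D l)
  have : Epi (Subobject.ofLE _ _ (le_refl (imageH0 t c))) := by
    rw [Subobject.ofLE_refl]
    infer_instance
  have : Epi (factorThruImageSubobject ((H0 t).map c) ≫
      Subobject.ofLE _ _ (le_refl (imageH0 t c))) := epi_comp _ _
  have h₂ := isTEpi_map_of_epi G eD ht ht' (factorThruImageSubobject ((H0 t).map c) ≫
    Subobject.ofLE _ _ (le_refl (imageH0 t c)))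
  rw [G.map_comp]
  exact h₁.comp h₂

include ht ht' eN in
-- At most one degree is lost, since the cone of a uniformizer on `N p` is sent to an extension of
-- `(N' p)⟦1⟧` by `N' p`.
theorem isGE_zero_map_of_isGE_one (Y : C) (hY : t.IsGE Y 1) : t'.IsGE (G.obj Y) 0 := by
  have h₁ := t.isGE_shift Y 1 1 0
  have h₂ : t'.IsGE ((shiftFunctor C (1 : ℤ) ⋙ G).obj Y) (-1) :=
    isGE_map G eN ht ht' (b := 1) zero_le_one (fun p Z hZ => by
    have := ht'.nab_isGE p
    have := t'.isGE_of_iso (eN p).symm 0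
    exact isGE_map_irreducibleCone G hZ) (Y⟦(1 : ℤ)⟧)
  have h₃ : t'.IsGE ((G.obj Y)⟦(1 : ℤ)⟧) (-1) := t'.isGE_of_iso ((G.commShiftIso (1 : ℤ)).app Y) (-1)
  exact t'.isGE_of_shift (G.obj Y) 0 1 (-1)

include ht ht' eN in
theorem isTMono_map_subobject [t.IsGE (N l) 0] (M : Subobject ((H0 t).obj (N l)))
    [t'.IsGE (G.obj (cokernel M.arrow).obj) 0] :
    IsTMono t' (G.map (M.arrow.hom ≫ fromH0 t (N l))) := by
  rw [G.map_comp]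
  exact (isTMono_map_of_mono G M.arrow).comp
    (isTMono_map_fromH0 G (N l) (isGE_zero_map_of_isGE_one eN ht ht'))

include eN eD ht ht' hN' hc hc' in
/-- After inverting the uniformizer, the image of `L` is `L`. -/
theorem nonempty_iso_map_imageH0 [FaithfulSMul O k] (hG : IsSemilinear O k G) :
    Nonempty (G.obj (imageH0 t c : HeartCat t).obj ≅ (imageH0 t' c' : HeartCat t').obj) := by
  have := ht.del_isLE l
  have := ht.nab_isGE l
  have := ht'.del_isLE l
  have := ht'.nab_isGE l
  -- The cones become zero, so the bound `b = 0` is available and `G` is t-exact.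
  have hge (X : C) [t.IsGE X 0] : t'.IsGE (G.obj X) 0 :=
    isGE_map G eN ht ht' (b := 0) le_rfl
      (fun p Z hZ => isGE_zero_map_irreducibleCone G hG hZ) X
  have h₁ := isLE_map G eD ht ht' (imageH0 t c : HeartCat t).obj
  have h₂ := hge (imageH0 t c : HeartCat t).obj
  have h₃ := hge (cokernel (imageH0 t c).arrow).obj
  obtain ⟨q, r, hqr, hq, hr⟩ := exists_map_factorization (t' := t') G eN hN' (eD l) hc hc'
    (toH0_factor_arrow t c (le_refl (imageH0 t c)))
  obtain ⟨e⟩ := nonempty_iso_image_H0 (Z := ⟨_, (t'.mem_heart_iff _).2 ⟨h₁, h₂⟩⟩) hqr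
    (hq (isTEpi_map_image eD ht ht')) (hr (isTMono_map_subobject eN ht ht' _))
  exact ⟨t'.heart.ι.mapIso e⟩

theorem nonempty_iso_map_torsionOver [FaithfulSMul O k] (hG : IsSemilinear O k G) {Y : HeartCat t}
    {L M : Subobject Y} (hM : M ∈ torsionOver O L) :
    Nonempty (G.obj (L : HeartCat t).obj ≅ G.obj (M : HeartCat t).obj) := by
  obtain ⟨h, ϖ, hϖ, n, -, hn⟩ := hM
  exact nonempty_iso_map_ofLE G hG h (by simpa using fun h => (hϖ.ne_zero h).elim) hn

end BaseChange

/-! ### Head and socle of the reductions to the residue field. -/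

section ResidueField

variable {C : Type w} [Category.{u} C] [Preadditive C] [HasZeroObject C] [HasShift C ℤ]
  [∀ n : ℤ, (shiftFunctor C n).Additive] [Pretriangulated C] [IsTriangulated C]
variable {C' : Type w'} [Category.{v'} C'] [Preadditive C'] [HasZeroObject C'] [HasShift C' ℤ]
  [∀ n : ℤ, (shiftFunctor C' n).Additive] [Pretriangulated C'] [IsTriangulated C']
variable {G : C ⥤ C'} [G.CommShift ℤ] [G.IsTriangulated]
variable {O : Type u} [CommRing O] [IsDomain O] [IsDiscreteValuationRing O] [Linear O C]
  [∀ n : ℤ, (shiftFunctor C n).Linear O]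
  {k : Type u} [Field k] [Algebra O k] [Linear k C'] [∀ n : ℤ, (shiftFunctor C' n).Linear k]
variable {Λ : Type x} {lev : Λ → ℕ} {N D : Λ → C} {N' D' : Λ → C'}
  (R : ResidueFunctorData O k G) (hfin : ∀ X Y : C, Module.Finite O (X ⟶ Y))
  (eN : ∀ l, G.obj (N l) ≅ N' l) (eD : ∀ l, G.obj (D l) ≅ D' l)
variable {t : TStructure C} {t' : TStructure C'}
  (ht : IsFamilyTStructure O N D t) (ht' : IsFamilyTStructure k N' D' t')
variable (hN' : IsExceptionalFamily lev N' k) (hD' : IsDualFamily lev N' D')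
variable {l : Λ} {c : D l ⟶ N l} (hc : (levelLT lev N (lev l)).trW c)
  {c' : D' l ⟶ N' l} (hc' : (levelLT lev N' (lev l)).trW c')

include R hfin eD ht ht'

/-- Subobjects of `H⁰(N l)` inherit the torsion-freeness of `N l`, so their reductions stay in `T^{≥
0}`. -/
theorem heart_map_subobject (M : Subobject ((H0 t).obj (N l))) :
    t'.heart (G.obj (M : HeartCat t).obj) := by
  have := ht.nab_isGE l
  obtain ⟨ϖ, hϖ⟩ := IsDiscreteValuationRing.exists_irreducible O
  exact (t'.mem_heart_iff _).2 ⟨isLE_map G eD ht ht' _, R.isGE_map eD ht ht' hfin hϖ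
    fun S _ f hf => hom_subobject_torsionFree ht M hϖ.ne_zero f hf⟩

include eN hN' hD' hc hc'

omit R hfin in
theorem hasSimpleHead_map_imageH0 (h : t'.heart (G.obj (imageH0 t c : HeartCat t).obj)) :
    HasSimpleHead (⟨_, h⟩ : HeartCat t') (imageH0 t' c' : HeartCat t') := by
  have := ht.del_isLE l
  have := ht.nab_isGE l
  obtain ⟨q, r, hqr, hq, -⟩ := exists_map_factorization (t' := t') G eN hN' (eD l) hc hc'
    (toH0_factor_arrow t c (le_refl (imageH0 t c)))
  exact hasSimpleHead_image hN' hD' ht' hc' (Z := ⟨_, h⟩) hqr (hq (isTEpi_map_image eD ht ht'))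

/-- The quotient by the saturated subobject `M` is torsion-free, so its reduction stays in `T^{≥ 0}`
and `M ⟶ N l` remains mono-like. The quotient by `L` may have torsion; for `L` it is right exactness
that controls the head. -/
theorem hasSimpleSocle_map_torsionOver {M : Subobject ((H0 t).obj (N l))}
    (hM : IsGreatest (torsionOver O (imageH0 t c)) M)
    (h : t'.heart (G.obj (M : HeartCat t).obj)) :
    HasSimpleSocle (⟨_, h⟩ : HeartCat t') (imageH0 t' c' : HeartCat t') := by
  have := ht.del_isLE l
  have := ht.nab_isGE l
  obtain ⟨ϖ, hϖ⟩ := IsDiscreteValuationRing.exists_irreducible O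
  have : t'.IsGE (G.obj (cokernel M.arrow).obj) 0 := R.isGE_map eD ht ht' hfin hϖ
    fun S _ f hf => hom_cokernel_torsionFree ht hM hϖ f hf
  obtain ⟨q, r, hqr, -, hr⟩ := exists_map_factorization (t' := t') G eN hN' (eD l) hc hc'
    (toH0_factor_arrow t c hM.1.choose)
  exact hasSimpleSocle_image hN' hD' ht' hc' (Z := ⟨_, h⟩) hqr
    (hr (isTMono_map_subobject eN ht ht' M))

end ResidueField

end ExcSeq

/-! ### The main theorem. -/

open ExcSeq in
theorem mainTheorem10
    -- a complete discrete valuation ring, its fraction field and its residue field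
    {O : Type u} [CommRing O] [IsDomain O] [IsDiscreteValuationRing O]
    [IsAdicComplete (IsLocalRing.maximalIdeal O) O]
    {K : Type u'} [Field K] [Algebra O K] [IsFractionRing O K]
    -- the `O`-linear triangulated category `TO`
    {TO : Type w} [Category.{u} TO] [Preadditive TO] [Linear O TO] [HasZeroObject TO]
    [HasShift TO ℤ] [∀ n : ℤ, (shiftFunctor TO n).Additive]
    [∀ n : ℤ, (shiftFunctor TO n).Linear O] [Pretriangulated TO] [IsTriangulated TO]
    -- the `K`-linear triangulated category `TK`
    {TK : Type w'} [Category.{v'} TK] [Preadditive TK] [Linear K TK] [HasZeroObject TK]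
    [HasShift TK ℤ] [∀ n : ℤ, (shiftFunctor TK n).Additive]
    [∀ n : ℤ, (shiftFunctor TK n).Linear K] [Pretriangulated TK] [IsTriangulated TK]
    -- the triangulated category `TF`, linear over the residue field
    {TF : Type w''} [Category.{v''} TF] [Preadditive TF]
    [Linear (IsLocalRing.ResidueField O) TF] [HasZeroObject TF]
    [HasShift TF ℤ] [∀ n : ℤ, (shiftFunctor TF n).Additive]
    [∀ n : ℤ, (shiftFunctor TF n).Linear (IsLocalRing.ResidueField O)]
    [Pretriangulated TF] [IsTriangulated TF]
    -- Tate twists, and graded Hom-finiteness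
    (τO : TateTwist O TO) (τK : TateTwist K TK) (τF : TateTwist (IsLocalRing.ResidueField O) TF)
    (finO : IsGradedHomFinite τO) (finK : IsGradedHomFinite τK) (finF : IsGradedHomFinite τF)
    -- the graded exceptional sequence over `O` and its dual sequence
    {I : Type x} [LinearOrder I] (nab del : I → TO)
    (excO : IsGradedExceptional τO nab) (dualO : IsDualSequence τO nab del)
    -- the functor `K(-)`
    (FK : TO ⥤ TK) [FK.CommShift ℤ] [FK.IsTriangulated]
    (twistK : τO.equiv.functor ⋙ FK ≅ FK ⋙ τK.equiv.functor)
    (genericK : IsGenericFunctor O K FK)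
    -- the functor `F(-)`
    (FF : TO ⥤ TF) [FF.CommShift ℤ] [FF.IsTriangulated]
    (twistF : τO.equiv.functor ⋙ FF ≅ FF ⋙ τF.equiv.functor)
    (residueF : ResidueFunctorData O (IsLocalRing.ResidueField O) FF)
    -- the images of the exceptional sequence are exceptional sequences
    (excK : IsGradedExceptional τK fun i => FK.obj (nab i))
    (excF : IsGradedExceptional τF fun i => FF.obj (nab i)) :
    -- the three t-structures exist
    (∃ tO : TStructure TO, IsExcTStructure τO nab del tO) ∧
    (∃ tK : TStructure TK,
      IsExcTStructure τK (fun i => FK.obj (nab i)) (fun i => FK.obj (del i)) tK) ∧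
    (∃ tF : TStructure TF,
      IsExcTStructure τF (fun i => FF.obj (nab i)) (fun i => FF.obj (del i)) tF) ∧
    ∀ (tO : TStructure TO) (tK : TStructure TK) (tF : TStructure TF),
      IsExcTStructure τO nab del tO →
      IsExcTStructure τK (fun i => FK.obj (nab i)) (fun i => FK.obj (del i)) tK →
      IsExcTStructure τF (fun i => FF.obj (nab i)) (fun i => FF.obj (del i)) tF →
      ∀ i : I,
        -- the canonical maps exist
        (∃ cO : del i ⟶ nab i, IsCanonicalMap τO nab del cO) ∧
        (∃ cK : FK.obj (del i) ⟶ FK.obj (nab i),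
          IsCanonicalMap τK (fun i => FK.obj (nab i)) (fun i => FK.obj (del i)) (i := i) cK) ∧
        (∃ cF : FF.obj (del i) ⟶ FF.obj (nab i),
          IsCanonicalMap τF (fun i => FF.obj (nab i)) (fun i => FF.obj (del i)) (i := i) cF) ∧
        ∀ (cO : del i ⟶ nab i) (cK : FK.obj (del i) ⟶ FK.obj (nab i))
          (cF : FF.obj (del i) ⟶ FF.obj (nab i)),
          IsCanonicalMap τO nab del cO →
          IsCanonicalMap τK (fun i => FK.obj (nab i)) (fun i => FK.obj (del i)) (i := i) cK →
          IsCanonicalMap τF (fun i => FF.obj (nab i)) (fun i => FF.obj (del i)) (i := i) cF →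
          -- the subobject `L_i⁺(O)` exists
          (∃ Lp : Subobject ((H0 tO).obj (nab i)), IsLplus O tO cO Lp) ∧
          ∀ Lp : Subobject ((H0 tO).obj (nab i)), IsLplus O tO cO Lp →
            -- `K(L_i(O)) ≅ K(L_i⁺(O)) ≅ L_i(K)`
            Nonempty (FK.obj (Lobj tO cO).obj ≅ FK.obj (Lp : HeartCat tO).obj) ∧
            Nonempty (FK.obj (Lp : HeartCat tO).obj ≅
              (Lobj (nab := fun i => FK.obj (nab i)) (del := fun i => FK.obj (del i))
                (i := i) tK cK).obj) ∧
            -- `F(L_i(O))` lies in the heart, with simple head `L_i(F)`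
            (∃ h : tF.heart (FF.obj (Lobj tO cO).obj),
              HasSimpleHead (⟨FF.obj (Lobj tO cO).obj, h⟩ : HeartCat tF)
                (Lobj (nab := fun i => FF.obj (nab i)) (del := fun i => FF.obj (del i))
                  (i := i) tF cF)) ∧
            -- `F(L_i⁺(O))` lies in the heart, with simple socle `L_i(F)`
            (∃ h : tF.heart (FF.obj (Lp : HeartCat tO).obj),
              HasSimpleSocle (⟨FF.obj (Lp : HeartCat tO).obj, h⟩ : HeartCat tF)
                (Lobj (nab := fun i => FF.obj (nab i)) (del := fun i => FF.obj (del i))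
                  (i := i) tF cF)) := by
  obtain ⟨f⟩ := excO.order
  have hNO := isExceptionalFamily_twist f excO
  have hDO := isDualFamily_twist f hNO dualO
  have hNK := isExceptionalFamily_twist f excK
  have hNF := isExceptionalFamily_twist f excF
  have hfin := finite_hom τO finO
  obtain ⟨ϖ, hϖ⟩ := IsDiscreteValuationRing.exists_irreducible O
  have hom_of_shift {X Y : TO} (h : ∀ (n : ℤ) (g : X ⟶ Y⟦n⟧), g = 0) (g : X ⟶ Y) : g = 0 := by
    rw [← cancel_mono (shiftZeroIso Y).inv, zero_comp]
    exact h 0 _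
  have eK (X : I → TO) (p : I × ℤ) : Nonempty (FK.obj (twistFamily τO X p) ≅
      twistFamily τK (fun i => FK.obj (X i)) p) := nonempty_map_twist τO τK twistK p.2 (X p.1)
  have eF (X : I → TO) (p : I × ℤ) : Nonempty (FF.obj (twistFamily τO X p) ≅
      twistFamily τF (fun i => FF.obj (X i)) p) := nonempty_map_twist τO τF twistF p.2 (X p.1)
  have eNK p := (eK nab p).some
  have eDK p := (eK del p).some
  have eNF p := (eF nab p).some
  have eDF p := (eF del p).some
  -- Duality over `K` and over the residue field is inherited from `O`: both functors preserve the
  -- vanishing of all shifted morphism groups.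
  have hDK := isDualFamily_map FK eNK eDK hDO fun X Y h =>
    genericK.hom_eq_zero FK (hom_of_shift h)
  have hDF := isDualFamily_map FF eNF eDF hDO fun X Y h => by
    have := hfin X (Y⟦(1 : ℤ)⟧)
    exact residueF.hom_eq_zero (hom_of_shift h) hϖ fun g _ => h 1 g
  refine ⟨?_, ?_, ?_, ?_⟩
  · obtain ⟨t, h₁, h₂⟩ := exists_tStructure hNO hDO
    exact ⟨t, (isExcTStructure_iff t).2 ⟨h₁, h₂⟩⟩
  · obtain ⟨t, h₁, h₂⟩ := exists_tStructure hNK hDK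
    exact ⟨t, (isExcTStructure_iff t).2 ⟨h₁, h₂⟩⟩
  · obtain ⟨t, h₁, h₂⟩ := exists_tStructure hNF hDF
    exact ⟨t, (isExcTStructure_iff t).2 ⟨h₁, h₂⟩⟩
  intro tO tK tF htO htK htF i
  rw [isExcTStructure_iff] at htO htK htF
  refine ⟨exists_isCanonicalMap f hNO dualO i, ?_, ?_, ?_⟩
  -- The index `(i, 0)` stands for the untwisted object, as the twist by `0` is the identity by
  -- definition.
  · obtain ⟨c, hc⟩ := hDK.exists_canonical (i, 0)
    exact ⟨c, (isCanonicalMap_iff f hNK).2 hc⟩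
  · obtain ⟨c, hc⟩ := hDF.exists_canonical (i, 0)
    exact ⟨c, (isCanonicalMap_iff f hNF).2 hc⟩
  intro cO cK cF hcO hcK hcF
  have hcO := (isCanonicalMap_iff f hNO).1 hcO
  have hcK := (isCanonicalMap_iff f hNK).1 hcK
  have hcF := (isCanonicalMap_iff f hNF).1 hcF
  refine ⟨exists_isGreatest_torsionOver htO (Lsub tO cO), fun Lp hLp => ?_⟩
  have : FaithfulSMul O K := (faithfulSMul_iff_algebraMap_injective O K).2
    (IsFractionRing.injective O K)
  obtain ⟨e₁⟩ := nonempty_iso_map_torsionOver genericK.semilinear hLp.1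
  obtain ⟨e₂⟩ := nonempty_iso_map_imageH0 (l := (i, 0)) eNK eDK htO htK hNK hcO hcK
    genericK.semilinear
  refine ⟨⟨e₁⟩, ⟨e₁.symm ≪≫ e₂⟩, ?_, ?_⟩
  · exact ⟨heart_map_subobject (l := (i, 0)) residueF hfin eDF htO htF _,
      hasSimpleHead_map_imageH0 (l := (i, 0)) eNF eDF htO htF hNF hDF hcO hcF _⟩
  · exact ⟨heart_map_subobject (l := (i, 0)) residueF hfin eDF htO htF _,
      hasSimpleSocle_map_torsionOver (l := (i, 0)) residueF hfin eNF eDF htO htF hNF hDF hcO hcF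
        hLp _⟩
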